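/- Let $k$ be an algebraically closed field of characteristic $p>0$ and let $G=\alpha_p=\operatorname{Spec}k[\epsilon]/(\epsilon^p)$ act on $V=\operatorname{Spec}k[x,y]$ by the coaction $x\mapsto x$, $y\mapsto y+x\epsilon$; thus $V/G=\operatorname{Spec}k[x,y^p]\cong\mathbb A^2_k$. **The ring.** Let $K$ be any quotient of the Grothendieck ring of $k$-varieties in which universally homeomorphic varieties have the same class, $\mathbb L=[\mathbb A^1_k]$, and let $\hat{\mathcal M}'$ be the completion of $K[\mathbb L^{-1}]$ for the filtration by the subgroups $F^n$ generated by the $[X]\mathbb L^i$ with $\dim X+i\le-n$. **Arcs.** Let $\Delta_G\subset k((t))$ be the set of Laurent series having only terms of degree prime to $p$. For $f\in\Delta_G$ let $K_f=k((t))[z]/(z^p-f)$ with the coaction $z\mapsto z+\epsilon$; let $\mathcal O_f$ be the integral closure of $k[[t]]$ in $K_f$ if $f\ne0$, and $\mathcal O_0=k[[t]][z]/(z^p)$. Let $\operatorname{Hom}^G(\operatorname{Spec}\mathcal O_f,V)$ be the set of morphisms $\operatorname{Spec}\mathcal O_f\to V$ whose composite with $\operatorname{Spec}K_f\to\operatorname{Spec}\mathcal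 O_f$ is $G$-equivariant, and $$\mathcal J_\infty\mathcal V=\bigsqcup_{f\in\Delta_G}\operatorname{Hom}^G(\operatorname{Spec}\mathcal O_f,V).$$ An element $\gamma$ over $f$ is given by $x\mapsto a$, $y\mapsto b+az$ with $a\in t^{s(\gamma)}k[[t]]$ and $b\in k[[t]]$, where $s(\gamma)=\max\{0,\lceil-\operatorname{ord}(f)/p\rceil\}$ ($=0$ if $f=0$); put $\operatorname{ord}(x)(\gamma)=\operatorname{ord}(a)\in\mathbb Z\cup\{\infty\}$. Let $J_\infty(V/G)$ be the set of morphisms $\operatorname{Spec}k[[t]]\to V/G$, and let $\psi\colon\mathcal J_\infty\mathcal V\to J_\infty(V/G)$ be the map induced by taking $G$-quotients; explicitly $(f,a,b)\mapsto(a,b^p+fa^p)$. **Measures.** A cylinder of level $m$ in $J_\infty(V/G)$ is the preimage of a constructible set $Z$ under truncation of the images of $x$ and $y^p$ modulo $t^{m+1}$; its measure is $[Z]\mathbb L^{-2m}$. A cylinder of level $(m,n)$ in $\mathcal J_\infty\mathcal V$ ($m,n\ge0$) is a set of $\gamma=(f,a,b)$ on which $\operatorname{ord}(f)$ is bounded below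 and which is the preimage of a constructible set $Z$ under truncation of $f$ modulo $t^{np}$, of $a$ modulo $t^{s(\gamma)+m+1}$ and of $b$ modulo $t^{m+1}$; its measure is $[Z]\mathbb L^{-2m-(p-1)n}$. The dimension of the measure $[Z]\mathbb L^{-e}$ is $\dim Z-e$. A set $A$ is measurable if there are cylinders $C_i,B_i$ ($i\ge1$) with $A\mathbin\triangle C_i\subseteq B_i$ for all $i$ and $\mu(B_i)\to0$ (that is, the dimension of $\mu(B_i)$ tends to $-\infty$), and then $\mu(A)=\lim\mu(C_i)\in\hat{\mathcal M}'$. A function $u\colon A\to\mathbb Z$ on a set $A$ is measurable if all its fibres are, and then $$\int_A\mathbb L^{u}\,d\mu=\sum_{n\in\mathbb Z}\mu(u^{-1}(n))\,\mathbb L^n\in\hat{\mathcal M}'\cup\{\infty\}.$$ The sum is said to converge if for every $N$ all but finitely many of the sets $u^{-1}(n)$ lie in a cylinder whose measure has dimension at most $N-n$; otherwise the integral is $\infty$. Loci where an exponent is $\pm\infty$ are omitted from the domain of integration. **Theorem.** Let $C\subset J_\infty(V/G)$ be a subset and $F\colon C\to\mathbb Z$ a measurable function. 1. The function $F\circ\psi-s-(p-1)\operatorname{ord}(x)$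 on $\psi^{-1}(C)\cap\{\operatorname{ord}(x)<\infty\}$ is measurable if and only if $s$ is bounded on each of its fibres over $\mathbb Z$. 2. If this function is measurable, then $$\int_C\mathbb L^F\,d\mu_{V/G}=\int_{\psi^{-1}(C)}\mathbb L^{F\circ\psi-s-(p-1)\operatorname{ord}(x)}\,d\mu_{\mathcal V}\quad\text{in }\hat{\mathcal M}'\cup\{\infty\};$$ in particular one integral converges if and only if the other does. 3. In particular, $$\mathbb L^2=M_{\mathrm{st}}(V/G)=\int_{J_\infty(V/G)}1\,d\mu_{V/G}=\int_{\mathcal J_\infty\mathcal V}\mathbb L^{-s-(p-1)\operatorname{ord}(x)}\,d\mu_{\mathcal V},$$ where $M_{\mathrm{st}}(V/G)=\int_{J_\infty(V/G)}\mathbb L^{\operatorname{ord}\mathcal J}\,d\mu_{V/G}$ and $\mathcal J$ is the ideal with $\mathcal J\,\omega_{V/G}=\operatorname{Im}(\Omega^2_{V/G}\to\omega_{V/G})$. -/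

import Mathlib

open AlgebraicGeometry CategoryTheory TensorProduct

universe u v

noncomputable section

namespace AlphaP

/-! ### Grothendieck rings of varieties and their dimensional completions -/

section Grothendieck

variable (k : Type u) [Field k]

/-- A `k`-variety: a separated scheme of finite type over `k`. -/
structure Variety where
  carrier : Scheme.{u}
  hom : carrier ⟶ Spec (CommRingCat.of k)
  locallyOfFiniteType : LocallyOfFiniteType hom
  quasiCompact : QuasiCompact hom
  isSeparated : IsSeparated hom

/-- The scheme `𝔸^ι` over `k`. -/
abbrev affineScheme (ι : Type) : Scheme.{u} := Spec (CommRingCat.of (MvPolynomial ι k))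

/-- The structure morphism of `𝔸^ι`. -/
abbrev affineHom (ι : Type) : affineScheme k ι ⟶ Spec (CommRingCat.of k) :=
  Spec.map (CommRingCat.ofHom (MvPolynomial.C : k →+* MvPolynomial ι k))

/-- Affine space `𝔸^ι` as a `k`-variety. -/
def affineVariety (ι : Type) [Finite ι] : Variety k where
  carrier := affineScheme k ι
  hom := affineHom k ι
  locallyOfFiniteType := by
    rw [HasRingHomProperty.Spec_iff (P := @LocallyOfFiniteType)]
    have h : (algebraMap k (MvPolynomial ι k)).FiniteType :=
      RingHom.finiteType_algebraMap.mpr inferInstance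
    exact h
  quasiCompact := inferInstance
  isSeparated := inferInstance

/-- The elements of the free commutative ring on all `k`-varieties that are set equal to zero:
scissor relations, products, the class of the point, and invariance under universal
homeomorphisms (a special case of which is invariance under isomorphisms). -/
inductive IsRelation : FreeCommRing (Variety k) → Prop
  | iso (X Y : Variety k) (e : X.carrier ≅ Y.carrier) (he : e.hom ≫ Y.hom = X.hom) :
      IsRelation (FreeCommRing.of X - FreeCommRing.of Y)
  | scissor (X Z U : Variety k) (i : Z.carrier ⟶ X.carrier) (j : U.carrier ⟶ X.carrier)
      (hi : IsClosedImmersion i) (hj : IsOpenImmersion j)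
      (hik : i ≫ X.hom = Z.hom) (hjk : j ≫ X.hom = U.hom)
      (hc : Set.range j = (Set.range i)ᶜ) :
      IsRelation (FreeCommRing.of X - FreeCommRing.of Z - FreeCommRing.of U)
  | prod (X Y P : Variety k) (a : P.carrier ⟶ X.carrier) (b : P.carrier ⟶ Y.carrier)
      (hP : IsPullback a b X.hom Y.hom) (hk : a ≫ X.hom = P.hom) :
      IsRelation (FreeCommRing.of P - FreeCommRing.of X * FreeCommRing.of Y)
  | point (X : Variety k) (hX : IsIso X.hom) : IsRelation (FreeCommRing.of X - 1)
  | univHomeo (X Y : Variety k) (g : Y.carrier ⟶ X.carrier) (hk : g ≫ X.hom = Y.hom)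
      (h₁ : UniversallyInjective g) (h₂ : Surjective g) (h₃ : UniversallyClosed g) :
      IsRelation (FreeCommRing.of Y - FreeCommRing.of X)

/-- A version of the Grothendieck ring of `k`-varieties: the one in which universally homeomorphic
varieties have the same class, and in which the additional relations `E` (an arbitrary set,
possibly empty) are imposed. -/
abbrev GrothendieckRing (E : Set (FreeCommRing (Variety k))) : Type (u + 1) :=
  FreeCommRing (Variety k) ⧸ Ideal.span ({x | IsRelation k x} ∪ E)

variable {k}

/-- The class `[X]`. -/
def classOf (E : Set (FreeCommRing (Variety k))) (X : Variety k) : GrothendieckRing k E :=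
  Ideal.Quotient.mk _ (FreeCommRing.of X)

/-- `𝕃 = [𝔸¹]`. -/
def lefschetz (E : Set (FreeCommRing (Variety k))) : GrothendieckRing k E :=
  classOf E (affineVariety k (Fin 1))

/-- The localization `ℳ' = K₀[𝕃⁻¹]`. -/
abbrev LocalizedRing (E : Set (FreeCommRing (Variety k))) : Type (u + 1) :=
  Localization.Away (lefschetz E)

/-- `𝕃` as a unit of `ℳ'`. -/
def lefschetzUnit (E : Set (FreeCommRing (Variety k))) : (LocalizedRing E)ˣ :=
  (IsLocalization.Away.algebraMap_isUnit (S := LocalizedRing E) (lefschetz E)).unit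

/-- `𝕃 ^ i` in `ℳ'`, for an integer `i`. -/
def lefschetzPow (E : Set (FreeCommRing (Variety k))) (i : ℤ) : LocalizedRing E :=
  ((lefschetzUnit E ^ i : (LocalizedRing E)ˣ) : LocalizedRing E)

theorem lefschetzPow_add (E : Set (FreeCommRing (Variety k))) (i j : ℤ) :
    lefschetzPow E (i + j) = lefschetzPow E i * lefschetzPow E j := by
  simp [lefschetzPow, zpow_add]

/-- The dimension filtration: `F n` is generated by the `[X] 𝕃 ^ i` with `dim X + i ≤ -n`. -/
def dimFiltration (E : Set (FreeCommRing (Variety k))) (n : ℤ) : AddSubgroup (LocalizedRing E) :=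
  AddSubgroup.closure {x | ∃ (X : Variety k) (i : ℤ),
    (∀ d : ℕ, (d : WithBot ℕ∞) ≤ topologicalKrullDim X.carrier → (d : ℤ) + i ≤ -n) ∧
    x = algebraMap _ _ (classOf E X) * lefschetzPow E i}

theorem dimFiltration_succ_le (E : Set (FreeCommRing (Variety k))) (n : ℤ) :
    dimFiltration E (n + 1) ≤ dimFiltration E n := by
  refine AddSubgroup.closure_mono ?_
  rintro x ⟨X, i, h, rfl⟩
  exact ⟨X, i, fun d hd => by have := h d hd; omega, rfl⟩

theorem mul_lefschetzPow_mem (E : Set (FreeCommRing (Variety k))) (i n : ℤ)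
    {x : LocalizedRing E} (hx : x ∈ dimFiltration E (n + i)) :
    x * lefschetzPow E i ∈ dimFiltration E n := by
  induction hx using AddSubgroup.closure_induction with
  | mem x hx =>
    obtain ⟨X, j, h, rfl⟩ := hx
    refine AddSubgroup.subset_closure ⟨X, j + i, fun d hd => ?_, ?_⟩
    · have := h d hd
      omega
    · rw [lefschetzPow_add, mul_assoc]
  | zero => simp
  | add x y _ _ hx hy => rw [add_mul]; exact add_mem hx hy
  | neg x _ hx => rw [neg_mul]; exact neg_mem hx

/-- The transition map `ℳ' / F (n + 1) → ℳ' / F n`. -/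
def transition (E : Set (FreeCommRing (Variety k))) (n : ℤ) :
    LocalizedRing E ⧸ dimFiltration E (n + 1) →+ LocalizedRing E ⧸ dimFiltration E n :=
  QuotientAddGroup.map _ _ (AddMonoidHom.id _) (dimFiltration_succ_le E n)

/-- The completion `lim ℳ' / F n` of `ℳ'`. Only its additive group, its topology and the
multiplication by powers of `𝕃` are needed. -/
def completion (E : Set (FreeCommRing (Variety k))) :
    AddSubgroup (∀ n : ℤ, LocalizedRing E ⧸ dimFiltration E n) where
  carrier := {x | ∀ n, transition E n (x (n + 1)) = x n}
  add_mem' := fun {x y} hx hy n => by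
    simp only [Pi.add_apply, map_add]
    rw [hx n, hy n]
  zero_mem' := fun n => by simp
  neg_mem' := fun {x} hx n => by
    simp only [Pi.neg_apply, map_neg]
    rw [hx n]

/-- The completed Grothendieck group of varieties, denoted `ℳ̂'`. -/
def Completed (E : Set (FreeCommRing (Variety k))) : Type (u + 1) := completion E

instance (E : Set (FreeCommRing (Variety k))) : AddCommGroup (Completed E) :=
  inferInstanceAs (AddCommGroup (completion E))

/-- The topology of the inverse limit, all the `ℳ' / F n` being discrete. -/
instance (E : Set (FreeCommRing (Variety k))) : TopologicalSpace (Completed E) :=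
  TopologicalSpace.induced
    (fun x : Completed E => (x.1 : ∀ n : ℤ, LocalizedRing E ⧸ dimFiltration E n))
    (@Pi.topologicalSpace ℤ (fun n => LocalizedRing E ⧸ dimFiltration E n) (fun _ => ⊥))

/-- The canonical map `ℳ' → ℳ̂'`. -/
def toCompleted (E : Set (FreeCommRing (Variety k))) : LocalizedRing E →+ Completed E where
  toFun x := (⟨fun _ => QuotientAddGroup.mk x, fun _ => rfl⟩ : completion E)
  map_zero' := rfl
  map_add' _ _ := rfl

theorem quotient_map_comm {A : Type v} [AddCommGroup A] {P P' Q Q' : AddSubgroup A} (g : A →+ A)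
    (hP : P ≤ P'.comap (AddMonoidHom.id A)) (hQ : Q ≤ Q'.comap (AddMonoidHom.id A))
    (h : P ≤ Q.comap g) (h' : P' ≤ Q'.comap g) (y : A ⧸ P) :
    QuotientAddGroup.map Q Q' (AddMonoidHom.id A) hQ (QuotientAddGroup.map P Q g h y) =
      QuotientAddGroup.map P' Q' g h' (QuotientAddGroup.map P P' (AddMonoidHom.id A) hP y) := by
  induction y using QuotientAddGroup.induction_on with
  | H z => rfl

/-- Multiplication by `𝕃 ^ i`, as a map `ℳ' / F m → ℳ' / F n` for `m = n + i`. -/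
def mulLefschetzQuotient (E : Set (FreeCommRing (Variety k))) (i n m : ℤ) (h : m = n + i) :
    LocalizedRing E ⧸ dimFiltration E m →+ LocalizedRing E ⧸ dimFiltration E n :=
  QuotientAddGroup.map _ _ (AddMonoidHom.mulRight (lefschetzPow E i))
    (fun _ hy => mul_lefschetzPow_mem E i n (h ▸ hy))

theorem transition_mulLefschetzQuotient (E : Set (FreeCommRing (Variety k))) (i n m : ℤ)
    (h : m = n + i) (h' : m + 1 = n + 1 + i) (y : LocalizedRing E ⧸ dimFiltration E (m + 1)) :
    transition E n (mulLefschetzQuotient E i (n + 1) (m + 1) h' y) =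
      mulLefschetzQuotient E i n m h (transition E m y) :=
  quotient_map_comm _ _ _ _ _ y

theorem mulLefschetzQuotient_congr (E : Set (FreeCommRing (Variety k))) (i n m m' : ℤ)
    (h : m = n + i) (h' : m' = n + i) (x : ∀ n : ℤ, LocalizedRing E ⧸ dimFiltration E n) :
    mulLefschetzQuotient E i n m h (x m) = mulLefschetzQuotient E i n m' h' (x m') := by
  subst h h'
  rfl

/-- Multiplication by `𝕃 ^ i` on `ℳ̂'`. -/
def mulLefschetz (E : Set (FreeCommRing (Variety k))) (i : ℤ) (x : Completed E) : Completed E :=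
  (⟨fun n => mulLefschetzQuotient E i n (n + i) rfl (x.1 (n + i)), fun n =>
    (congrArg (transition E n) (mulLefschetzQuotient_congr E i (n + 1) (n + 1 + i) (n + i + 1) rfl
      (by omega) x.1)).trans
      ((transition_mulLefschetzQuotient E i n (n + i) rfl (by omega) (x.1 (n + i + 1))).trans
        (congrArg (mulLefschetzQuotient E i n (n + i) rfl) (x.2 (n + i))))⟩ : completion E)

end Grothendieck

/-! ### Constructible subsets of affine spaces -/

section Constructible

variable {k : Type u} [Field k]

/-- A constructible subset of `k ^ ι` (for `k` algebraically closed): the set of `k`-points of a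
constructible subset of the scheme `𝔸^ι`. -/
def IsConstructibleSet {ι : Type} (Z : Set (ι → k)) : Prop :=
  ∃ T : Set (PrimeSpectrum (MvPolynomial ι k)), Topology.IsConstructible T ∧
    Z = MvPolynomial.pointToPoint ⁻¹' T

/-- `c` is the class of the constructible set `Z`: there are finitely many pairwise disjoint
subvarieties of `𝔸^ι`, the union of whose sets of `k`-points is `Z` and the sum of whose classes
is `c`. -/
def HasClass {ι : Type} (E : Set (FreeCommRing (Variety k))) (Z : Set (ι → k))
    (c : GrothendieckRing k E) : Prop :=
  ∃ (r : ℕ) (Y : Fin r → Variety k) (j : ∀ i, (Y i).carrier ⟶ affineScheme k ι),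
    (∀ i, IsImmersion (j i)) ∧ (∀ i, j i ≫ affineHom k ι = (Y i).hom) ∧
    Pairwise (fun i i' => Disjoint (Set.range (j i)) (Set.range (j i'))) ∧
    (∀ x : ι → k, x ∈ Z ↔ ∃ i, (MvPolynomial.pointToPoint x : PrimeSpectrum (MvPolynomial ι k)) ∈
      Set.range (j i)) ∧
    c = ∑ i, classOf E (Y i)

open Classical in
/-- The class `[Z]` of a constructible subset `Z` of `k ^ ι`. -/
def constructibleClass {ι : Type} (E : Set (FreeCommRing (Variety k))) (Z : Set (ι → k)) :
    GrothendieckRing k E :=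
  if h : ∃ c, HasClass E Z c then h.choose else 0

/-- The dimension of a subset of `k ^ ι`: the Krull dimension of the coordinate ring of its Zariski
closure (so the empty set has dimension `⊥`). -/
def dimension {ι : Type} (Z : Set (ι → k)) : WithBot ℕ∞ :=
  ringKrullDim (MvPolynomial ι k ⧸ MvPolynomial.vanishingIdeal k Z)

end Constructible

/-! ### Motivic measures defined through truncation maps -/

section Measure

/-- A system of truncations of a set `X`: for every level `l` a map `trunc l` from a subset
`domain l` of `X` onto an affine space over `k`, and the integer `shift l` by which classes at
level `l` are normalized. -/
structure TruncationSystem (k : Type u) (X : Type v) where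
  Level : Type
  Coord : Level → Type
  finite_coord : ∀ l, Finite (Coord l)
  domain : Level → Set X
  trunc : ∀ l, X → Coord l → k
  shift : Level → ℤ

variable {k : Type u} [Field k] {X : Type v}

/-- Cylinders of level `l`: sets that are the preimage of their image under the truncation map,
the image being constructible. -/
def IsCylinder (S : TruncationSystem k X) (l : S.Level) (C : Set X) : Prop :=
  C ⊆ S.domain l ∧ (∀ x ∈ C, ∀ y ∈ S.domain l, S.trunc l y = S.trunc l x → y ∈ C) ∧
    IsConstructibleSet (S.trunc l '' C)

/-- The measure `[trunc l (C)] 𝕃 ^ (-shift l)` of a cylinder of level `l`. -/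
def cylinderMeasure (E : Set (FreeCommRing (Variety k))) (S : TruncationSystem k X) (l : S.Level)
    (C : Set X) : Completed E :=
  toCompleted E (algebraMap _ _ (constructibleClass E (S.trunc l '' C)) *
    lefschetzPow E (-S.shift l))

/-- The measure of the cylinder `C` of level `l` has dimension at most `n`, that is,
`dim (trunc l (C)) - shift l ≤ n`. -/
def CylinderDimLE (S : TruncationSystem k X) (l : S.Level) (C : Set X) (n : ℤ) : Prop :=
  ∀ d : ℕ, (d : WithBot ℕ∞) ≤ dimension (S.trunc l '' C) → (d : ℤ) - S.shift l ≤ n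

/-- The sequence `C i` of cylinders (of levels `l i`) approximates `A`: there are cylinders `B i`
whose measures tend to zero for the dimension filtration, that is, have dimensions tending to `-∞`,
such that `B i` contains the symmetric difference of `A` and `C i`. -/
def Approximates (S : TruncationSystem k X) (l : ℕ → S.Level) (C : ℕ → Set X) (A : Set X) : Prop :=
  (∀ i, IsCylinder S (l i) (C i)) ∧
  ∃ (l' : ℕ → S.Level) (B : ℕ → Set X), (∀ i, IsCylinder S (l' i) (B i)) ∧
    (∀ n : ℤ, ∀ᶠ i in Filter.atTop, CylinderDimLE S (l' i) (B i) n) ∧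
    ∀ i, symmDiff A (C i) ⊆ B i

/-- Measurable sets: those that are approximated by a sequence of cylinders. -/
def IsMeasurableSet (S : TruncationSystem k X) (A : Set X) : Prop :=
  ∃ l C, Approximates S l C A

/-- `m` is the limit of the measures of a sequence of cylinders approximating `A`. -/
def HasMeasure (E : Set (FreeCommRing (Variety k))) (S : TruncationSystem k X) (A : Set X)
    (m : Completed E) : Prop :=
  ∃ l C, Approximates S l C A ∧
    Filter.Tendsto (fun i => cylinderMeasure E S (l i) (C i)) Filter.atTop (nhds m)

open Classical in
/-- The motivic measure `μ(A)` of a measurable set. -/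
def measure (E : Set (FreeCommRing (Variety k))) (S : TruncationSystem k X) (A : Set X) :
    Completed E :=
  if h : ∃ m, HasMeasure E S A m then h.choose else 0

/-- `A` is contained in a cylinder whose measure has dimension at most `n`. -/
def DimLE (S : TruncationSystem k X) (A : Set X) (n : ℤ) : Prop :=
  ∃ l B, IsCylinder S l B ∧ A ⊆ B ∧ CylinderDimLE S l B n

/-- The fibre over `n` of a function on `A`. -/
def fibre (A : Set X) (f : X → ℤ) (n : ℤ) : Set X := {x ∈ A | f x = n}

/-- `f` is a measurable function on `A` (which need not be measurable): its fibres are. -/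
def IsMeasurableFun (S : TruncationSystem k X) (A : Set X) (f : X → ℤ) : Prop :=
  ∀ n, IsMeasurableSet S (fibre A f n)

/-- The motivic integral of `𝕃 ^ f` over `A` exists and is equal to `m`: the function `f` is
measurable, the dimensions of the terms `μ(f⁻¹(n)) 𝕃 ^ n` tend to `-∞` as `|n| → ∞`
(convergence for the dimension filtration), and their sum is `m`. -/
def HasIntegral (E : Set (FreeCommRing (Variety k))) (S : TruncationSystem k X) (A : Set X)
    (f : X → ℤ) (m : Completed E) : Prop :=
  IsMeasurableFun S A f ∧
  (∀ N : ℤ, {n : ℤ | ¬ DimLE S (fibre A f n) (N - n)}.Finite) ∧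
  HasSum (fun n : ℤ => mulLefschetz E n (measure E S (fibre A f n))) m

open Classical in
/-- The motivic integral of `𝕃 ^ f` over `A`, with value `∞` if it does not converge. -/
def integral (E : Set (FreeCommRing (Variety k))) (S : TruncationSystem k X) (A : Set X)
    (f : X → ℤ) : WithTop (Completed E) :=
  if h : ∃ m, HasIntegral E S A f m then ((h.choose : Completed E) : WithTop (Completed E)) else ⊤

end Measure

/-! ### The group scheme `α_p`, its torsors over the punctured formal disk, and its action on `V` -/

section Torsors

variable {k : Type u} [Field k] (p : ℕ)

variable (k) in
/-- The coordinate ring `k[ε] = k[x]/(x ^ p)` of `G = α_p`. -/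
abbrev CoordRing : Type u := AdjoinRoot (Polynomial.X ^ p : Polynomial k)

variable (k) in
/-- The class `ε` of `x` in `k[ε]`. -/
abbrev eps : CoordRing k p := AdjoinRoot.root (Polynomial.X ^ p : Polynomial k)

variable (k) in
theorem eps_pow : eps k p ^ p = 0 := by
  have h := AdjoinRoot.eval₂_root (Polynomial.X ^ p : Polynomial k)
  simpa using h

variable (k) in
/-- The coordinate ring `k[x, y]` of `V`, with `x = X 0` and `y = X 1`. -/
abbrev VRing : Type u := MvPolynomial (Fin 2) k

variable (k) in
/-- The coaction `x ↦ x`, `y ↦ y + x ε` defining the action of `G` on `V`. -/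
def coactionV : VRing k →ₐ[k] VRing k ⊗[k] CoordRing k p :=
  MvPolynomial.aeval ![MvPolynomial.X 0 ⊗ₜ 1, MvPolynomial.X 1 ⊗ₜ 1 + MvPolynomial.X 0 ⊗ₜ eps k p]

variable (k) in
/-- The coordinate ring of `V/G`, that is, the ring of invariants of `k[x, y]`. -/
abbrev invariants : Subalgebra k (VRing k) :=
  AlgHom.equalizer (coactionV k p) Algebra.TensorProduct.includeLeft

variable (k) in
theorem X_zero_mem : (MvPolynomial.X 0 : VRing k) ∈ invariants k p := by
  simp [AlgHom.mem_equalizer, coactionV]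

/-- `Δ_G`: the Laurent series having only terms of degree prime to `p`. -/
def DeltaG : Set (LaurentSeries k) := {f | ∀ i : ℤ, (p : ℤ) ∣ i → f.coeff i = 0}

/-- The polynomial `z ^ p - f`. -/
abbrev torsorPoly (f : LaurentSeries k) : Polynomial (LaurentSeries k) :=
  Polynomial.X ^ p - Polynomial.C f

/-- `K_f = k((t))[z]/(z ^ p - f)`, the coordinate ring of the `G`-torsor given by `f`. -/
def TorsorRing (f : LaurentSeries k) : Type u := AdjoinRoot (torsorPoly p f)

namespace TorsorRing

variable {p} {f : LaurentSeries k}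

instance : CommRing (TorsorRing p f) := inferInstanceAs (CommRing (AdjoinRoot (torsorPoly p f)))

instance : Algebra (LaurentSeries k) (TorsorRing p f) :=
  inferInstanceAs (Algebra (LaurentSeries k) (AdjoinRoot (torsorPoly p f)))

instance : Algebra (PowerSeries k) (TorsorRing p f) :=
  ((algebraMap (LaurentSeries k) (TorsorRing p f)).comp
    (algebraMap (PowerSeries k) (LaurentSeries k))).toAlgebra

instance : Algebra k (TorsorRing p f) :=
  ((algebraMap (PowerSeries k) (TorsorRing p f)).comp
    (algebraMap k (PowerSeries k))).toAlgebra

instance : IsScalarTower (PowerSeries k) (LaurentSeries k) (TorsorRing p f) :=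
  IsScalarTower.of_algebraMap_eq' rfl

instance : IsScalarTower k (PowerSeries k) (TorsorRing p f) :=
  IsScalarTower.of_algebraMap_eq' rfl

variable (p f) in
/-- The class of `z` in `K_f`. -/
def z : TorsorRing p f := AdjoinRoot.root (torsorPoly p f)

theorem z_pow : z p f ^ p = algebraMap (LaurentSeries k) _ f := by
  have h := AdjoinRoot.eval₂_root (torsorPoly p f)
  simp only [Polynomial.eval₂_sub, Polynomial.eval₂_pow, Polynomial.eval₂_X,
    Polynomial.eval₂_C, sub_eq_zero] at h
  exact h

/-- The homomorphism on `K_f` that is `i` on `k((t))` and maps `z` to `x`. -/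
def lift {S : Type v} [CommRing S] (i : LaurentSeries k →+* S) (x : S) (hx : x ^ p = i f) :
    TorsorRing p f →+* S :=
  AdjoinRoot.lift i x (by simp [hx])

theorem lift_algebraMap {S : Type v} [CommRing S] (i : LaurentSeries k →+* S) (x : S)
    (hx : x ^ p = i f) (a : LaurentSeries k) :
    lift i x hx (algebraMap (LaurentSeries k) (TorsorRing p f) a) = i a :=
  AdjoinRoot.lift_of _

theorem lift_z {S : Type v} [CommRing S] (i : LaurentSeries k →+* S) (x : S)
    (hx : x ^ p = i f) : lift i x hx (z p f) = x :=
  AdjoinRoot.lift_root _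

end TorsorRing

open TorsorRing

variable [Fact p.Prime]

theorem torsorPoly_monic (f : LaurentSeries k) : (torsorPoly p f).Monic :=
  Polynomial.monic_X_pow_sub_C f (Fact.out : p.Prime).ne_zero

/-- The coefficient of `z ^ i` in an element of `K_f`, with respect to the basis
`1, z, …, z ^ (p - 1)`. -/
def zCoeff {f : LaurentSeries k} (i : ℕ) (w : TorsorRing p f) : LaurentSeries k :=
  (AdjoinRoot.modByMonicHom (torsorPoly_monic p f) w).coeff i

theorem algebraMap_laurent_injective (f : LaurentSeries k) :
    Function.Injective (algebraMap (LaurentSeries k) (TorsorRing p f)) := by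
  have h : (torsorPoly p f).degree ≠ 0 := by
    rw [Polynomial.degree_X_pow_sub_C (Fact.out : p.Prime).pos]
    exact_mod_cast (Fact.out : p.Prime).ne_zero
  exact AdjoinRoot.of.injective_of_degree_ne_zero h

theorem algebraMap_powerSeries_injective (f : LaurentSeries k) :
    Function.Injective (algebraMap (PowerSeries k) (TorsorRing p f)) :=
  (algebraMap_laurent_injective p f).comp HahnSeries.ofPowerSeries_injective

open Classical in
/-- `O_f ⊆ K_f`: the integral closure of `k[[t]]` in `K_f` if `f ≠ 0`, and `k[[t]][z]/(z ^ p)` if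
`f = 0`. -/
def integers (f : LaurentSeries k) : Subalgebra (PowerSeries k) (TorsorRing p f) :=
  if f = 0 then Algebra.adjoin (PowerSeries k) {z p f}
  else integralClosure (PowerSeries k) (TorsorRing p f)

/-- An element of `k((t))` that lies in `O_f` lies in `k[[t]]`. -/
theorem mem_range_of_mem_integers {f a : LaurentSeries k}
    (ha : algebraMap (LaurentSeries k) (TorsorRing p f) a ∈ integers p f) :
    ∃ b : PowerSeries k, algebraMap (PowerSeries k) (LaurentSeries k) b = a := by
  unfold integers at ha
  split_ifs at ha with hf
  · subst hf
    let e : TorsorRing p (0 : LaurentSeries k) →+* LaurentSeries k :=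
      TorsorRing.lift (RingHom.id _) 0 (by simp [(Fact.out : p.Prime).ne_zero])
    let e' : TorsorRing p (0 : LaurentSeries k) →ₐ[PowerSeries k] LaurentSeries k :=
      { e with commutes' := fun c => TorsorRing.lift_algebraMap _ _ _ _ }
    have h₀ : (0 : LaurentSeries k) ^ p = RingHom.id _ 0 := by
      simp [(Fact.out : p.Prime).ne_zero]
    have h₁ : e' (algebraMap (LaurentSeries k) _ a) = a := TorsorRing.lift_algebraMap _ _ h₀ _
    have h₂ : e' (z p 0) = 0 := TorsorRing.lift_z _ _ h₀
    have h₃ : e' (algebraMap (LaurentSeries k) _ a) ∈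
        (Algebra.adjoin (PowerSeries k) {z p (0 : LaurentSeries k)}).map e' := ⟨_, ha, rfl⟩
    rw [AlgHom.map_adjoin, Set.image_singleton, h₂, h₁, Algebra.adjoin_singleton_zero,
      Algebra.mem_bot] at h₃
    exact h₃
  · have h₁ : IsIntegral (PowerSeries k) a :=
      (isIntegral_algebraMap_iff (algebraMap_laurent_injective p f)).mp ha
    exact IsIntegrallyClosed.isIntegral_iff.mp h₁

/-- The homomorphism `K_f ⊗ k[ε] → K_f[δ]`, with `δ ^ 2 = 0`, that maps `ε` to `δ`. -/
theorem coaction_infinitesimal (f : LaurentSeries k) :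
    ∃ h : TorsorRing p f ⊗[k] CoordRing k p →+* DualNumber (TorsorRing p f),
      (∀ w, h (w ⊗ₜ 1) = TrivSqZeroExt.inl w) ∧ h (1 ⊗ₜ eps k p) = DualNumber.eps := by
  have he : (DualNumber.eps : DualNumber (TorsorRing p f)) ^ p = 0 := by
    obtain ⟨n, hn⟩ := Nat.exists_eq_add_of_le (Fact.out : p.Prime).two_le
    rw [hn, pow_add, pow_two, DualNumber.eps_mul_eps, zero_mul]
  refine ⟨(Algebra.TensorProduct.lift (TrivSqZeroExt.inlAlgHom k _ _)
    (AdjoinRoot.liftAlgHom _ (Algebra.ofId k _) DualNumber.eps (by simp [he]))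
    (fun _ _ => Commute.all _ _)).toRingHom, fun w => ?_, ?_⟩
  · simp
  · simp

variable [CharP k p]

theorem add_pow_tensor {R : Type u} [CommRing R] [Algebra k R] (r s : R) :
    (r ⊗ₜ[k] (1 : CoordRing k p) + s ⊗ₜ[k] eps k p) ^ p = (r ^ p) ⊗ₜ[k] 1 := by
  rcases subsingleton_or_nontrivial (R ⊗[k] CoordRing k p) with h | h
  · exact Subsingleton.elim _ _
  · have : CharP (R ⊗[k] CoordRing k p) p :=
      charP_of_injective_algebraMap (algebraMap k (R ⊗[k] CoordRing k p)).injective p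
    rw [add_pow_char, Algebra.TensorProduct.tmul_pow, Algebra.TensorProduct.tmul_pow, eps_pow,
      TensorProduct.tmul_zero, add_zero, one_pow]

/-- The coaction `z ↦ z + ε` on `K_f`, as a ring homomorphism. -/
def coactionTorsorRingHom (f : LaurentSeries k) :
    TorsorRing p f →+* TorsorRing p f ⊗[k] CoordRing k p :=
  TorsorRing.lift
    ((Algebra.TensorProduct.includeLeft :
        TorsorRing p f →ₐ[k] TorsorRing p f ⊗[k] CoordRing k p).toRingHom.comp
      (algebraMap (LaurentSeries k) (TorsorRing p f)))
    (z p f ⊗ₜ 1 + 1 ⊗ₜ eps k p) (by rw [add_pow_tensor, z_pow]; rfl)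

theorem coactionTorsorRingHom_algebraMap (f a : LaurentSeries k) :
    coactionTorsorRingHom p f (algebraMap (LaurentSeries k) (TorsorRing p f) a) =
      algebraMap (LaurentSeries k) (TorsorRing p f) a ⊗ₜ 1 :=
  TorsorRing.lift_algebraMap _ _ _ a

/-- The `k((t))`-linear coaction `z ↦ z + ε` on `K_f` defining the action of `G` on `Spec K_f`. -/
def coactionTorsor (f : LaurentSeries k) :
    TorsorRing p f →ₐ[k] TorsorRing p f ⊗[k] CoordRing k p :=
  { coactionTorsorRingHom p f with
    commutes' := fun c => by
      rw [Algebra.TensorProduct.algebraMap_apply]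
      exact coactionTorsorRingHom_algebraMap p f _ }

variable (k) in
/-- The elements of `𝒥_∞ 𝒱 = ⊔_{f ∈ Δ_G} Hom^G(Spec O_f, V)`: a morphism `Spec O_f → V` is given by
a homomorphism `k[x, y] → K_f` with image in `O_f`, and it is `G`-equivariant if the induced
morphism `Spec K_f → V` is. -/
structure TwistedArc where
  f : LaurentSeries k
  mem_deltaG : f ∈ DeltaG p
  hom : VRing k →ₐ[k] TorsorRing p f
  mem_integers : ∀ r, hom r ∈ integers p f
  equivariant : (Algebra.TensorProduct.map hom (AlgHom.id k (CoordRing k p))).comp (coactionV k p) =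
    (coactionTorsor p f).comp hom

variable (k) in
/-- The arcs of `V/G`, that is, the morphisms `Spec k[[t]] → V/G`. -/
abbrev QuotientArc : Type u := invariants k p →ₐ[k] PowerSeries k

/-! ### The map from twisted arcs to arcs of the quotient -/

/-- The elements of `K_f` that are invariant under `G` are those of `k((t))`. -/
theorem mem_range_of_coaction_eq {f : LaurentSeries k} {w : TorsorRing p f}
    (hw : coactionTorsor p f w = w ⊗ₜ 1) : ∃ a, algebraMap (LaurentSeries k) _ a = w := by
  have hp := (Fact.out : p.Prime)
  obtain ⟨g, hgdeg, rfl⟩ : ∃ g : Polynomial (LaurentSeries k), g.degree < (torsorPoly p f).degree ∧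
      Polynomial.aeval (z p f) g = w := by
    obtain ⟨g, hg⟩ := AdjoinRoot.mk_surjective (g := torsorPoly p f) w
    refine ⟨g %ₘ torsorPoly p f, Polynomial.degree_modByMonic_lt _ (torsorPoly_monic p f), ?_⟩
    rw [← hg, ← AdjoinRoot.modByMonicHom_mk (torsorPoly_monic p f)]
    exact (AdjoinRoot.aeval_eq _).trans (AdjoinRoot.mk_leftInverse (torsorPoly_monic p f) _)
  obtain ⟨h, h₁, h₂⟩ := coaction_infinitesimal p f
  let φ : TorsorRing p f →+* DualNumber (TorsorRing p f) := h.comp (coactionTorsorRingHom p f)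
  have hφL : φ.comp (algebraMap (LaurentSeries k) (TorsorRing p f)) =
      algebraMap (LaurentSeries k) (DualNumber (TorsorRing p f)) := by
    ext1 a
    change h (coactionTorsorRingHom p f (algebraMap _ _ a)) = _
    rw [coactionTorsorRingHom_algebraMap, h₁]
    rfl
  have hφz : φ (z p f) = TrivSqZeroExt.inl (z p f) + DualNumber.eps := by
    change h (coactionTorsorRingHom p f (z p f)) = _
    rw [coactionTorsorRingHom, TorsorRing.lift_z, map_add, h₁, h₂]
  have hinl : ∀ q : Polynomial (LaurentSeries k),
      Polynomial.aeval (TrivSqZeroExt.inl (z p f) : DualNumber (TorsorRing p f)) q =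
        TrivSqZeroExt.inl (Polynomial.aeval (z p f) q) := fun q =>
    Polynomial.aeval_algHom_apply
      (TrivSqZeroExt.inlAlgHom (LaurentSeries k) (TorsorRing p f) (TorsorRing p f)) (z p f) q
  have e₁ : φ (Polynomial.aeval (z p f) g) = TrivSqZeroExt.inl (Polynomial.aeval (z p f) g) := by
    have := congrArg h hw
    rwa [h₁] at this
  rw [Polynomial.aeval_def, Polynomial.hom_eval₂, hφL, hφz, ← Polynomial.aeval_def,
    ← Polynomial.aeval_def,
    Polynomial.aeval_add_of_sq_eq_zero g _ _ (by rw [pow_two, DualNumber.eps_mul_eps]), hinl, hinl,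
    add_eq_left] at e₁
  have e₂ : Polynomial.aeval (z p f) (Polynomial.derivative g) = 0 := by
    simpa using congrArg TrivSqZeroExt.snd e₁
  have e₃ : torsorPoly p f ∣ Polynomial.derivative g := by
    rw [← AdjoinRoot.mk_eq_zero, ← AdjoinRoot.aeval_eq]
    exact e₂
  have e₄ : Polynomial.derivative g = 0 := by
    by_contra hne
    exact absurd (Polynomial.degree_le_of_dvd e₃ hne)
      (not_le.mpr ((Polynomial.degree_derivative_le).trans_lt hgdeg))
  have : CharP (LaurentSeries k) p :=
    charP_of_injective_ringHom (HahnSeries.C (Γ := ℤ) (R := k)).injective p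
  rw [Polynomial.degree_X_pow_sub_C hp.pos, Polynomial.degree_lt_iff_coeff_zero] at hgdeg
  have hg : g = Polynomial.C (g.coeff 0) := by
    refine Polynomial.ext fun n => ?_
    rw [Polynomial.coeff_C]
    split_ifs with hn
    · rw [hn]
    · obtain ⟨m, rfl⟩ := Nat.exists_eq_succ_of_ne_zero hn
      by_cases hm : m + 1 < p
      · have hc := congrArg (fun q => q.coeff m) e₄
        simp only [Polynomial.coeff_derivative, Polynomial.coeff_zero] at hc
        refine (mul_eq_zero.mp hc).resolve_right ?_
        have := (CharP.cast_eq_zero_iff (LaurentSeries k) p (m + 1)).not.mpr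
          (Nat.not_dvd_of_pos_of_lt m.succ_pos hm)
        exact_mod_cast this
      · exact hgdeg _ (by omega)
  exact ⟨g.coeff 0, by rw [hg]; simp⟩

variable {p}

theorem TwistedArc.exists_lift (γ : TwistedArc k p) (r : invariants k p) :
    ∃ b : PowerSeries k, algebraMap (PowerSeries k) (TorsorRing p γ.f) b = γ.hom r := by
  have h : coactionTorsor p γ.f (γ.hom r) = γ.hom r ⊗ₜ 1 := by
    have h₁ := DFunLike.congr_fun γ.equivariant (r : VRing k)
    have h₂ : coactionV k p (r : VRing k) = (r : VRing k) ⊗ₜ 1 := r.2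
    simp only [AlgHom.comp_apply, h₂, Algebra.TensorProduct.map_tmul, map_one] at h₁
    exact h₁.symm
  obtain ⟨a, ha⟩ := mem_range_of_coaction_eq p h
  obtain ⟨b, hb⟩ := mem_range_of_mem_integers p (ha ▸ γ.mem_integers r)
  exact ⟨b, by rw [IsScalarTower.algebraMap_apply (PowerSeries k) (LaurentSeries k), hb, ha]⟩

/-- The map `ψ : 𝒥_∞ 𝒱 → J_∞(V/G)`: the restriction of `k[x, y] → K_f` to the ring of invariants
takes values in `k[[t]]`. -/
def psi (γ : TwistedArc k p) : QuotientArc k p :=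
  ((AlgEquiv.ofInjective (IsScalarTower.toAlgHom k (PowerSeries k) (TorsorRing p γ.f))
    (algebraMap_powerSeries_injective p γ.f)).symm : _ →ₐ[k] PowerSeries k).comp
    ((γ.hom.comp (invariants k p).val).codRestrict
      (IsScalarTower.toAlgHom k (PowerSeries k) (TorsorRing p γ.f)).range fun r => γ.exists_lift r)

theorem algebraMap_psi (γ : TwistedArc k p) (r : invariants k p) :
    algebraMap (PowerSeries k) (TorsorRing p γ.f) (psi γ r) = γ.hom r := by
  have h := (AlgEquiv.ofInjective (IsScalarTower.toAlgHom k (PowerSeries k) (TorsorRing p γ.f))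
    (algebraMap_powerSeries_injective p γ.f)).apply_symm_apply
    ((γ.hom.comp (invariants k p).val).codRestrict
      (IsScalarTower.toAlgHom k (PowerSeries k) (TorsorRing p γ.f)).range
      (fun r => γ.exists_lift r) r)
  exact congrArg Subtype.val h

/-- The `ω`-Jacobian ideal of a normal surface `Spec A` with invertible canonical module: the ideal
`𝒥` with `𝒥 ω = Im(Ω² → ω)`, where the canonical module `ω` is the bidual of `Ω²`. -/
def omegaJacobian (k : Type u) [Field k] (A : Type u) [CommRing A] [Algebra k A] : Ideal A :=
  (LinearMap.range (Module.Dual.eval A (⋀[A]^2 (Ω[A⁄k])))).colon Set.univ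

/-! ### The functions and the motivic measures on the two spaces of arcs -/

/-- For a twisted arc, `x ↦ a` and `y ↦ b + a z` with `a, b ∈ k((t))`; this is `a`. -/
def TwistedArc.a (γ : TwistedArc k p) : LaurentSeries k := zCoeff p 0 (γ.hom (MvPolynomial.X 0))

/-- For a twisted arc, `x ↦ a` and `y ↦ b + a z` with `a, b ∈ k((t))`; this is `b`. -/
def TwistedArc.b (γ : TwistedArc k p) : LaurentSeries k := zCoeff p 0 (γ.hom (MvPolynomial.X 1))

open Classical in
/-- The function `s`, equal to `max {0, ⌈-ord(f) / p⌉}`, and to `0` where `f = 0`. -/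
def TwistedArc.s (γ : TwistedArc k p) : ℤ :=
  if γ.f = 0 then 0 else max 0 ⌈(-(γ.f.order : ℚ)) / p⌉

/-- The function `ord(x)` where it is finite, that is, where `a ≠ 0`. -/
def TwistedArc.ordX (γ : TwistedArc k p) : ℤ := γ.a.order

/-- The part of `ψ⁻¹(C)` where `ord(x)` is finite; on the rest the exponent is `-∞` and
`𝕃 ^ (-∞) = 0`. -/
def liftedSet (C : Set (QuotientArc k p)) : Set (TwistedArc k p) := {γ | psi γ ∈ C ∧ γ.a ≠ 0}

/-- The function `F ∘ ψ - s - (p - 1) ord(x)`. -/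
def exponent (F : QuotientArc k p → ℤ) (γ : TwistedArc k p) : ℤ :=
  F (psi γ) - γ.s - (p - 1) * γ.ordX

variable (k p)

/-- The motivic measure on `𝒥_∞ 𝒱`. At the level `(m, n, j)` a twisted arc with `ord(f) ≥ -j` is
truncated to the coefficients of `f` in degrees `< n p`, the coefficients of `a` in degrees
`s, …, s + m`, and the coefficients of `b` in degrees `0, …, m`. -/
def twistedSystem : TruncationSystem k (TwistedArc k p) where
  Level := ℕ × ℕ × ℕ
  Coord l := {i : ℤ // -(l.2.2 : ℤ) ≤ i ∧ i < l.2.1 * p ∧ ¬ (p : ℤ) ∣ i} ⊕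
    Fin (l.1 + 1) ⊕ Fin (l.1 + 1)
  finite_coord l :=
    have : Finite {i : ℤ // -(l.2.2 : ℤ) ≤ i ∧ i < l.2.1 * p ∧ ¬ (p : ℤ) ∣ i} :=
      Set.Finite.to_subtype ((Set.finite_Ico (-(l.2.2 : ℤ)) (l.2.1 * p)).subset
        fun _ (hi : _ ∧ _ ∧ _) => ⟨hi.1, hi.2.1⟩)
    inferInstance
  domain l := {γ : TwistedArc k p | ∀ i : ℤ, i < -(l.2.2 : ℤ) → γ.f.coeff i = 0}
  trunc l γ := Sum.elim (fun i => γ.f.coeff i)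
    (Sum.elim (fun i => γ.a.coeff (γ.s + (i : ℕ))) (fun i => γ.b.coeff ((i : ℕ) : ℤ)))
  shift l := 2 * l.1 + (p - 1) * l.2.1

theorem X_one_pow_mem : (MvPolynomial.X 1 ^ p : VRing k) ∈ invariants k p := by
  rw [AlgHom.mem_equalizer, map_pow, coactionV, MvPolynomial.aeval_X]
  exact add_pow_tensor p _ _

/-- The elements `x` and `y ^ p` of the ring of invariants. -/
def invariantGen : Fin 2 → invariants k p :=
  ![⟨MvPolynomial.X 0, X_zero_mem k p⟩, ⟨MvPolynomial.X 1 ^ p, X_one_pow_mem k p⟩]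

/-- The motivic measure on `J_∞(V/G)`. At the level `m` an arc is truncated to the coefficients in
degrees `0, …, m` of the images of `x` and `y ^ p`. -/
def quotientSystem : TruncationSystem k (QuotientArc k p) where
  Level := ℕ
  Coord m := Fin 2 × Fin (m + 1)
  finite_coord _ := inferInstance
  domain _ := Set.univ
  trunc _ δ i := PowerSeries.coeff (i.2 : ℕ) (δ (invariantGen k p i.1))
  shift m := 2 * m

/-- The order of an ideal along an arc of `V/G`. -/
def ordIdeal {k : Type u} [Field k] {p : ℕ} (J : Ideal (invariants k p)) (δ : QuotientArc k p) : ℕ∞ :=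
  ⨅ r ∈ J, (δ r).order

/-- The motivic stringy invariant `M_st(V/G)`: the integral of `𝕃 ^ ord(𝒥)` over the arcs of `V/G`
(over those where `ord(𝒥)` is finite). -/
def stringyInvariant (E : Set (FreeCommRing (Variety k))) : WithTop (Completed E) :=
  integral E (quotientSystem k p) {δ | ordIdeal (omegaJacobian k (invariants k p)) δ ≠ ⊤}
    (fun δ => ((ordIdeal (omegaJacobian k (invariants k p)) δ).toNat : ℤ))

end Torsors

end AlphaP

/-!
# Change of variables for the quotient by `α_p`

A twisted arc `(f, a, b)` is mapped by `ψ` to the arc of `V/G` with coordinates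
`x = a` and `y ^ p = b ^ p + f a ^ p`. The two summands are the parts of the second series whose
terms have degree divisible by `p` and prime to `p`. Hence, where `x ≠ 0`, the series `a`, `b` and
`f` can be recovered from the image, and `ψ` is a bijection (`psi_injOn`, `exists_psi_eq`); as
`f a ^ p` has to be integral, `s ≤ ord(x)`.

On the stratum where `s` and `e = ord(x)` are fixed, the relevant coefficients of `f`, `a`, `b`
and the corresponding coefficients of `x` and `y ^ p` are indexed by one finite set `CoeffIndex`,
and `ψ` becomes a polynomial endomorphism `coeffMap` of the open set of an affine space where the
leading coefficient of `a` is invertible: the coefficients of `b` are raised to the power `p`, and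
those of `f` undergo a triangular linear substitution whose diagonal entries are the `p`-th power
of the leading coefficient of `a`. So the endomorphism is bijective on points and its comorphism
has all `p`-th powers in its image (`pow_mem_range`), which makes it a universal homeomorphism. It
therefore preserves classes in the Grothendieck ring, and also dimensions
(`HasClass.comap_away`, `ClassShift.away`). Counting the coefficients that are constrained on the
one side and free on the other, one finds that `ψ` changes measures by the factor
`𝕃 ^ (s + (p - 1) e)` (`IsPresented.twisted`, `IsPresented.quotient`, `isMeasureShift_stratum`).

The general part of the theory of motivic measures that this needs is developed for an arbitrary
system of truncations with surjective truncation maps and directed levels (`IsRegularSystem`):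
measures do not depend on the approximation, they are additive, and an integral may be computed
from any decomposition of the fibres into measurable parts which is finite up to sets of small
dimension (`IsRegularSystem.hasIntegral_iff`). The decomposition used here is by the value of `F`
and by the strata. The arcs with `ord(x)` large have small dimension on the side of `V/G`, and on
the side of twisted arcs as long as `s` is bounded (`dimLE_ordX_quotient`, `dimLE_ordX_twisted`).
So boundedness of `s` on the fibres of the exponent is sufficient for measurability; it is necessary
because `s` is bounded on every cylinder. The two integrals are then sums of the same terms.

Finally, the ring of invariants is a polynomial ring (`invariantsEquiv`), so that the Jacobian ideal
is the unit ideal and the stringy invariant is the measure `𝕃 ^ 2` of the whole space of arcs.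
-/

set_option linter.unusedSectionVars false

namespace AlphaP

/-! ### Subvarieties of affine space -/

section Pieces

variable {k : Type u} [Field k]

/-- A subvariety of `𝔸^ι`: a `k`-variety with an immersion into `𝔸^ι`. -/
structure Piece (k : Type u) [Field k] (ι : Type) where
  variety : Variety k
  imm : variety.carrier ⟶ affineScheme k ι
  isImmersion : IsImmersion imm
  comp_hom : imm ≫ affineHom k ι = variety.hom

attribute [instance] Piece.isImmersion Variety.locallyOfFiniteType Variety.quasiCompact
  Variety.isSeparated

/-- The `k`-point of `𝔸^ι` with coordinates `x`. -/
abbrev pt {ι : Type} (x : ι → k) : affineScheme k ι :=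
  (MvPolynomial.pointToPoint x : PrimeSpectrum (MvPolynomial ι k))

/-- The set of `k`-points of a subvariety of affine space. -/
def Piece.points {ι : Type} (Y : Piece k ι) : Set (ι → k) := {x | pt x ∈ Set.range Y.imm}

/-- A scheme with a separated quasi-compact morphism locally of finite type to a variety. -/
abbrev Variety.ofHom (X : Variety k) {Y : Scheme.{u}} (f : Y ⟶ X.carrier) [LocallyOfFiniteType f]
    [QuasiCompact f] [IsSeparated f] : Variety k where
  carrier := Y
  hom := f ≫ X.hom
  locallyOfFiniteType := inferInstance
  quasiCompact := inferInstance
  isSeparated := inferInstance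

/-- The pull-back of a subvariety of `𝔸^ι` along a morphism `g : T ⟶ 𝔸^ι`, as a subvariety of the
affine space `𝔸^κ` in which `T` is immersed. -/
abbrev Piece.pullback {ι κ : Type} (Y : Piece k ι) {T : Scheme.{u}} (g : T ⟶ affineScheme k ι)
    (i : T ⟶ affineScheme k κ) [LocallyOfFiniteType g] [QuasiCompact g] [IsSeparated g]
    [IsImmersion i] (h : g ≫ affineHom k ι = i ≫ affineHom k κ) : Piece k κ where
  variety := Y.variety.ofHom (Limits.pullback.fst Y.imm g)
  imm := Limits.pullback.snd Y.imm g ≫ i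
  isImmersion := inferInstance
  comp_hom := by
    rw [Category.assoc, ← h, ← Limits.pullback.condition_assoc, Y.comp_hom]

theorem Piece.mem_points_pullback {ι κ : Type} (Y : Piece k ι) {T : Scheme.{u}}
    (g : T ⟶ affineScheme k ι) (i : T ⟶ affineScheme k κ) [LocallyOfFiniteType g]
    [QuasiCompact g] [IsSeparated g] [IsImmersion i]
    (h : g ≫ affineHom k ι = i ≫ affineHom k κ) (x : κ → k) :
    x ∈ (Y.pullback g i h).points ↔ ∃ t : T, i t = pt x ∧ g t ∈ Set.range Y.imm := by
  change pt x ∈ Set.range (Limits.pullback.snd Y.imm g ≫ i) ↔ _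
  rw [Scheme.Hom.comp_base, TopCat.coe_comp, Set.range_comp, Scheme.Pullback.range_snd]
  constructor
  · rintro ⟨t, ht, h⟩
    exact ⟨t, h, ht⟩
  · rintro ⟨t, h, ht⟩
    exact ⟨t, ht, h⟩

instance Piece.quasiCompact_imm {ι : Type} (Y : Piece k ι) : QuasiCompact Y.imm := by
  have : QuasiCompact (Y.imm ≫ affineHom k ι) := by rw [Y.comp_hom]; infer_instance
  exact QuasiCompact.of_comp Y.imm (affineHom k ι)

/-- The intersection of two subvarieties of affine space. -/
abbrev Piece.inter {ι : Type} (Y Y' : Piece k ι) : Piece k ι := Y.pullback Y'.imm Y'.imm rfl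

theorem Piece.points_inter {ι : Type} (Y Y' : Piece k ι) :
    (Y.inter Y').points = Y.points ∩ Y'.points := by
  ext x
  rw [Piece.inter, Piece.mem_points_pullback]
  constructor
  · rintro ⟨t, ht, h⟩
    exact ⟨by rw [ht] at h; exact h, t, ht⟩
  · rintro ⟨h, t, ht⟩
    exact ⟨t, ht, by rw [ht]; exact h⟩

theorem isConstructible_of_isLocallyClosed {R : Type u} [CommRing R] [IsNoetherianRing R]
    {T : Set (PrimeSpectrum R)} (hT : IsLocallyClosed T) : Topology.IsConstructible T := by
  obtain ⟨U, Z, hU, hZ, rfl⟩ := hT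
  have : ∀ U : Set (PrimeSpectrum R), IsOpen U → Topology.IsConstructible U := fun U hU =>
    (TopologicalSpace.NoetherianSpace.isCompact U).isConstructible hU
  refine (this U hU).inter ?_
  rw [← Topology.isConstructible_compl]
  exact this _ hZ.isOpen_compl

theorem Piece.isConstructible_range {ι : Type} [Finite ι] (Y : Piece k ι) :
    Topology.IsConstructible (X := PrimeSpectrum (MvPolynomial ι k)) (Set.range Y.imm) :=
  isConstructible_of_isLocallyClosed Y.imm.isLocallyClosed_range

variable [IsAlgClosed k] in
/-- A nonempty constructible subset of affine space has a `k`-point. -/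
theorem exists_pt_mem_of_isConstructible {ι : Type} [Finite ι]
    {T : Set (PrimeSpectrum (MvPolynomial ι k))} (hT : Topology.IsConstructible T)
    (hne : T.Nonempty) : ∃ x : ι → k, MvPolynomial.pointToPoint x ∈ T := by
  obtain ⟨S, rfl⟩ := PrimeSpectrum.exists_constructibleSetData_iff.mpr hT
  obtain ⟨q, hq⟩ := hne
  simp only [PrimeSpectrum.ConstructibleSetData.toSet, Set.mem_iUnion] at hq ⊢
  obtain ⟨C, hC, hq⟩ := hq
  have hf : C.f ∉ q.asIdeal.jacobson := by
    rw [← Ideal.radical_eq_jacobson, q.2.radical]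
    intro h
    exact hq.2 (by simpa using h)
  rw [Ideal.jacobson, Ideal.mem_sInf] at hf
  push Not at hf
  obtain ⟨m, ⟨hqm, hm⟩, hfm⟩ := hf
  obtain ⟨x, rfl⟩ := MvPolynomial.eq_vanishingIdeal_singleton_of_isMaximal k hm
  refine ⟨x, C, hC, ?_, ?_⟩
  · exact fun g hg => hqm (hq.1 hg)
  · simp only [PrimeSpectrum.mem_zeroLocus, Set.singleton_subset_iff]
    exact hfm

variable [IsAlgClosed k] in
theorem subset_of_forall_pt_mem {ι : Type} [Finite ι]
    {T T' : Set (PrimeSpectrum (MvPolynomial ι k))}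
    (hT : Topology.IsConstructible T) (hT' : Topology.IsConstructible T')
    (h : ∀ x : ι → k, MvPolynomial.pointToPoint x ∈ T → MvPolynomial.pointToPoint x ∈ T') :
    T ⊆ T' := by
  by_contra hne
  obtain ⟨x, hx, hx'⟩ := exists_pt_mem_of_isConstructible (hT.sdiff hT') (by
    rw [Set.not_subset] at hne
    exact hne)
  exact hx' (h x hx)

variable [IsAlgClosed k] in
theorem Piece.range_subset {ι : Type} [Finite ι] {Y Y' : Piece k ι} (h : Y.points ⊆ Y'.points) :
    Set.range Y.imm ⊆ Set.range Y'.imm :=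
  subset_of_forall_pt_mem Y.isConstructible_range Y'.isConstructible_range fun _ hx => h hx

variable (E : Set (FreeCommRing (Variety k)))

theorem classOf_eq_of_relation {x : FreeCommRing (Variety k)} (h : IsRelation k x) :
    (Ideal.Quotient.mk (Ideal.span ({x | IsRelation k x} ∪ E)) x : GrothendieckRing k E) = 0 :=
  Ideal.Quotient.eq_zero_iff_mem.mpr (Ideal.subset_span (Or.inl h))

theorem classOf_univHomeo {X Y : Variety k} (g : Y.carrier ⟶ X.carrier) (hk : g ≫ X.hom = Y.hom)
    [UniversallyInjective g] [Surjective g] [UniversallyClosed g] : classOf E Y = classOf E X := by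
  have := classOf_eq_of_relation E (.univHomeo X Y g hk inferInstance inferInstance inferInstance)
  rwa [map_sub, sub_eq_zero] at this

theorem classOf_surjective_immersion {X Y : Variety k} (g : Y.carrier ⟶ X.carrier)
    (hk : g ≫ X.hom = Y.hom) [IsImmersion g] [Surjective g] : classOf E Y = classOf E X := by
  have : IsClosedImmersion g := IsClosedImmersion.of_isPreimmersion g (by
    rw [Set.range_eq_univ.mpr g.surjective]; exact isClosed_univ)
  exact classOf_univHomeo E g hk

variable [IsAlgClosed k] in
/-- The class of an intersection with a subvariety having more points. -/
theorem Piece.classOf_inter_of_subset {ι : Type} [Finite ι] {Y Y' : Piece k ι}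
    (h : Y.points ⊆ Y'.points) : classOf E (Y.inter Y').variety = classOf E Y.variety := by
  have : Surjective (Limits.pullback.fst Y.imm Y'.imm) := by
    refine ⟨Set.range_eq_univ.mp ?_⟩
    rw [Scheme.Pullback.range_fst]
    refine Set.eq_univ_of_forall fun y => Piece.range_subset h ⟨y, rfl⟩
  exact classOf_surjective_immersion E (X := Y.variety) (Y := (Y.inter Y').variety)
    (Limits.pullback.fst Y.imm Y'.imm) rfl

/-- The intersection of subvarieties is symmetric, up to isomorphism. -/
theorem Piece.classOf_inter_comm {ι : Type} (Y Y' : Piece k ι) :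
    classOf E (Y.inter Y').variety = classOf E (Y'.inter Y).variety := by
  have h : (Limits.pullbackSymmetry Y.imm Y'.imm).hom ≫ (Y'.inter Y).variety.hom =
      (Y.inter Y').variety.hom := by
    change (Limits.pullbackSymmetry Y.imm Y'.imm).hom ≫ Limits.pullback.fst Y'.imm Y.imm ≫
      Y'.variety.hom = Limits.pullback.fst Y.imm Y'.imm ≫ Y.variety.hom
    rw [Limits.pullbackSymmetry_hom_comp_fst_assoc, ← Y.comp_hom, ← Y'.comp_hom,
      Limits.pullback.condition_assoc]
  have := classOf_eq_of_relation E (.iso (Y.inter Y').variety (Y'.inter Y).variety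
    (Limits.pullbackSymmetry Y.imm Y'.imm) h)
  rwa [map_sub, sub_eq_zero] at this

variable [IsAlgClosed k] in
/-- The class of a subvariety of affine space depends only on its `k`-points, because universally
homeomorphic varieties have the same class. -/
theorem Piece.classOf_eq_of_points_eq {ι : Type} [Finite ι] {Y Y' : Piece k ι}
    (h : Y.points = Y'.points) : classOf E Y.variety = classOf E Y'.variety := by
  rw [← Piece.classOf_inter_of_subset E h.subset, ← Piece.classOf_inter_of_subset E h.superset,
    Piece.classOf_inter_comm]

instance locallyOfFiniteType_affineHom (ι : Type) [Finite ι] :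
    LocallyOfFiniteType (affineHom k ι) := (affineVariety k ι).locallyOfFiniteType

/-- A scheme with a quasi-compact immersion into affine space, as a subvariety. -/
abbrev Piece.ofImmersion {ι : Type} [Finite ι] {T : Scheme.{u}} (i : T ⟶ affineScheme k ι)
    [IsImmersion i] [QuasiCompact i] : Piece k ι where
  variety :=
    { carrier := T
      hom := i ≫ affineHom k ι
      locallyOfFiniteType := inferInstance
      quasiCompact := inferInstance
      isSeparated := inferInstance }
  imm := i
  isImmersion := inferInstance
  comp_hom := rfl

instance isClosedImmersion_quotient {ι : Type} (P : MvPolynomial ι k) :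
    IsClosedImmersion (Spec.map (CommRingCat.ofHom (Ideal.Quotient.mk (Ideal.span {P})))) :=
  IsClosedImmersion.spec_of_surjective _ Ideal.Quotient.mk_surjective

/-- The hypersurface `P = 0`. -/
abbrev Piece.vanishing {ι : Type} [Finite ι] (P : MvPolynomial ι k) : Piece k ι :=
  Piece.ofImmersion (Spec.map (CommRingCat.ofHom (Ideal.Quotient.mk (Ideal.span {P}))))

/-- The complement of the hypersurface `P = 0`. -/
abbrev Piece.nonvanishing {ι : Type} [Finite ι] (P : MvPolynomial ι k) : Piece k ι :=
  Piece.ofImmersion (Spec.map (CommRingCat.ofHom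
    (algebraMap (MvPolynomial ι k) (Localization.Away P))))

theorem Piece.range_vanishing {ι : Type} [Finite ι] (P : MvPolynomial ι k) :
    Set.range (Piece.vanishing P).imm = PrimeSpectrum.zeroLocus {P} := by
  change Set.range (PrimeSpectrum.comap (Ideal.Quotient.mk (Ideal.span {P}))) = _
  rw [range_comap_of_surjective _ _ Ideal.Quotient.mk_surjective, Ideal.mk_ker,
    PrimeSpectrum.zeroLocus_span]

theorem Piece.range_nonvanishing {ι : Type} [Finite ι] (P : MvPolynomial ι k) :
    Set.range (Piece.nonvanishing P).imm = (PrimeSpectrum.zeroLocus {P})ᶜ := by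
  change Set.range (PrimeSpectrum.comap (algebraMap (MvPolynomial ι k) (Localization.Away P))) = _
  rw [PrimeSpectrum.localization_away_comap_range (Localization.Away P) P,
    PrimeSpectrum.basicOpen_eq_zeroLocus_compl]

theorem pt_mem_zeroLocus {ι : Type} (P : MvPolynomial ι k) (x : ι → k) :
    MvPolynomial.pointToPoint x ∈ PrimeSpectrum.zeroLocus {P} ↔ MvPolynomial.eval x P = 0 := by
  rw [PrimeSpectrum.mem_zeroLocus, Set.singleton_subset_iff]
  exact MvPolynomial.mem_vanishingIdeal_singleton_iff x P

theorem Piece.points_vanishing {ι : Type} [Finite ι] (P : MvPolynomial ι k) :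
    (Piece.vanishing P).points = {x | MvPolynomial.eval x P = 0} := by
  ext x
  rw [Piece.points, Piece.range_vanishing]
  exact pt_mem_zeroLocus P x

theorem Piece.points_nonvanishing {ι : Type} [Finite ι] (P : MvPolynomial ι k) :
    (Piece.nonvanishing P).points = {x | MvPolynomial.eval x P ≠ 0} := by
  ext x
  rw [Piece.points, Piece.range_nonvanishing]
  exact (pt_mem_zeroLocus P x).not

/-- Scissor relation for the intersections with a hypersurface and with its complement. -/
theorem Piece.classOf_eq_add {ι : Type} [Finite ι] (Y : Piece k ι) (P : MvPolynomial ι k) :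
    classOf E Y.variety = classOf E (Y.inter (Piece.vanishing P)).variety +
      classOf E (Y.inter (Piece.nonvanishing P)).variety := by
  have := classOf_eq_of_relation E (.scissor Y.variety (Y.inter (Piece.vanishing P)).variety
    (Y.inter (Piece.nonvanishing P)).variety (Limits.pullback.fst Y.imm (Piece.vanishing P).imm)
    (Limits.pullback.fst Y.imm (Piece.nonvanishing P).imm) inferInstance inferInstance rfl rfl
    (by rw [Scheme.Pullback.range_fst, Scheme.Pullback.range_fst, Piece.range_vanishing,
          Piece.range_nonvanishing]; rfl))
  rw [map_sub, map_sub, sub_sub, sub_eq_zero] at this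
  exact this

end Pieces

/-! ### Constructible sets and their classes -/

section Classes

variable {k : Type u} [Field k] {ι : Type}

/-- Whether a point belongs to `Z` depends only on which polynomials in `L` vanish at it. -/
def IsSaturated (L : Finset (MvPolynomial ι k)) (Z : Set (ι → k)) : Prop :=
  ∀ x y, (∀ P ∈ L, MvPolynomial.eval x P = 0 ↔ MvPolynomial.eval y P = 0) → x ∈ Z → y ∈ Z

theorem IsSaturated.mono {L L' : Finset (MvPolynomial ι k)} {Z : Set (ι → k)}
    (h : IsSaturated L Z) (hL : L ⊆ L') : IsSaturated L' Z :=
  fun x y hxy => h x y fun P hP => hxy P (hL hP)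

/-- The set of points at which exactly the polynomials of `L` that are in `α` vanish. -/
def cell (L α : Finset (MvPolynomial ι k)) : Set (ι → k) :=
  {x | ∀ P ∈ L, MvPolynomial.eval x P = 0 ↔ P ∈ α}

theorem IsSaturated.cell_subset {L : Finset (MvPolynomial ι k)} {Z : Set (ι → k)}
    (h : IsSaturated L Z) {α : Finset (MvPolynomial ι k)} {x : ι → k} (hx : x ∈ cell L α)
    (hxZ : x ∈ Z) : cell L α ⊆ Z :=
  fun y hy => h x y (fun P hP => (hx P hP).trans (hy P hP).symm) hxZ

theorem disjoint_cell {L α β : Finset (MvPolynomial ι k)} (hα : α ⊆ L) (hβ : β ⊆ L)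
    (h : α ≠ β) : Disjoint (cell L α) (cell L β) := by
  rw [Set.disjoint_left]
  intro x hx hx'
  refine h (Finset.ext fun P => ⟨fun hP => ?_, fun hP => ?_⟩)
  · exact (hx' P (hα hP)).mp ((hx P (hα hP)).mpr hP)
  · exact (hx P (hβ hP)).mp ((hx' P (hβ hP)).mpr hP)

open Classical in
theorem exists_mem_cell (L : Finset (MvPolynomial ι k)) (x : ι → k) :
    ∃ α ∈ L.powerset, x ∈ cell L α :=
  ⟨L.filter fun P => MvPolynomial.eval x P = 0, by simp, fun P hP => by simp [hP]⟩

open Classical in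
theorem exists_isSaturated_of_isConstructible {T : Set (PrimeSpectrum (MvPolynomial ι k))}
    (hT : Topology.IsConstructible T) :
    ∃ L, IsSaturated L {x : ι → k | MvPolynomial.pointToPoint x ∈ T} := by
  obtain ⟨S, rfl⟩ := PrimeSpectrum.exists_constructibleSetData_iff.mpr hT
  refine ⟨S.biUnion fun C => insert C.f (Finset.univ.image C.g), fun x y hxy hx => ?_⟩
  simp only [PrimeSpectrum.ConstructibleSetData.toSet, Set.mem_iUnion, Set.mem_ofPred_eq,
    PrimeSpectrum.BasicConstructibleSetData.toSet] at hx ⊢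
  obtain ⟨C, hC, hx⟩ := hx
  refine ⟨C, hC, ?_, fun h => hx.2 ?_⟩
  · rintro _ ⟨i, rfl⟩
    refine (pt_mem_zeroLocus (C.g i) y).mpr ((hxy _ ?_).mp ((pt_mem_zeroLocus (C.g i) x).mp ?_)) rfl
    · exact Finset.mem_biUnion.mpr ⟨C, hC, by simp⟩
    · rw [PrimeSpectrum.mem_zeroLocus, Set.singleton_subset_iff]
      exact hx.1 ⟨i, rfl⟩
  · refine (pt_mem_zeroLocus C.f x).mpr ((hxy _ ?_).mpr ((pt_mem_zeroLocus C.f y).mp h))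
    exact Finset.mem_biUnion.mpr ⟨C, hC, by simp⟩

variable [Finite ι]

theorem Piece.exists_isSaturated (Y : Piece k ι) : ∃ L, IsSaturated L Y.points :=
  exists_isSaturated_of_isConstructible Y.isConstructible_range

variable (E : Set (FreeCommRing (Variety k)))

open Classical in
/-- The class of a subvariety is the sum of the classes of its intersections with the cells. -/
theorem Piece.exists_cells (L : Finset (MvPolynomial ι k)) (Y : Piece k ι) :
    ∃ W : Finset (MvPolynomial ι k) → Piece k ι, (∀ α, (W α).points = Y.points ∩ cell L α) ∧
      classOf E Y.variety = ∑ α ∈ L.powerset, classOf E (W α).variety := by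
  induction L using Finset.induction_on generalizing Y with
  | empty => exact ⟨fun _ => Y, fun α => by simp [cell], by simp⟩
  | insert P L hP ih =>
    obtain ⟨W₀, h₀, e₀⟩ := ih (Y.inter (Piece.vanishing P))
    obtain ⟨W₁, h₁, e₁⟩ := ih (Y.inter (Piece.nonvanishing P))
    rw [Piece.points_inter, Piece.points_vanishing] at h₀
    rw [Piece.points_inter, Piece.points_nonvanishing] at h₁
    have hne : ∀ Q ∈ L, Q ≠ P := fun Q hQ h => hP (h ▸ hQ)
    refine ⟨fun α => if P ∈ α then W₀ (α.erase P) else W₁ α, fun α => ?_, ?_⟩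
    · ext x
      dsimp only
      split_ifs with h
      · rw [h₀]
        simp only [cell, Set.mem_inter_iff, Set.mem_ofPred_eq, Finset.mem_insert, forall_eq_or_imp,
          Finset.mem_erase, h, iff_true, and_assoc]
        refine and_congr_right fun _ => and_congr_right fun _ => forall₂_congr fun Q hQ => ?_
        simp [hne Q hQ]
      · rw [h₁]
        simp only [cell, Set.mem_inter_iff, Set.mem_ofPred_eq, Finset.mem_insert, forall_eq_or_imp,
          h, iff_false, and_assoc]
    · rw [Finset.sum_powerset_insert hP, Piece.classOf_eq_add E Y P, e₀, e₁, add_comm]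
      congr 1
      · refine Finset.sum_congr rfl fun α hα => ?_
        dsimp only
        rw [if_neg fun h => hP (Finset.mem_powerset.mp hα h)]
      · refine Finset.sum_congr rfl fun α hα => ?_
        dsimp only
        rw [if_pos (Finset.mem_insert_self _ _), Finset.erase_insert]
        exact fun h => hP (Finset.mem_powerset.mp hα h)

variable [IsAlgClosed k]

theorem Piece.classOf_eq_zero {Y : Piece k ι} (h : Y.points = ∅) : classOf E Y.variety = 0 := by
  have h₁ := Piece.classOf_eq_add E Y 0
  rw [Piece.classOf_eq_of_points_eq E (Y := Y.inter (Piece.vanishing 0)) (Y' := Y)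
    (by rw [Piece.points_inter, h, Set.empty_inter])] at h₁
  rw [Piece.classOf_eq_of_points_eq E (Y := Y) (Y' := Y.inter (Piece.nonvanishing 0))
    (by rw [Piece.points_inter, h, Set.empty_inter])]
  simpa using h₁

open Classical in
/-- The class of the subvarieties of affine space having `S` as set of `k`-points. -/
def pieceClass (S : Set (ι → k)) : GrothendieckRing k E :=
  if h : ∃ Y : Piece k ι, Y.points = S then classOf E h.choose.variety else 0

theorem Piece.classOf_eq_pieceClass (Y : Piece k ι) {S : Set (ι → k)} (h : Y.points = S) :
    classOf E Y.variety = pieceClass E S := by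
  have h' : ∃ Y : Piece k ι, Y.points = S := ⟨Y, h⟩
  rw [pieceClass, dif_pos h']
  exact Piece.classOf_eq_of_points_eq E (h.trans h'.choose_spec.symm)

theorem pieceClass_empty : pieceClass E (∅ : Set (ι → k)) = 0 := by
  rw [pieceClass]
  split_ifs with h
  · exact Piece.classOf_eq_zero E h.choose_spec
  · rfl

open Classical in
/-- The sum of the classes of disjoint subvarieties in terms of cells. In particular it depends only
on the union of their sets of `k`-points. -/
theorem sum_classOf_eq {I : Type} [Fintype I] (Y : I → Piece k ι) (L : Finset (MvPolynomial ι k))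
    (hL : ∀ i, IsSaturated L (Y i).points)
    (hY : Pairwise fun i j => Disjoint (Y i).points (Y j).points) :
    ∑ i, classOf E (Y i).variety =
      ∑ α ∈ L.powerset, if cell L α ⊆ ⋃ i, (Y i).points then pieceClass E (cell L α) else 0 := by
  choose W hW eW using fun i => Piece.exists_cells E L (Y i)
  simp_rw [eW]
  rw [Finset.sum_comm]
  refine Finset.sum_congr rfl fun α _ => ?_
  have e : ∀ i, classOf E (W i α).variety = pieceClass E ((Y i).points ∩ cell L α) := fun i =>
    Piece.classOf_eq_pieceClass E _ (hW i α)
  simp_rw [e]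
  rcases (cell L α).eq_empty_or_nonempty with h0 | ⟨x, hx⟩
  · simp [h0, pieceClass_empty]
  split_ifs with h
  · obtain ⟨i, hi⟩ := Set.mem_iUnion.mp (h hx)
    have hsub := (hL i).cell_subset hx hi
    rw [Finset.sum_eq_single_of_mem i (Finset.mem_univ i), Set.inter_eq_right.mpr hsub]
    intro j _ hj
    rw [((hY hj).mono_right hsub).inter_eq, pieceClass_empty]
  · refine Finset.sum_eq_zero fun i _ => ?_
    have : (Y i).points ∩ cell L α = ∅ := by
      by_contra hne
      obtain ⟨y, hy, hy'⟩ := Set.nonempty_iff_ne_empty.mpr hne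
      exact h (((hL i).cell_subset hy' hy).trans (Set.subset_iUnion (fun i => (Y i).points) i))
    rw [this, pieceClass_empty]

theorem Piece.disjoint_range {Y Y' : Piece k ι} (h : Disjoint Y.points Y'.points) :
    Disjoint (Set.range Y.imm) (Set.range Y'.imm) := by
  rw [Set.disjoint_iff_inter_eq_empty]
  by_contra hne
  obtain ⟨x, hx⟩ := exists_pt_mem_of_isConstructible
    (Y.isConstructible_range.inter Y'.isConstructible_range) (Set.nonempty_iff_ne_empty.mpr hne)
  exact Set.disjoint_left.mp h hx.1 hx.2

/-- A constructible set that is a disjoint union of subvarieties has the sum of their classes as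
class. -/
theorem hasClass_of_pieces {I : Type} [Fintype I] (Y : I → Piece k ι)
    (hY : Pairwise fun i j => Disjoint (Y i).points (Y j).points) {Z : Set (ι → k)}
    (hZ : Z = ⋃ i, (Y i).points) : HasClass E Z (∑ i, classOf E (Y i).variety) := by
  let e := (Fintype.equivFin I).symm
  refine ⟨_, fun i => (Y (e i)).variety, fun i => (Y (e i)).imm, fun i => (Y (e i)).isImmersion,
    fun i => (Y (e i)).comp_hom, fun i j hij => Piece.disjoint_range (hY (e.injective.ne hij)),
    fun x => ?_, (e.sum_comp fun i => classOf E (Y i).variety).symm⟩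
  rw [hZ, Set.mem_iUnion, ← e.exists_congr_right]
  rfl

omit [IsAlgClosed k] in
theorem HasClass.exists_pieces {Z : Set (ι → k)} {c : GrothendieckRing k E} (h : HasClass E Z c) :
    ∃ (r : ℕ) (Y : Fin r → Piece k ι), (Pairwise fun i j => Disjoint (Y i).points (Y j).points) ∧
      Z = (⋃ i, (Y i).points) ∧ c = ∑ i, classOf E (Y i).variety := by
  obtain ⟨r, Y, j, h₁, h₂, h₃, h₄, h₅⟩ := h
  refine ⟨r, fun i => ⟨Y i, j i, h₁ i, h₂ i⟩, fun i i' hi => ?_, ?_, h₅⟩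
  · exact Set.disjoint_left.mpr fun x hx hx' => Set.disjoint_left.mp (h₃ hi) hx hx'
  · ext x
    rw [h₄, Set.mem_iUnion]
    rfl

open Classical in
theorem HasClass.unique {Z : Set (ι → k)} {c c' : GrothendieckRing k E} (h : HasClass E Z c)
    (h' : HasClass E Z c') : c = c' := by
  obtain ⟨r, Y, hd, hZ, rfl⟩ := h.exists_pieces
  obtain ⟨r', Y', hd', hZ', rfl⟩ := h'.exists_pieces
  choose L hL using fun i => (Y i).exists_isSaturated
  choose L' hL' using fun i => (Y' i).exists_isSaturated
  let M := Finset.univ.biUnion L ∪ Finset.univ.biUnion L'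
  rw [sum_classOf_eq E Y M (fun i => (hL i).mono
      ((Finset.subset_biUnion_of_mem L (Finset.mem_univ i)).trans Finset.subset_union_left)) hd,
    sum_classOf_eq E Y' M (fun i => (hL' i).mono
      ((Finset.subset_biUnion_of_mem L' (Finset.mem_univ i)).trans Finset.subset_union_right)) hd',
    ← hZ, ← hZ']

open Classical in
/-- A set saturated for finitely many polynomials is a finite disjoint union of subvarieties. -/
theorem IsSaturated.exists_pieces {L : Finset (MvPolynomial ι k)} {Z : Set (ι → k)}
    (h : IsSaturated L Z) : ∃ (r : ℕ) (Y : Fin r → Piece k ι),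
      (Pairwise fun i j => Disjoint (Y i).points (Y j).points) ∧ Z = ⋃ i, (Y i).points := by
  obtain ⟨W, hW, -⟩ := Piece.exists_cells ∅ L (Piece.ofImmersion (𝟙 (affineScheme k ι)))
  have hW' : ∀ α, (W α).points = cell L α := fun α => by
    rw [hW, Set.inter_eq_right]
    exact fun x _ => ⟨pt x, rfl⟩
  let I : Finset (Finset (MvPolynomial ι k)) := L.powerset.filter fun α => cell L α ⊆ Z
  let e := I.equivFin.symm
  refine ⟨_, fun i => W (e i), fun i j hij => ?_, ?_⟩
  · have hI : ∀ α : I, (α : Finset _) ⊆ L := fun α =>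
      Finset.mem_powerset.mp (Finset.mem_filter.mp α.2).1
    change Disjoint (W _).points (W _).points
    rw [hW', hW']
    exact disjoint_cell (hI _) (hI _) fun h => hij (e.injective (Subtype.ext h))
  · ext x
    simp_rw [Set.mem_iUnion, hW']
    constructor
    · intro hx
      obtain ⟨α, hα, hxα⟩ := exists_mem_cell L x
      refine ⟨e.symm ⟨α, Finset.mem_filter.mpr ⟨hα, h.cell_subset hxα hx⟩⟩, ?_⟩
      rwa [Equiv.apply_symm_apply]
    · rintro ⟨i, hi⟩
      exact (Finset.mem_filter.mp (e i).2).2 hi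

theorem isConstructibleSet_iff {Z : Set (ι → k)} :
    IsConstructibleSet Z ↔ ∃ L, IsSaturated L Z := by
  constructor
  · rintro ⟨T, hT, rfl⟩
    exact exists_isSaturated_of_isConstructible hT
  · rintro ⟨L, hL⟩
    obtain ⟨r, Y, -, rfl⟩ := hL.exists_pieces
    refine ⟨⋃ i, Set.range (Y i).imm, .iUnion fun i => (Y i).isConstructible_range, ?_⟩
    ext x
    simp only [Set.mem_iUnion, Set.mem_preimage]
    rfl

theorem IsConstructibleSet.hasClass {Z : Set (ι → k)} (h : IsConstructibleSet Z) :
    HasClass E Z (constructibleClass E Z) := by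
  have : ∃ c, HasClass E Z c := by
    obtain ⟨L, hL⟩ := isConstructibleSet_iff.mp h
    obtain ⟨r, Y, hd, hZ⟩ := hL.exists_pieces
    exact ⟨_, hasClass_of_pieces E Y hd hZ⟩
  rw [constructibleClass, dif_pos this]
  exact this.choose_spec

theorem HasClass.constructibleClass_eq {Z : Set (ι → k)} {c : GrothendieckRing k E}
    (h : HasClass E Z c) : constructibleClass E Z = c := by
  have h' : ∃ c, HasClass E Z c := ⟨c, h⟩
  rw [constructibleClass, dif_pos h']
  exact h'.choose_spec.unique E h

theorem constructibleClass_union {Z Z' : Set (ι → k)} (h : IsConstructibleSet Z)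
    (h' : IsConstructibleSet Z') (hd : Disjoint Z Z') :
    constructibleClass E (Z ∪ Z') = constructibleClass E Z + constructibleClass E Z' := by
  obtain ⟨r, Y, hY, hZ, e⟩ := (h.hasClass E).exists_pieces
  obtain ⟨r', Y', hY', hZ', e'⟩ := (h'.hasClass E).exists_pieces
  rw [e, e']
  have hYZ : ∀ i, (Y i).points ⊆ Z := fun i => hZ ▸ Set.subset_iUnion (fun i => (Y i).points) i
  have hYZ' : ∀ i, (Y' i).points ⊆ Z' := fun i =>
    hZ' ▸ Set.subset_iUnion (fun i => (Y' i).points) i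
  have := hasClass_of_pieces E (I := Fin r ⊕ Fin r') (Sum.elim Y Y') (Z := Z ∪ Z') (by
    rintro (i | i) (j | j) hij
    · exact hY fun h => hij (h ▸ rfl)
    · exact hd.mono (hYZ i) (hYZ' j)
    · exact hd.symm.mono (hYZ' i) (hYZ j)
    · exact hY' fun h => hij (h ▸ rfl)) (by
    rw [Set.iUnion_sum, hZ, hZ']
    rfl)
  rw [this.constructibleClass_eq, Fintype.sum_sum_type]
  rfl

theorem IsConstructibleSet.compl {Z : Set (ι → k)} (h : IsConstructibleSet Z) :
    IsConstructibleSet Zᶜ := by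
  obtain ⟨T, hT, rfl⟩ := h
  exact ⟨Tᶜ, Topology.isConstructible_compl.mpr hT, rfl⟩

theorem IsConstructibleSet.union {Z Z' : Set (ι → k)} (h : IsConstructibleSet Z)
    (h' : IsConstructibleSet Z') : IsConstructibleSet (Z ∪ Z') := by
  obtain ⟨T, hT, rfl⟩ := h
  obtain ⟨T', hT', rfl⟩ := h'
  exact ⟨T ∪ T', hT.union hT', rfl⟩

theorem IsConstructibleSet.inter {Z Z' : Set (ι → k)} (h : IsConstructibleSet Z)
    (h' : IsConstructibleSet Z') : IsConstructibleSet (Z ∩ Z') := by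
  obtain ⟨T, hT, rfl⟩ := h
  obtain ⟨T', hT', rfl⟩ := h'
  exact ⟨T ∩ T', hT.inter hT', rfl⟩

theorem IsConstructibleSet.diff {Z Z' : Set (ι → k)} (h : IsConstructibleSet Z)
    (h' : IsConstructibleSet Z') : IsConstructibleSet (Z \ Z') := h.inter h'.compl

theorem isConstructibleSet_univ : IsConstructibleSet (Set.univ : Set (ι → k)) :=
  isConstructibleSet_iff.mpr ⟨∅, fun _ _ _ _ => trivial⟩

theorem isConstructibleSet_eq_zero (P : MvPolynomial ι k) :
    IsConstructibleSet {x : ι → k | MvPolynomial.eval x P = 0} :=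
  isConstructibleSet_iff.mpr ⟨{P}, fun _ _ h hx => (h P (Finset.mem_singleton_self P)).mp hx⟩

theorem isConstructibleSet_forall {I : Type*} [Finite I] {Z : I → Set (ι → k)}
    (h : ∀ i, IsConstructibleSet (Z i)) : IsConstructibleSet {x | ∀ i, x ∈ Z i} := by
  choose T hT hZ using h
  refine ⟨⋂ i, T i, .iInter hT, ?_⟩
  ext x
  simp [hZ]

theorem isConstructibleSet_exists {I : Type*} [Finite I] {Z : I → Set (ι → k)}
    (h : ∀ i, IsConstructibleSet (Z i)) : IsConstructibleSet {x | ∃ i, x ∈ Z i} := by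
  choose T hT hZ using h
  refine ⟨⋃ i, T i, .iUnion hT, ?_⟩
  ext x
  simp [hZ]

omit [Finite ι] [IsAlgClosed k] in
theorem eval_bind₁ {κ : Type} (Q : κ → MvPolynomial ι k) (P : MvPolynomial κ k) (x : ι → k) :
    MvPolynomial.eval x (MvPolynomial.bind₁ Q P) =
      MvPolynomial.eval (fun i => MvPolynomial.eval x (Q i)) P := by
  rw [← MvPolynomial.coe_aeval_eq_eval, ← MvPolynomial.coe_aeval_eq_eval]
  exact MvPolynomial.aeval_bind₁ _ _ _

/-- The preimage of a constructible set under a map given by polynomials. -/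
theorem IsConstructibleSet.preimage {κ : Type} [Finite κ] {Z : Set (κ → k)}
    (h : IsConstructibleSet Z) (Q : κ → MvPolynomial ι k) :
    IsConstructibleSet {x : ι → k | (fun i => MvPolynomial.eval x (Q i)) ∈ Z} := by
  classical
  obtain ⟨L, hL⟩ := isConstructibleSet_iff.mp h
  refine isConstructibleSet_iff.mpr ⟨L.image (MvPolynomial.bind₁ Q), fun x y hxy =>
    hL _ _ fun P hP => ?_⟩
  have := hxy _ (Finset.mem_image_of_mem _ hP)
  rwa [eval_bind₁, eval_bind₁] at this

end Classes

/-! ### Classes and pull-backs -/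

section Pullback

variable {k : Type u} [Field k] {ι κ : Type}

/-- The morphism `𝔸^κ ⟶ 𝔸^ι` given by a family of polynomials. -/
abbrev polyMap (g : ι → MvPolynomial κ k) : affineScheme k κ ⟶ affineScheme k ι :=
  Spec.map (CommRingCat.ofHom (MvPolynomial.bind₁ g).toRingHom)

theorem polyMap_comp_affineHom (g : ι → MvPolynomial κ k) :
    polyMap g ≫ affineHom k ι = affineHom k κ := by
  rw [polyMap, affineHom, affineHom, ← Spec.map_comp, ← CommRingCat.ofHom_comp]
  congr 2
  ext c
  simp

theorem comap_pt {R : Type u} [CommRing R] (g : MvPolynomial ι k →+* R) (q : PrimeSpectrum R)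
    (x : ι → k) (h : ∀ P, g P ∈ q.asIdeal ↔ MvPolynomial.eval x P = 0) :
    PrimeSpectrum.comap g q = MvPolynomial.pointToPoint x := by
  ext P
  exact (h P).trans (MvPolynomial.mem_vanishingIdeal_singleton_iff x P).symm

theorem mem_pt {x : ι → k} {P : MvPolynomial ι k} :
    P ∈ (MvPolynomial.pointToPoint x : PrimeSpectrum (MvPolynomial ι k)).asIdeal ↔
      MvPolynomial.eval x P = 0 :=
  MvPolynomial.mem_vanishingIdeal_singleton_iff x P

theorem polyMap_pt (g : ι → MvPolynomial κ k) (x : κ → k) :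
    polyMap g (pt x) = pt fun i => MvPolynomial.eval x (g i) :=
  comap_pt _ _ _ fun P => by
    rw [mem_pt, ← eval_bind₁]
    rfl

instance locallyOfFiniteType_polyMap [Finite κ] (g : ι → MvPolynomial κ k) :
    LocallyOfFiniteType (polyMap g) := by
  have : LocallyOfFiniteType (polyMap g ≫ affineHom k ι) := by
    rw [polyMap_comp_affineHom]
    infer_instance
  exact locallyOfFiniteType_of_comp _ (affineHom k ι)

variable [Finite ι] [Finite κ] [IsAlgClosed k] (E : Set (FreeCommRing (Variety k)))

/-- Pull-back of a class along a morphism `g : T ⟶ 𝔸^ι` which on the `k`-points of `T`, a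
subvariety of `𝔸^κ`, is given by `φ`. -/
theorem HasClass.pullback {T : Scheme.{u}} {g : T ⟶ affineScheme k ι} {i : T ⟶ affineScheme k κ}
    [LocallyOfFiniteType g] [QuasiCompact g] [IsSeparated g] [IsImmersion i]
    (h : g ≫ affineHom k ι = i ≫ affineHom k κ) {D : Set (κ → k)} {D' : Set (ι → k)}
    {φ : (κ → k) → ι → k} (h₁ : ∀ x, ∀ t : T, i t = pt x → x ∈ D ∧ g t = pt (φ x))
    (h₂ : ∀ x ∈ D, ∃ t : T, i t = pt x) (m : GrothendieckRing k E)
    (hm : ∀ Y : Piece k ι, Y.points ⊆ D' →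
      classOf E (Y.pullback g i h).variety = classOf E Y.variety * m)
    {Z : Set (ι → k)} (hZ : Z ⊆ D') {c : GrothendieckRing k E} (hc : HasClass E Z c) :
    HasClass E {x | x ∈ D ∧ φ x ∈ Z} (c * m) := by
  obtain ⟨r, Y, hd, rfl, rfl⟩ := hc.exists_pieces
  have hpts : ∀ j, ((Y j).pullback g i h).points = {x | x ∈ D ∧ φ x ∈ (Y j).points} := by
    intro j
    ext x
    rw [Piece.mem_points_pullback]
    constructor
    · rintro ⟨t, ht, htY⟩
      obtain ⟨hx, e⟩ := h₁ x t ht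
      exact ⟨hx, by rw [e] at htY; exact htY⟩
    · rintro ⟨hx, hxY⟩
      obtain ⟨t, ht⟩ := h₂ x hx
      exact ⟨t, ht, by rw [(h₁ x t ht).2]; exact hxY⟩
  rw [Finset.sum_mul, ← Finset.sum_congr rfl fun j _ => hm (Y j)
    ((Set.subset_iUnion (fun j => (Y j).points) j).trans hZ)]
  refine hasClass_of_pieces E (fun j => (Y j).pullback g i h) (fun j j' hj => ?_) ?_
  · dsimp only
    rw [hpts, hpts]
    exact Set.disjoint_left.mpr fun x hx hx' => Set.disjoint_left.mp (hd hj) hx.2 hx'.2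
  · ext x
    simp [hpts]

/-! #### Coordinate subspaces -/

open Classical in
/-- Extension by zero along `α`. -/
def extendZero (α : ι → κ) (x : ι → k) : κ → k := fun i =>
  if h : ∃ j, α j = i then x h.choose else 0

omit [Finite ι] [Finite κ] [IsAlgClosed k] in
theorem extendZero_apply {α : ι → κ} (hα : Function.Injective α) (x : ι → k) (j : ι) :
    extendZero α x (α j) = x j := by
  have h : ∃ j', α j' = α j := ⟨j, rfl⟩
  rw [extendZero, dif_pos h, hα h.choose_spec]

omit [Finite ι] [Finite κ] [IsAlgClosed k] in
theorem extendZero_of_notMem {α : ι → κ} (x : ι → k) {i : κ} (hi : i ∉ Set.range α) :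
    extendZero α x i = 0 :=
  dif_neg hi

omit [Finite ι] [Finite κ] [IsAlgClosed k] in
theorem extendZero_comp {α : ι → κ} (hα : Function.Injective α) {u : κ → k}
    (hu : ∀ i ∉ Set.range α, u i = 0) : extendZero α (u ∘ α) = u := by
  ext i
  by_cases hi : i ∈ Set.range α
  · obtain ⟨j, rfl⟩ := hi
    rw [extendZero_apply hα]
    rfl
  · rw [extendZero_of_notMem _ hi, hu i hi]

open Classical in
/-- A constructible subset of a coordinate subspace has the same class in that subspace. -/
theorem HasClass.comap_extendZero {α : ι → κ} (hα : Function.Injective α) {Z : Set (κ → k)}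
    (hZ : ∀ u ∈ Z, ∀ i ∉ Set.range α, u i = 0) {c : GrothendieckRing k E} (hc : HasClass E Z c) :
    HasClass E {x | extendZero α x ∈ Z} c := by
  let g : κ → MvPolynomial ι k := fun i =>
    if h : ∃ j, α j = i then MvPolynomial.X h.choose else 0
  have hg : ∀ x : ι → k, (fun i => MvPolynomial.eval x (g i)) = extendZero α x := by
    intro x
    ext i
    simp only [g, extendZero]
    split_ifs <;> simp
  have e : polyMap g ≫ affineHom k κ = 𝟙 _ ≫ affineHom k ι := by
    rw [polyMap_comp_affineHom, Category.id_comp]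
  have hsurj : Function.Surjective (MvPolynomial.bind₁ g) := by
    rw [← AlgHom.range_eq_top, eq_top_iff, ← MvPolynomial.adjoin_range_X, Algebra.adjoin_le_iff]
    rintro _ ⟨j, rfl⟩
    refine ⟨MvPolynomial.X (α j), ?_⟩
    have h : ∃ j', α j' = α j := ⟨j, rfl⟩
    change MvPolynomial.bind₁ g (MvPolynomial.X (α j)) = _
    rw [MvPolynomial.bind₁_X_right]
    simp only [g]
    rw [dif_pos h, hα h.choose_spec]
  have : IsClosedImmersion (polyMap g) := IsClosedImmersion.spec_of_surjective _ hsurj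
  have key := HasClass.pullback E (g := polyMap g) (i := 𝟙 _) e (D := Set.univ)
    (D' := {u | ∀ i ∉ Set.range α, u i = 0}) (φ := extendZero α)
    (fun x t ht => ⟨trivial, by
      have ht' : t = pt x := ht
      rw [ht', polyMap_pt, hg]⟩) (fun x _ => ⟨pt x, rfl⟩) 1 (fun Y hY => by
      rw [mul_one]
      have : Surjective (Limits.pullback.fst Y.imm (polyMap g)) := by
        refine ⟨Set.range_eq_univ.mp ?_⟩
        rw [Scheme.Pullback.range_fst]
        refine Set.eq_univ_of_forall fun y => ?_
        refine subset_of_forall_pt_mem Y.isConstructible_range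
          (Piece.ofImmersion (polyMap g)).isConstructible_range (fun u hu => ?_) ⟨y, rfl⟩
        refine ⟨pt (u ∘ α), ?_⟩
        have := polyMap_pt g (u ∘ α)
        rw [hg, extendZero_comp hα (hY hu)] at this
        exact this
      exact classOf_surjective_immersion E (X := Y.variety)
        (Y := (Y.pullback (polyMap g) (𝟙 _) e).variety)
        (Limits.pullback.fst Y.imm (polyMap g)) rfl) hZ hc
  simpa using key

/-! #### Products with affine spaces -/

omit [Finite ι] [Finite κ] [IsAlgClosed k] in
/-- `𝔸^(ι ⊕ κ)` is the product of `𝔸^ι` and `𝔸^κ`. -/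
theorem isPullback_affine (ι κ : Type) :
    IsPullback (polyMap fun i : ι => (MvPolynomial.X (Sum.inl i) : MvPolynomial (ι ⊕ κ) k))
      (polyMap fun i : κ => (MvPolynomial.X (Sum.inr i) : MvPolynomial (ι ⊕ κ) k))
      (affineHom k ι) (affineHom k κ) := by
  refine isPullback_SpecMap_of_isPushout _ _ _ _ ⟨⟨?_⟩, ⟨Limits.PushoutCocone.IsColimit.mk _
    (fun s => CommRingCat.ofHom (MvPolynomial.eval₂Hom
      (s.inl.hom.comp MvPolynomial.C)
      (Sum.elim (fun i => s.inl.hom (MvPolynomial.X i)) fun i => s.inr.hom (MvPolynomial.X i))))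
    (fun s => ?_) (fun s => ?_) fun s m h₁ h₂ => ?_⟩⟩
  · ext c
    simp
  · ext i
    · simp
    · simp
  · have hs := fun c => congr($(s.condition).hom c)
    ext i
    · simpa using hs i
    · simp
  · ext i
    · have := congr($(h₁).hom (MvPolynomial.C i))
      simpa using this
    · obtain i | i := i
      · have := congr($(h₁).hom (MvPolynomial.X i))
        simpa using this
      · have := congr($(h₂).hom (MvPolynomial.X i))
        simpa using this

omit [IsAlgClosed k] in
theorem classOf_pullback_sum (Y : Piece k ι) :
    classOf E (Y.pullback (κ := ι ⊕ κ)
      (polyMap fun i : ι => (MvPolynomial.X (Sum.inl i) : MvPolynomial (ι ⊕ κ) k)) (𝟙 _)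
      (by rw [polyMap_comp_affineHom, Category.id_comp])).variety =
      classOf E Y.variety * classOf E (affineVariety k κ) := by
  have h := (IsPullback.of_hasPullback Y.imm
    (polyMap fun i : ι => (MvPolynomial.X (Sum.inl i) : MvPolynomial (ι ⊕ κ) k))).flip.paste_horiz
    (isPullback_affine (k := k) ι κ).flip
  rw [Y.comp_hom] at h
  have := classOf_eq_of_relation E (.prod Y.variety (affineVariety k κ) (Y.pullback (κ := ι ⊕ κ)
      (polyMap fun i : ι => (MvPolynomial.X (Sum.inl i) : MvPolynomial (ι ⊕ κ) k)) (𝟙 _)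
      (by rw [polyMap_comp_affineHom, Category.id_comp])).variety _ _ h.flip rfl)
  rwa [map_sub, map_mul, sub_eq_zero] at this

theorem mul_classOf_affineVariety {Z : Set (ι → k)} {c : GrothendieckRing k E}
    (hc : HasClass E Z c) : HasClass E {x : ι ⊕ κ → k | x ∘ Sum.inl ∈ Z}
      (c * classOf E (affineVariety k κ)) := by
  have e : (polyMap fun i : ι => (MvPolynomial.X (Sum.inl i) : MvPolynomial (ι ⊕ κ) k)) ≫
      affineHom k ι = 𝟙 _ ≫ affineHom k (ι ⊕ κ) := by
    rw [polyMap_comp_affineHom, Category.id_comp]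
  have key := HasClass.pullback E (i := 𝟙 _) e (D := Set.univ) (D' := Set.univ)
    (φ := fun x => x ∘ Sum.inl) (fun x t ht => ⟨trivial, by
      have ht' : t = pt x := ht
      rw [ht', polyMap_pt]
      congr 1
      ext i
      simp⟩) (fun x _ => ⟨pt x, rfl⟩) (classOf E (affineVariety k κ))
    (fun Y _ => classOf_pullback_sum E Y) (Set.subset_univ Z) hc
  simpa using key

theorem hasClass_univ : HasClass E (Set.univ : Set (ι → k)) (classOf E (affineVariety k ι)) := by
  have := hasClass_of_pieces E (I := Unit)
    (fun _ => Piece.ofImmersion (𝟙 (affineScheme k ι))) (fun i j h => (h rfl).elim)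
    (Z := Set.univ) (by
      ext x
      simp only [Set.mem_univ, Set.iUnion_const, true_iff]
      exact ⟨pt x, rfl⟩)
  rw [Fintype.sum_unique] at this
  convert! this

theorem classOf_affineVariety_congr (e : ι ≃ κ) :
    classOf E (affineVariety k ι) = classOf E (affineVariety k κ) :=
  (hasClass_univ E).unique E ((hasClass_univ (ι := κ) E).comap_extendZero E e.injective
    fun _ _ i hi => (hi (e.surjective i)).elim)

/-- `[𝔸ⁿ] = 𝕃 ^ n`. -/
theorem classOf_affineVariety (κ : Type) [Finite κ] :
    classOf E (affineVariety k κ) = lefschetz E ^ Nat.card κ := by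
  rw [classOf_affineVariety_congr E (Finite.equivFin κ)]
  induction Nat.card κ with
  | zero =>
    have : IsIso (affineVariety k (Fin 0)).hom := by
      have : IsIso (CommRingCat.ofHom (MvPolynomial.C : k →+* MvPolynomial (Fin 0) k)) := by
        rw [ConcreteCategory.isIso_iff_bijective]
        exact ⟨MvPolynomial.C_injective _ _, MvPolynomial.C_surjective _⟩
      exact inferInstanceAs (IsIso (Spec.map (CommRingCat.ofHom
        (MvPolynomial.C : k →+* MvPolynomial (Fin 0) k))))
    have := classOf_eq_of_relation E (.point (affineVariety k (Fin 0)) this)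
    rw [map_sub, map_one, sub_eq_zero] at this
    rw [pow_zero]
    exact this
  | succ n ih =>
    rw [← classOf_affineVariety_congr E (finSumFinEquiv (m := n) (n := 1))]
    have h := mul_classOf_affineVariety (κ := Fin 1) E (hasClass_univ (k := k) (ι := Fin n) E)
    rw [(hasClass_univ (k := k) (ι := Fin n ⊕ Fin 1) E).unique E (by simpa using h), ih, pow_succ,
      lefschetz]

/-! #### Pull-back along a purely inseparable endomorphism of a principal open set -/

omit [Finite κ] [IsAlgClosed k] in
theorem universallyInjective_of_pow_mem_range (p : ℕ) [Fact p.Prime] [CharP k p] {R S : Type u}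
    [CommRing R] [CommRing S] [Algebra k S] (t : R →+* S) (ht : ∀ r, r ^ p ∈ t.range) :
    UniversallyInjective (Spec.map (CommRingCat.ofHom t)) := by
  refine ((tfae_universallyInjective (Spec.map (CommRingCat.ofHom t))).out 0 1).mpr ?_
  intro K _ f g hfg
  obtain ⟨f, rfl⟩ := Spec.map_surjective f
  obtain ⟨g, rfl⟩ := Spec.map_surjective g
  congr 1
  ext s
  obtain ⟨r, hr⟩ := ht s
  have h : f.hom (t r) = g.hom (t r) := by
    simp only [← Spec.map_comp] at hfg
    have := congr($(Spec.map_injective hfg).hom r)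
    simpa using this
  have : CharP K p := by
    have : Nontrivial S := RingHom.domain_nontrivial f.hom
    have : CharP S p := charP_of_injective_algebraMap (algebraMap k S).injective p
    exact charP_of_injective_ringHom (f.hom.comp (algebraMap k S)).injective p
  rw [hr, map_pow, map_pow] at h
  exact frobenius_inj K p h

variable {h : MvPolynomial κ k} {Θ : κ → MvPolynomial κ k}
  {t : Localization.Away h →+* Localization.Away h}

omit [Finite κ] in
theorem injective_of_surjective_on_points (h0 : h ≠ 0)
    (ht : ∀ P, t (algebraMap _ _ P) = algebraMap _ _ (MvPolynomial.bind₁ Θ P))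
    (hs : ∀ y, MvPolynomial.eval y h ≠ 0 →
      ∃ x, MvPolynomial.eval x h ≠ 0 ∧ (fun i => MvPolynomial.eval x (Θ i)) = y) :
    Function.Injective t := by
  have hinj : Function.Injective (algebraMap (MvPolynomial κ k) (Localization.Away h)) :=
    IsLocalization.injective _ (powers_le_nonZeroDivisors_of_noZeroDivisors h0)
  rw [injective_iff_map_eq_zero]
  intro r hr
  obtain ⟨P, s, rfl⟩ := IsLocalization.exists_mk'_eq (Submonoid.powers h) r
  rw [IsLocalization.mk'_eq_zero_iff]
  have h₁ : t (algebraMap _ _ P) = 0 := by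
    rw [← IsLocalization.mk'_spec (Localization.Away h) P s, map_mul, hr, zero_mul]
  rw [ht, map_eq_zero_iff _ hinj] at h₁
  refine ⟨⟨h, Submonoid.mem_powers h⟩, ?_⟩
  refine MvPolynomial.funext fun y => ?_
  rw [map_mul, map_zero]
  by_cases hy : MvPolynomial.eval y h = 0
  · simp [hy]
  · obtain ⟨x, -, rfl⟩ := hs y hy
    rw [← eval_bind₁, ← eval_bind₁ Θ P, h₁, map_zero, mul_zero]

/-- The class of a constructible subset of the open set `h ≠ 0` is invariant under pull-back along
an endomorphism of that open set which is surjective on points and whose comorphism has all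
`p`-th powers in its image, because such an endomorphism is a universal homeomorphism. -/
theorem HasClass.comap_away (p : ℕ) [Fact p.Prime] [CharP k p] (h0 : h ≠ 0)
    (ht : ∀ P, t (algebraMap _ _ P) = algebraMap _ _ (MvPolynomial.bind₁ Θ P))
    (hp : ∀ r, r ^ p ∈ t.range)
    (hs : ∀ y, MvPolynomial.eval y h ≠ 0 →
      ∃ x, MvPolynomial.eval x h ≠ 0 ∧ (fun i => MvPolynomial.eval x (Θ i)) = y)
    {Z : Set (κ → k)} (hZ : ∀ x ∈ Z, MvPolynomial.eval x h ≠ 0) {c : GrothendieckRing k E}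
    (hc : HasClass E Z c) :
    HasClass E {x | MvPolynomial.eval x h ≠ 0 ∧ (fun i => MvPolynomial.eval x (Θ i)) ∈ Z} c := by
  let u : Spec (CommRingCat.of (Localization.Away h)) ⟶ affineScheme k κ :=
    Spec.map (CommRingCat.ofHom (algebraMap (MvPolynomial κ k) (Localization.Away h)))
  let θ : Spec (CommRingCat.of (Localization.Away h)) ⟶
    Spec (CommRingCat.of (Localization.Away h)) := Spec.map (CommRingCat.ofHom t)
  have hu : IsOpenImmersion u := inferInstanceAs (IsOpenImmersion (Spec.map (CommRingCat.ofHom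
    (algebraMap (MvPolynomial κ k) (Localization.Away h)))))
  have hθ₁ : UniversallyInjective θ := universallyInjective_of_pow_mem_range (k := k) p t hp
  have hθ₂ : Surjective θ := ⟨(PrimeSpectrum.isHomeomorph_comap t
    (fun r => ⟨p, (Fact.out : p.Prime).pos, hp r⟩) (by
      rw [(RingHom.injective_iff_ker_eq_bot t).mp (injective_of_surjective_on_points h0 ht hs)]
      exact bot_le)).surjective⟩
  have hθ₃ : UniversallyClosed θ := by
    have hint : t.IsIntegral := fun r => by
      obtain ⟨s, hs⟩ := hp r
      exact ⟨Polynomial.X ^ p - Polynomial.C s,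
        Polynomial.monic_X_pow_sub_C s (Fact.out : p.Prime).ne_zero, by simp [hs]⟩
    have : IsIntegralHom θ := IsIntegralHom.SpecMap_iff.mpr hint
    infer_instance
  have hcomp : θ ≫ u = u ≫ polyMap Θ := by
    rw [← Spec.map_comp, ← Spec.map_comp, ← CommRingCat.ofHom_comp, ← CommRingCat.ofHom_comp]
    congr 2
    exact RingHom.ext ht
  have e : (θ ≫ u) ≫ affineHom k κ = u ≫ affineHom k κ := by
    rw [hcomp, Category.assoc, polyMap_comp_affineHom]
  have : LocallyOfFiniteType (θ ≫ u) := by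
    have : LocallyOfFiniteType ((θ ≫ u) ≫ affineHom k κ) := by
      rw [e]
      infer_instance
    exact locallyOfFiniteType_of_comp _ (affineHom k κ)
  have hru : Set.range u = (PrimeSpectrum.zeroLocus {h})ᶜ := Piece.range_nonvanishing h
  have key := HasClass.pullback E e (D := {x | MvPolynomial.eval x h ≠ 0})
    (D' := {x | MvPolynomial.eval x h ≠ 0}) (φ := fun x i => MvPolynomial.eval x (Θ i))
    (fun x q hq => ?_) (fun x hx => ?_) 1 (fun Y hY => ?_) hZ hc
  · simpa using key
  · refine ⟨?_, ?_⟩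
    · have : pt x ∈ Set.range u := ⟨q, hq⟩
      rw [hru] at this
      exact (pt_mem_zeroLocus h x).not.mp this
    · rw [hcomp, Scheme.Hom.comp_apply, hq, polyMap_pt]
  · have : pt x ∈ Set.range u := by
      rw [hru]
      exact (pt_mem_zeroLocus h x).not.mpr hx
    exact this
  · have hr : Set.range Y.imm ⊆ Set.range u := by
      refine subset_of_forall_pt_mem Y.isConstructible_range
        (Piece.nonvanishing h).isConstructible_range fun x hx => ?_
      rw [Piece.range_nonvanishing]
      exact (pt_mem_zeroLocus h x).not.mpr (hY hx)
    have h₂ : Surjective (Limits.pullback.fst Y.imm (θ ≫ u)) := by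
      refine ⟨Set.range_eq_univ.mp ?_⟩
      rw [Scheme.Pullback.range_fst]
      refine Set.eq_univ_of_forall fun y => ?_
      obtain ⟨q, hq⟩ := hr ⟨y, rfl⟩
      obtain ⟨q, rfl⟩ := hθ₂.surj q
      exact ⟨q, hq⟩
    have h₃ : UniversallyClosed (Limits.pullback.fst Y.imm (θ ≫ u)) := by
      let l := IsOpenImmersion.lift u Y.imm hr
      have hl : l ≫ u = Y.imm := IsOpenImmersion.lift_fac u Y.imm hr
      have w : Limits.pullback.fst Y.imm (θ ≫ u) ≫ l =
          Limits.pullback.snd Y.imm (θ ≫ u) ≫ θ := by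
        rw [← cancel_mono u, Category.assoc, Category.assoc, hl, Limits.pullback.condition]
      refine MorphismProperty.of_isPullback (P := @UniversallyClosed) (g := θ) (f := l)
        (f' := Limits.pullback.snd Y.imm (θ ≫ u)) (IsPullback.flip ⟨⟨w⟩,
          ⟨Limits.PullbackCone.IsLimit.mk w (fun s => Limits.pullback.lift s.fst s.snd ?_)
            (fun s => Limits.pullback.lift_fst ..) (fun s => Limits.pullback.lift_snd ..)
            fun s m h₁ h₂ => ?_⟩⟩) hθ₃
      · rw [← hl, ← Category.assoc, s.condition, Category.assoc]
      · refine Limits.pullback.hom_ext ?_ ?_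
        · rw [h₁, Limits.pullback.lift_fst]
        · rw [h₂, Limits.pullback.lift_snd]
    have h₁ : UniversallyInjective (Limits.pullback.fst Y.imm (θ ≫ u)) :=
      MorphismProperty.of_isPullback (IsPullback.of_hasPullback Y.imm (θ ≫ u)).flip
        (MorphismProperty.comp_mem @UniversallyInjective θ u hθ₁ inferInstance)
    rw [mul_one]
    exact classOf_univHomeo E (X := Y.variety) (Y := (Y.pullback (θ ≫ u) u e).variety)
      (Limits.pullback.fst Y.imm (θ ≫ u)) rfl

end Pullback

/-! ### Dimension -/

section Dimension

section Rings

variable {A B : Type*} [CommRing A] [CommRing B]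

theorem strictMono_comap_of_isIntegral (f : A →+* B) (hf : f.IsIntegral) :
    StrictMono (PrimeSpectrum.comap f) := by
  intro q q' h
  let _ := f.toAlgebra
  have : Algebra.IsIntegral A B := ⟨hf⟩
  exact Ideal.IsIntegral.comap_lt_comap (R := A) (A := B) (I := q.asIdeal) (J := q'.asIdeal) h

theorem ringKrullDim_le_of_isIntegral (f : A →+* B) (hf : f.IsIntegral) :
    ringKrullDim B ≤ ringKrullDim A :=
  Order.krullDim_le_of_strictMono _ (strictMono_comap_of_isIntegral f hf)

/-- Chains of prime ideals lift along injective integral homomorphisms. -/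
theorem ringKrullDim_le_of_isIntegral_of_injective (f : A →+* B) (hf : f.IsIntegral)
    (hinj : Function.Injective f) : ringKrullDim A ≤ ringKrullDim B := by
  let _ := f.toAlgebra
  have : Algebra.IsIntegral A B := ⟨hf⟩
  refine iSup_le fun l => ?_
  obtain ⟨Q, hQ⟩ := hf.comap_surjective hinj l.head
  have : Q.asIdeal.LiesOver l.head.asIdeal := ⟨by rw [← hQ]; rfl⟩
  obtain ⟨L, hL, -, -⟩ := Ideal.exists_ltSeries_of_hasGoingUp (R := A) (S := B) l Q.asIdeal
  rw [← hL]
  exact le_iSup (fun p : LTSeries (PrimeSpectrum B) => ((p.length : ℕ∞) : WithBot ℕ∞)) L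

end Rings

variable {k : Type u} [Field k]

/-- The Krull dimension is monotone for inclusions of finitely generated algebras over a field:
some prime ideal of the larger algebra meets a Noether normalization of the smaller one trivially,
and the residue domain has at least the same transcendence degree. -/
theorem ringKrullDim_le_of_injective {A B : Type u} [CommRing A] [CommRing B] [Algebra k A]
    [Algebra k B] [Algebra.FiniteType k A] [Algebra.FiniteType k B] (f : A →ₐ[k] B)
    (hf : Function.Injective f) : ringKrullDim A ≤ ringKrullDim B := by
  rcases subsingleton_or_nontrivial A with hA | hA
  · rw [ringKrullDim_eq_bot_of_subsingleton]
    exact bot_le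
  obtain ⟨s, g, hg, hgi⟩ := exists_integral_inj_algHom_of_fg k A
  have h₁ : ringKrullDim A ≤ s := by
    refine (ringKrullDim_le_of_isIntegral g.toRingHom hgi).trans ?_
    rw [MvPolynomial.ringKrullDim_of_isNoetherianRing, ringKrullDim_eq_zero_of_field]
    simp
  refine h₁.trans ?_
  obtain ⟨q, hq, hq'⟩ := Ideal.exists_comap_eq_of_mem_minimalPrimes_of_injective
    (f := (f.comp g).toRingHom) (hf.comp hg) ⊥ (by
      rw [IsDomain.minimalPrimes_eq_singleton_bot]; rfl)
  obtain ⟨n, g', hg', hgi'⟩ := exists_integral_inj_algHom_of_fg k (B ⧸ q)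
  have h₂ : (n : WithBot ℕ∞) ≤ ringKrullDim B := by
    refine le_trans ?_ (ringKrullDim_quotient_le q)
    refine le_trans ?_ (ringKrullDim_le_of_isIntegral_of_injective g'.toRingHom hgi' hg')
    rw [MvPolynomial.ringKrullDim_of_isNoetherianRing, ringKrullDim_eq_zero_of_field]
    simp
  refine le_trans ?_ h₂
  have hinj : Function.Injective ((Ideal.Quotient.mkₐ k q).comp (f.comp g)) := by
    rw [injective_iff_map_eq_zero]
    intro P hP
    have hq'' : f (g P) ∈ q := Ideal.Quotient.eq_zero_iff_mem.mp hP
    have : P ∈ q.comap (f.comp g).toRingHom := hq''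
    rwa [hq', Ideal.mem_bot] at this
  have h₃ := lift_trdeg_le_of_injective _ hinj
  have halg : Algebra.IsAlgebraic
      (Algebra.adjoin k (Set.range fun i => g' (MvPolynomial.X i))) (B ⧸ q) := by
    have e : Algebra.adjoin k (Set.range fun i => g' (MvPolynomial.X i)) = g'.range := by
      have : (Set.range fun i => g' (MvPolynomial.X i)) =
          g' '' Set.range (MvPolynomial.X : Fin n → MvPolynomial (Fin n) k) := by
        rw [← Set.range_comp]
        rfl
      rw [this, ← AlgHom.map_adjoin, MvPolynomial.adjoin_range_X, Algebra.map_top]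
    rw [e]
    have hi : (algebraMap g'.range (B ⧸ q)).IsIntegral :=
      RingHom.IsIntegral.tower_top g'.rangeRestrict.toRingHom (algebraMap g'.range (B ⧸ q)) hgi'
    have : Algebra.IsIntegral g'.range (B ⧸ q) := ⟨hi⟩
    infer_instance
  have h₄ := Algebra.IsAlgebraic.trdeg_le_cardinalMk k
    (Set.range fun i => g' (MvPolynomial.X i))
  have h₅ := Cardinal.mk_range_le_lift (f := fun i => g' (MvPolynomial.X i))
  rw [MvPolynomial.trdeg_of_isDomain] at h₃
  simp only [Cardinal.mk_fin, Cardinal.lift_natCast, Cardinal.lift_id, Cardinal.lift_uzero] at h₃ h₅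
  have h₆ : (s : Cardinal) ≤ n := h₃.trans (h₄.trans h₅)
  exact_mod_cast h₆

variable {ι κ : Type}

theorem dimension_mono {Z Z' : Set (ι → k)} (h : Z ⊆ Z') : dimension Z ≤ dimension Z' :=
  ringKrullDim_le_of_surjective (Ideal.Quotient.factor (MvPolynomial.vanishingIdeal_anti_mono h))
    (Ideal.Quotient.factor_surjective _)

theorem dimension_union_le (Z Z' : Set (ι → k)) :
    dimension (Z ∪ Z') ≤ max (dimension Z) (dimension Z') := by
  rw [dimension, dimension, dimension, ringKrullDim_quotient, ringKrullDim_quotient,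
    ringKrullDim_quotient]
  refine iSup_le fun l => ?_
  have key : ∀ Y : Set (ι → k), MvPolynomial.vanishingIdeal k Y ≤ l.head.1.asIdeal →
      ((l.length : ℕ∞) : WithBot ℕ∞) ≤ Order.krullDim (PrimeSpectrum.zeroLocus
        (R := MvPolynomial ι k) (MvPolynomial.vanishingIdeal k Y)) := by
    intro Y hY
    have hle : ∀ i, l.head ≤ l i := fun i => LTSeries.head_le l i
    refine le_trans ?_ (le_iSup _ (⟨l.length, fun i => ⟨(l i).1, hY.trans (hle i)⟩,
      fun i => l.step i⟩ : LTSeries (PrimeSpectrum.zeroLocus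
        (R := MvPolynomial ι k) (MvPolynomial.vanishingIdeal k Y))))
    exact le_rfl
  have h : MvPolynomial.vanishingIdeal k Z * MvPolynomial.vanishingIdeal k Z' ≤
      l.head.1.asIdeal := by
    refine le_trans ?_ l.head.2
    refine Ideal.mul_le.mpr fun P hP Q hQ => ?_
    rintro x (hx | hx)
    · rw [map_mul, hP x hx, zero_mul]
    · rw [map_mul, hQ x hx, mul_zero]
  rcases l.head.1.2.mul_le.mp h with h | h
  · exact le_max_of_le_left (key Z h)
  · exact le_max_of_le_right (key Z' h)

theorem dimension_le_card [Finite ι] (Z : Set (ι → k)) : dimension Z ≤ Nat.card ι := by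
  refine (ringKrullDim_quotient_le _).trans ?_
  rw [MvPolynomial.ringKrullDim_of_isNoetherianRing, ringKrullDim_eq_zero_of_field, zero_add]

theorem dimension_le_of_surjective {Z : Set (ι → k)} {Z' : Set (κ → k)}
    (f : MvPolynomial ι k →+* MvPolynomial κ k)
    (hI : MvPolynomial.vanishingIdeal k Z ≤ (MvPolynomial.vanishingIdeal k Z').comap f)
    (hf : Function.Surjective ((Ideal.Quotient.mk (MvPolynomial.vanishingIdeal k Z')).comp f)) :
    dimension Z' ≤ dimension Z :=
  ringKrullDim_le_of_surjective (Ideal.quotientMap _ f hI) fun y => by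
    obtain ⟨x, rfl⟩ := hf y
    exact ⟨Ideal.Quotient.mk _ x, rfl⟩

theorem mem_vanishingIdeal {Z : Set (ι → k)} {P : MvPolynomial ι k} :
    P ∈ MvPolynomial.vanishingIdeal k Z ↔ ∀ x ∈ Z, MvPolynomial.eval x P = 0 := Iff.rfl

open Classical in
theorem dimension_comap_extendZero_le {α : ι → κ} (hα : Function.Injective α)
    (Z : Set (κ → k)) : dimension {x | extendZero α x ∈ Z} ≤ dimension Z := by
  let g : κ → MvPolynomial ι k := fun i =>
    if h : ∃ j, α j = i then MvPolynomial.X h.choose else 0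
  have hg : ∀ x : ι → k, (fun i => MvPolynomial.eval x (g i)) = extendZero α x := by
    intro x
    ext i
    simp only [g, extendZero]
    split_ifs <;> simp
  refine dimension_le_of_surjective (MvPolynomial.bind₁ g).toRingHom (fun P hP x hx => ?_)
    (Ideal.Quotient.mk_surjective.comp ?_)
  · change MvPolynomial.eval x (MvPolynomial.bind₁ g P) = 0
    rw [eval_bind₁, hg]
    exact hP _ hx
  · change Function.Surjective (MvPolynomial.bind₁ g)
    rw [← AlgHom.range_eq_top, eq_top_iff, ← MvPolynomial.adjoin_range_X, Algebra.adjoin_le_iff]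
    rintro _ ⟨j, rfl⟩
    refine ⟨MvPolynomial.X (α j), ?_⟩
    have h : ∃ j', α j' = α j := ⟨j, rfl⟩
    change MvPolynomial.bind₁ g (MvPolynomial.X (α j)) = _
    rw [MvPolynomial.bind₁_X_right]
    simp only [g]
    rw [dif_pos h, hα h.choose_spec]

theorem dimension_le_comap_extendZero {α : ι → κ} (hα : Function.Injective α)
    {Z : Set (κ → k)} (hZ : ∀ u ∈ Z, ∀ i ∉ Set.range α, u i = 0) :
    dimension Z ≤ dimension {x | extendZero α x ∈ Z} := by
  have hev : ∀ (u : κ → k) P, MvPolynomial.eval u (MvPolynomial.rename α P) =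
      MvPolynomial.eval (u ∘ α) P := fun u P => MvPolynomial.eval_rename _ _ _
  refine dimension_le_of_surjective (MvPolynomial.rename α).toRingHom (fun P hP u hu => ?_) ?_
  · change MvPolynomial.eval u (MvPolynomial.rename α P) = 0
    rw [hev]
    refine hP _ ?_
    change extendZero α (u ∘ α) ∈ Z
    rwa [extendZero_comp hα (hZ u hu)]
  · change Function.Surjective ((Ideal.Quotient.mkₐ k (MvPolynomial.vanishingIdeal k Z)).comp
      (MvPolynomial.rename α))
    rw [← AlgHom.range_eq_top, eq_top_iff]
    have htop : (⊤ : Subalgebra k (MvPolynomial κ k ⧸ MvPolynomial.vanishingIdeal k Z)) =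
        Algebra.adjoin k (Ideal.Quotient.mkₐ k _ '' Set.range MvPolynomial.X) := by
      rw [← AlgHom.map_adjoin, MvPolynomial.adjoin_range_X, Algebra.map_top, eq_comm,
        AlgHom.range_eq_top]
      exact Ideal.Quotient.mk_surjective
    rw [htop, Algebra.adjoin_le_iff]
    rintro _ ⟨_, ⟨i, rfl⟩, rfl⟩
    by_cases hi : i ∈ Set.range α
    · obtain ⟨j, rfl⟩ := hi
      exact ⟨MvPolynomial.X j, by simp⟩
    · refine ⟨0, ?_⟩
      rw [map_zero, eq_comm]
      refine Ideal.Quotient.eq_zero_iff_mem.mpr fun u hu => ?_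
      change MvPolynomial.eval u _ = 0
      rw [MvPolynomial.eval_X, hZ u hu i hi]

/-- The coordinate ring of `Z × 𝔸^κ` is the polynomial ring over that of `Z`. -/
theorem dimension_prod [Infinite k] [Finite ι] [Finite κ] (Z : Set (ι → k)) :
    dimension {x : ι ⊕ κ → k | x ∘ Sum.inl ∈ Z} = dimension Z + Nat.card κ := by
  rw [dimension, dimension, ← MvPolynomial.ringKrullDim_of_isNoetherianRing]
  let I := MvPolynomial.vanishingIdeal k Z
  let I' := MvPolynomial.vanishingIdeal k {x : ι ⊕ κ → k | x ∘ Sum.inl ∈ Z}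
  let f₀ : MvPolynomial ι k ⧸ I →+* MvPolynomial (ι ⊕ κ) k ⧸ I' :=
    Ideal.quotientMap I' (MvPolynomial.rename Sum.inl).toRingHom fun P hP u hu => by
      change MvPolynomial.eval u (MvPolynomial.rename Sum.inl P) = 0
      rw [MvPolynomial.eval_rename]
      exact hP _ hu
  let f := MvPolynomial.eval₂Hom f₀ fun i : κ => Ideal.Quotient.mk I' (MvPolynomial.X (Sum.inr i))
  have hsurj : Function.Surjective f := by
    intro y
    obtain ⟨P, rfl⟩ := Ideal.Quotient.mk_surjective y
    have h0 : ∀ Q, f (MvPolynomial.C (Ideal.Quotient.mk _ Q)) =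
        Ideal.Quotient.mk I' (MvPolynomial.rename Sum.inl Q) := fun Q => by
      rw [MvPolynomial.coe_eval₂Hom, MvPolynomial.eval₂_C]
      rfl
    induction P using MvPolynomial.induction_on with
    | C c => exact ⟨_, (h0 (MvPolynomial.C c)).trans (by rw [MvPolynomial.rename_C])⟩
    | add P Q hP hQ =>
      obtain ⟨P', hP⟩ := hP
      obtain ⟨Q', hQ⟩ := hQ
      exact ⟨P' + Q', by rw [map_add, map_add, hP, hQ]⟩
    | mul_X P i hP =>
      obtain ⟨P', hP⟩ := hP
      obtain i | i := i
      · exact ⟨P' * MvPolynomial.C (Ideal.Quotient.mk _ (MvPolynomial.X i)), by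
          rw [map_mul, map_mul, hP, h0, MvPolynomial.rename_X]⟩
      · exact ⟨P' * MvPolynomial.X i, by
          rw [map_mul, map_mul, hP, MvPolynomial.coe_eval₂Hom, MvPolynomial.eval₂_X]⟩
  have hinj : Function.Injective f := by
    rw [injective_iff_map_eq_zero]
    intro P hP
    let ev (x : ι → k) (hx : x ∈ Z) : MvPolynomial ι k ⧸ I →+* k :=
      Ideal.Quotient.lift I (MvPolynomial.eval x) fun Q hQ => hQ x hx
    let ev' (u : ι ⊕ κ → k) (hu : u ∘ Sum.inl ∈ Z) : MvPolynomial (ι ⊕ κ) k ⧸ I' →+* k :=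
      Ideal.Quotient.lift I' (MvPolynomial.eval u) fun Q hQ => hQ u hu
    have hev : ∀ u hu, (ev' u hu).comp f = (MvPolynomial.eval (u ∘ Sum.inr)).comp
        (MvPolynomial.map (ev (u ∘ Sum.inl) hu)) := by
      intro u hu
      refine MvPolynomial.ringHom_ext' (Ideal.Quotient.ringHom_ext ?_) fun i => ?_
      · refine MvPolynomial.ringHom_ext (fun c => ?_) fun i => ?_
        · simp only [f, f₀, RingHom.comp_apply, MvPolynomial.coe_eval₂Hom, MvPolynomial.eval₂_C,
            MvPolynomial.map_C, MvPolynomial.eval_C]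
          change MvPolynomial.eval u (MvPolynomial.rename Sum.inl (MvPolynomial.C c)) =
            MvPolynomial.eval _ (MvPolynomial.C c)
          simp
        · simp only [f, f₀, RingHom.comp_apply, MvPolynomial.coe_eval₂Hom, MvPolynomial.eval₂_C,
            MvPolynomial.map_C, MvPolynomial.eval_C]
          change MvPolynomial.eval u (MvPolynomial.rename Sum.inl (MvPolynomial.X i)) =
            MvPolynomial.eval _ (MvPolynomial.X i)
          simp
      · simp only [f, RingHom.comp_apply, MvPolynomial.coe_eval₂Hom, MvPolynomial.eval₂_X,
          MvPolynomial.map_X, MvPolynomial.eval_X]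
        change MvPolynomial.eval u (MvPolynomial.X (Sum.inr i)) = _
        simp
    have h1 : ∀ x (hx : x ∈ Z), MvPolynomial.map (ev x hx) P = 0 := by
      intro x hx
      refine MvPolynomial.funext fun y => ?_
      have := RingHom.congr_fun (hev (Sum.elim x y) hx) P
      rw [RingHom.comp_apply, hP, map_zero] at this
      rw [map_zero]
      exact this.symm
    ext m
    rw [MvPolynomial.coeff_zero]
    obtain ⟨Q, hQ⟩ := Ideal.Quotient.mk_surjective (MvPolynomial.coeff m P)
    rw [← hQ]
    refine Ideal.Quotient.eq_zero_iff_mem.mpr fun x hx => ?_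
    have := congrArg (MvPolynomial.coeff m) (h1 x hx)
    rw [MvPolynomial.coeff_map, ← hQ, MvPolynomial.coeff_zero] at this
    exact this
  exact (ringKrullDim_eq_of_ringEquiv (RingEquiv.ofBijective f ⟨hinj, hsurj⟩)).symm

variable {h : MvPolynomial κ k} {Θ : κ → MvPolynomial κ k}
  {t : Localization.Away h →+* Localization.Away h}

/-- An endomorphism of the open set `h ≠ 0` that is surjective on points does not raise
dimensions. -/
theorem dimension_le_comap_away [Finite κ]
    (hs : ∀ y, MvPolynomial.eval y h ≠ 0 →
      ∃ x, MvPolynomial.eval x h ≠ 0 ∧ (fun i => MvPolynomial.eval x (Θ i)) = y)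
    {Z : Set (κ → k)} (hZ : ∀ x ∈ Z, MvPolynomial.eval x h ≠ 0) :
    dimension Z ≤ dimension
      {x | MvPolynomial.eval x h ≠ 0 ∧ (fun i => MvPolynomial.eval x (Θ i)) ∈ Z} := by
  have hI : ∀ P, P ∈ MvPolynomial.vanishingIdeal k Z ↔ MvPolynomial.bind₁ Θ P ∈
      MvPolynomial.vanishingIdeal k
        {x | MvPolynomial.eval x h ≠ 0 ∧ (fun i => MvPolynomial.eval x (Θ i)) ∈ Z} := by
    intro P
    rw [mem_vanishingIdeal, mem_vanishingIdeal]
    constructor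
    · intro hP x hx
      rw [eval_bind₁]
      exact hP _ hx.2
    · intro hP y hy
      obtain ⟨x, hx, rfl⟩ := hs y (hZ y hy)
      rw [← eval_bind₁]
      exact hP x ⟨hx, hy⟩
  refine ringKrullDim_le_of_injective (k := k) (Ideal.quotientMapₐ (MvPolynomial.vanishingIdeal k
    {x | MvPolynomial.eval x h ≠ 0 ∧ (fun i => MvPolynomial.eval x (Θ i)) ∈ Z})
    (MvPolynomial.bind₁ Θ) fun P hP => (hI P).mp hP) ?_
  rw [injective_iff_map_eq_zero]
  intro y hy
  obtain ⟨P, rfl⟩ := Ideal.Quotient.mk_surjective y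
  exact Ideal.Quotient.eq_zero_iff_mem.mpr ((hI P).mpr (Ideal.Quotient.eq_zero_iff_mem.mp hy))

/-- An endomorphism of the open set `h ≠ 0` whose comorphism has all `p`-th powers in its image does
not lower dimensions. -/
theorem dimension_comap_away_le [Finite κ] {p : ℕ} (hp0 : p ≠ 0)
    (ht : ∀ P, t (algebraMap _ _ P) = algebraMap _ _ (MvPolynomial.bind₁ Θ P))
    (hp : ∀ r, r ^ p ∈ t.range) (Z : Set (κ → k)) :
    dimension {x | MvPolynomial.eval x h ≠ 0 ∧ (fun i => MvPolynomial.eval x (Θ i)) ∈ Z} ≤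
      dimension Z := by
  set W := {x | MvPolynomial.eval x h ≠ 0 ∧ (fun i => MvPolynomial.eval x (Θ i)) ∈ Z} with hW
  let I := MvPolynomial.vanishingIdeal k W
  let A := Localization.Away (Ideal.Quotient.mk I h)
  have hinj : Function.Injective (algebraMap (MvPolynomial κ k ⧸ I) A) := by
    refine IsLocalization.injective (M := Submonoid.powers (Ideal.Quotient.mk I h)) _ ?_
    refine Submonoid.powers_le.mpr ?_
    rw [mem_nonZeroDivisors_iff_right]
    intro y hy
    obtain ⟨P, rfl⟩ := Ideal.Quotient.mk_surjective y
    rw [← map_mul, Ideal.Quotient.eq_zero_iff_mem] at hy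
    refine Ideal.Quotient.eq_zero_iff_mem.mpr fun x hx => ?_
    have := hy x hx
    rw [map_mul] at this
    exact (mul_eq_zero.mp this).resolve_right hx.1
  have : Algebra.FiniteType k A :=
    have : Algebra.FiniteType (MvPolynomial κ k ⧸ I) A :=
      IsLocalization.finiteType_of_monoid_fg (Submonoid.powers (Ideal.Quotient.mk I h)) A
    Algebra.FiniteType.trans (S := MvPolynomial κ k ⧸ I) inferInstance this
  have h₁ : dimension W ≤ ringKrullDim A := ringKrullDim_le_of_injective (k := k)
    (IsScalarTower.toAlgHom k (MvPolynomial κ k ⧸ I) A) hinj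
  refine h₁.trans ?_
  have hu : IsUnit ((algebraMap (MvPolynomial κ k ⧸ I) A).comp (Ideal.Quotient.mk I) h) :=
    IsLocalization.Away.algebraMap_isUnit (S := A) (Ideal.Quotient.mk I h)
  let π : Localization.Away h →+* A := IsLocalization.Away.lift h hu
  have hπ : ∀ P, π (algebraMap _ _ P) = algebraMap _ A (Ideal.Quotient.mk I P) := fun P =>
    IsLocalization.Away.lift_eq h hu P
  have hπs : Function.Surjective π := by
    intro y
    obtain ⟨n, P, hy⟩ := IsLocalization.Away.surj (Ideal.Quotient.mk I h) y
    obtain ⟨P, rfl⟩ := Ideal.Quotient.mk_surjective P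
    refine ⟨IsLocalization.mk' _ P (⟨h ^ n, n, rfl⟩ : Submonoid.powers h), ?_⟩
    have hu' : IsUnit (algebraMap _ A (Ideal.Quotient.mk I h) ^ n) := hu.pow n
    rw [← hu'.mul_left_inj, hy, ← hπ, ← hπ, ← map_pow, ← map_pow, ← map_mul]
    exact congrArg π (IsLocalization.mk'_spec (Localization.Away h) P _)
  have hint : (π.comp t).IsIntegral := by
    intro y
    obtain ⟨r, rfl⟩ := hπs y
    obtain ⟨s, hs⟩ := hp r
    exact ⟨Polynomial.X ^ p - Polynomial.C s, Polynomial.monic_X_pow_sub_C s hp0, by simp [hs]⟩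
  rw [dimension, ringKrullDim_quotient]
  have hloc : StrictMono (PrimeSpectrum.comap (algebraMap (MvPolynomial κ k)
      (Localization.Away h))) := by
    intro q q' hq
    refine lt_of_le_of_ne (Ideal.comap_mono hq.le) fun he => hq.ne ?_
    exact PrimeSpectrum.localization_comap_injective (Localization.Away h) (Submonoid.powers h) he
  have hmono := hloc.comp (strictMono_comap_of_isIntegral _ hint)
  refine Order.krullDim_le_of_strictMono (fun q => ⟨_, ?_⟩) fun q q' hq => hmono hq
  intro P hP
  change π (t (algebraMap _ _ P)) ∈ q.asIdeal
  rw [ht, hπ]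
  have : MvPolynomial.bind₁ Θ P ∈ I := fun x hx => by
    change MvPolynomial.eval x _ = 0
    rw [eval_bind₁]
    exact hP _ hx.2
  rw [Ideal.Quotient.eq_zero_iff_mem.mpr this, map_zero]
  exact zero_mem _

/-- `dim Z ≤ n`, for an integer `n`; it holds for all `n` if `Z` is empty. -/
def DimBound (Z : Set (ι → k)) (n : ℤ) : Prop :=
  ∀ d : ℕ, (d : WithBot ℕ∞) ≤ dimension Z → (d : ℤ) ≤ n

theorem DimBound.mono {Z Z' : Set (ι → k)} {n m : ℤ} (h : DimBound Z n) (hZ : Z' ⊆ Z)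
    (hn : n ≤ m) : DimBound Z' m := fun d hd => (h d (hd.trans (dimension_mono hZ))).trans hn

theorem DimBound.union {Z Z' : Set (ι → k)} {n : ℤ} (h : DimBound Z n) (h' : DimBound Z' n) :
    DimBound (Z ∪ Z') n := fun d hd => by
  rcases le_max_iff.mp (hd.trans (dimension_union_le Z Z')) with hd | hd
  · exact h d hd
  · exact h' d hd

theorem dimBound_empty (n : ℤ) : DimBound (∅ : Set (ι → k)) n := by
  intro d hd
  have : Subsingleton (MvPolynomial ι k ⧸ MvPolynomial.vanishingIdeal k (∅ : Set (ι → k))) := by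
    rw [Ideal.Quotient.subsingleton_iff, eq_top_iff]
    exact fun P _ x hx => hx.elim
  rw [dimension, ringKrullDim_eq_bot_of_subsingleton] at hd
  exact absurd hd (by simp)

theorem dimBound_card [Finite ι] (Z : Set (ι → k)) : DimBound Z (Nat.card ι) := fun d hd => by
  have := hd.trans (dimension_le_card Z)
  exact_mod_cast this

theorem dimBound_congr {Z : Set (ι → k)} {Z' : Set (κ → k)} {c : ℕ}
    (h : dimension Z' = dimension Z + c) (n : ℤ) : DimBound Z n ↔ DimBound Z' (n + c) := by
  rw [DimBound, DimBound, h]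
  induction dimension Z using WithBot.recBotCoe with
  | bot => simp
  | coe x =>
    have h1 : ∀ d : ℕ, (d : WithBot ℕ∞) ≤ (x : WithBot ℕ∞) ↔ (d : ℕ∞) ≤ x := fun d => by
      rw [show ((d : ℕ) : WithBot ℕ∞) = ((d : ℕ∞) : WithBot ℕ∞) from rfl, WithBot.coe_le_coe]
    have h2 : ∀ d : ℕ, (d : WithBot ℕ∞) ≤ (x : WithBot ℕ∞) + (c : ℕ) ↔ (d : ℕ∞) ≤ x + c :=
        fun d => by
      rw [show (x : WithBot ℕ∞) + (c : ℕ) = ((x + c : ℕ∞) : WithBot ℕ∞) from rfl,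
        show ((d : ℕ) : WithBot ℕ∞) = ((d : ℕ∞) : WithBot ℕ∞) from rfl, WithBot.coe_le_coe]
    simp_rw [h1, h2]
    constructor
    · intro H d hd
      rcases le_or_gt c d with hc | hc
      · obtain ⟨e, rfl⟩ := Nat.exists_eq_add_of_le' hc
        have := H e (by
          push_cast at hd
          exact (ENat.add_le_add_iff_right (ENat.natCast_ne_top c)).mp hd)
        push_cast
        omega
      · have := H 0 (by simp)
        omega
    · intro H d hd
      have := H (d + c) (by push_cast; gcongr)
      push_cast at this
      omega

/-- A subvariety of affine space contained in `Z` has dimension at most `dim Z`. -/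
theorem Piece.topologicalKrullDim_le [IsAlgClosed k] [Finite ι] (Y : Piece k ι) {Z : Set (ι → k)}
    (h : Y.points ⊆ Z) : topologicalKrullDim Y.variety.carrier ≤ dimension Z := by
  have hsub : ∀ y, Y.imm y ∈ PrimeSpectrum.zeroLocus
      (MvPolynomial.vanishingIdeal k Z : Set (MvPolynomial ι k)) := by
    intro y
    have := subset_of_forall_pt_mem Y.isConstructible_range
      (isConstructible_of_isLocallyClosed (PrimeSpectrum.isClosed_zeroLocus
        (MvPolynomial.vanishingIdeal k Z : Set (MvPolynomial ι k))).isLocallyClosed)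
      fun x hx => by
        rw [PrimeSpectrum.mem_zeroLocus]
        intro P hP
        exact mem_pt.mpr (hP x (h hx))
    exact this ⟨y, rfl⟩
  let g : Y.variety.carrier → PrimeSpectrum.zeroLocus
      (MvPolynomial.vanishingIdeal k Z : Set (MvPolynomial ι k)) := fun y => ⟨Y.imm y, hsub y⟩
  have hg : Topology.IsInducing g := by
    have := Y.imm.isEmbedding.isInducing
    exact Topology.IsInducing.of_comp (f := g) (g := Subtype.val)
      (by
        refine Continuous.subtype_mk ?_ _
        exact Y.imm.continuous) continuous_subtype_val this
  refine hg.topologicalKrullDim_le.trans ?_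
  rw [dimension, ← PrimeSpectrum.topologicalKrullDim_eq_ringKrullDim]
  have hs := PrimeSpectrum.isClosedEmbedding_comap_of_surjective _
    (Ideal.Quotient.mk (MvPolynomial.vanishingIdeal k Z)) Ideal.Quotient.mk_surjective
  have hr := range_comap_of_surjective _ (Ideal.Quotient.mk (MvPolynomial.vanishingIdeal k Z))
    Ideal.Quotient.mk_surjective
  rw [Ideal.mk_ker] at hr
  rw [← hr]
  exact (IsHomeomorph.topologicalKrullDim_eq _
    hs.isEmbedding.toHomeomorph.isHomeomorph).ge

theorem mem_dimFiltration_of_dimBound [IsAlgClosed k] [Finite ι]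
    (E : Set (FreeCommRing (Variety k))) {Z : Set (ι → k)} (hZ : IsConstructibleSet Z) {n i N : ℤ}
    (h : DimBound Z n) (hN : n + i ≤ -N) :
    algebraMap _ (LocalizedRing E) (constructibleClass E Z) * lefschetzPow E i ∈
      dimFiltration E N := by
  obtain ⟨r, Y, -, hY, e⟩ := (hZ.hasClass E).exists_pieces
  rw [e, map_sum, Finset.sum_mul]
  refine sum_mem fun j _ => AddSubgroup.subset_closure ⟨(Y j).variety, i, fun d hd => ?_, rfl⟩
  have := h d (hd.trans ((Y j).topologicalKrullDim_le
    (hY ▸ Set.subset_iUnion (fun i => (Y i).points) j)))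
  omega

end Dimension

/-! ### Comparing constructible sets in different affine spaces -/

section ClassShift

variable {k : Type u} [Field k] {ι κ τ ν : Type}

/-- The class and the dimension of the constructible set `Z'` are those of `Z × 𝔸^c`, where `c` may
be negative. -/
structure ClassShift (c : ℤ) (Z : Set (ι → k)) (Z' : Set (κ → k)) : Prop where
  left : IsConstructibleSet Z
  right : IsConstructibleSet Z'
  class_eq : ∀ E : Set (FreeCommRing (Variety k)),
    algebraMap _ (LocalizedRing E) (constructibleClass E Z') =
      algebraMap _ _ (constructibleClass E Z) * lefschetzPow E c
  dimBound_iff : ∀ n, DimBound Z n ↔ DimBound Z' (n + c)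

theorem lefschetzPow_zero (E : Set (FreeCommRing (Variety k))) : lefschetzPow E 0 = 1 := by
  simp [lefschetzPow]

theorem lefschetzPow_natCast (E : Set (FreeCommRing (Variety k))) (n : ℕ) :
    lefschetzPow E n = algebraMap _ _ (lefschetz E ^ n) := by
  rw [lefschetzPow, zpow_natCast, Units.val_pow_eq_pow_val, map_pow]
  rfl

theorem ClassShift.symm {c : ℤ} {Z : Set (ι → k)} {Z' : Set (κ → k)} (h : ClassShift c Z Z') :
    ClassShift (-c) Z' Z where
  left := h.right
  right := h.left
  class_eq E := by
    rw [h.class_eq, mul_assoc, ← lefschetzPow_add, add_neg_cancel, lefschetzPow_zero, mul_one]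
  dimBound_iff n := by rw [h.dimBound_iff, neg_add_cancel_right]

theorem ClassShift.trans {c d : ℤ} {Z : Set (ι → k)} {Z' : Set (κ → k)} {Z'' : Set (τ → k)}
    (h : ClassShift c Z Z') (h' : ClassShift d Z' Z'') : ClassShift (c + d) Z Z'' where
  left := h.left
  right := h'.right
  class_eq E := by rw [h'.class_eq, h.class_eq, mul_assoc, ← lefschetzPow_add]
  dimBound_iff n := by rw [h.dimBound_iff, h'.dimBound_iff, add_assoc]

variable [Finite ι] [Finite κ] [Finite τ] [Finite ν] [IsAlgClosed k]

/-- The product of `W` with an affine space and with the origin of another one. -/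
theorem ClassShift.of_coordinates {c : ℤ} {W : Set (τ → k)} (hW : IsConstructibleSet W)
    {β : τ ⊕ ν → κ} (hβ : Function.Injective β)
    (hc : (Nat.card κ : ℤ) = Nat.card τ + Nat.card ν + c) :
    ClassShift c W {u | (∀ i, u (β (Sum.inr i)) = 0) ∧ (fun i => u (β (Sum.inl i))) ∈ W} := by
  set Z := {u : κ → k | (∀ i, u (β (Sum.inr i)) = 0) ∧ (fun i => u (β (Sum.inl i))) ∈ W} with hZ
  let R := {i : κ // i ∉ Set.range β}
  let γ : τ ⊕ R → κ := Sum.elim (fun i => β (Sum.inl i)) Subtype.val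
  have hγ : Function.Injective γ := by
    refine Function.Injective.sumElim (hβ.comp Sum.inl_injective) Subtype.val_injective ?_
    intro i r hr
    exact r.2 ⟨_, hr⟩
  have hcR : c = Nat.card R := by
    have h1 : Nat.card κ = Nat.card (τ ⊕ ν) + Nat.card R := by
      rw [← Nat.card_range_of_injective hβ]
      classical
      have := Nat.card_congr (Equiv.Set.sumCompl (Set.range β))
      rw [Nat.card_sum] at this
      exact this.symm
    rw [Nat.card_sum] at h1
    omega
  have hγZ : ∀ u ∈ Z, ∀ i ∉ Set.range γ, u i = 0 := by
    intro u hu i hi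
    by_cases h : i ∈ Set.range β
    · obtain ⟨j | j, rfl⟩ := h
      · exact (hi ⟨Sum.inl j, rfl⟩).elim
      · exact hu.1 j
    · exact (hi ⟨Sum.inr ⟨i, h⟩, rfl⟩).elim
  have hV : {x : τ ⊕ R → k | extendZero γ x ∈ Z} = {x : τ ⊕ R → k | x ∘ Sum.inl ∈ W} := by
    ext x
    have h1 : ∀ i, extendZero γ x (β (Sum.inr i)) = 0 := by
      intro i
      refine extendZero_of_notMem x ?_
      rintro ⟨j | j, hj⟩
      · exact Sum.inl_ne_inr (hβ hj)
      · exact j.2 ⟨_, hj.symm⟩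
    have h2 : (fun i => extendZero γ x (β (Sum.inl i))) = x ∘ Sum.inl := by
      ext i
      exact extendZero_apply hγ x (Sum.inl i)
    change (_ ∧ _) ↔ _
    rw [h2]
    exact ⟨fun h => h.2, fun h => ⟨h1, h⟩⟩
  have hZc : IsConstructibleSet Z := by
    have h1 : IsConstructibleSet {u : κ → k | ∀ i, u ∈ {u : κ → k | u (β (Sum.inr i)) = 0}} :=
      isConstructibleSet_forall fun i => by
        simpa using isConstructibleSet_eq_zero (MvPolynomial.X (β (Sum.inr i)) : MvPolynomial κ k)
    have h2 := hW.preimage fun i => (MvPolynomial.X (β (Sum.inl i)) : MvPolynomial κ k)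
    simp only [MvPolynomial.eval_X] at h2
    exact h1.inter h2
  refine ⟨hW, hZc, fun E => ?_, fun n => ?_⟩
  · have h1 := (hZc.hasClass E).comap_extendZero E hγ hγZ
    rw [hV] at h1
    rw [h1.unique E (mul_classOf_affineVariety (κ := R) E (hW.hasClass E)),
      classOf_affineVariety, map_mul, hcR, lefschetzPow_natCast]
  · rw [hcR]
    refine dimBound_congr ?_ n
    rw [← dimension_prod, ← hV]
    exact le_antisymm (dimension_le_comap_extendZero hγ hγZ) (dimension_comap_extendZero_le hγ Z)

section Away

variable {h : MvPolynomial κ k} {Θ : κ → MvPolynomial κ k}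
  {t : Localization.Away h →+* Localization.Away h}

/-- Preimages under a bijective endomorphism of the open set `h ≠ 0`, whose comorphism has all
`p`-th powers in its image, have the same class and dimension. -/
theorem ClassShift.away (p : ℕ) [Fact p.Prime] [CharP k p] (h0 : h ≠ 0)
    (ht : ∀ P, t (algebraMap _ _ P) = algebraMap _ _ (MvPolynomial.bind₁ Θ P))
    (hp : ∀ r, r ^ p ∈ t.range)
    (hs : ∀ y, MvPolynomial.eval y h ≠ 0 →
      ∃ x, MvPolynomial.eval x h ≠ 0 ∧ (fun i => MvPolynomial.eval x (Θ i)) = y)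
    {Z : Set (κ → k)} (hZ : ∀ x ∈ Z, MvPolynomial.eval x h ≠ 0) (hZc : IsConstructibleSet Z) :
    ClassShift 0 Z
      {x | MvPolynomial.eval x h ≠ 0 ∧ (fun i => MvPolynomial.eval x (Θ i)) ∈ Z} where
  left := hZc
  right := (isConstructibleSet_eq_zero h).compl.inter (hZc.preimage Θ)
  class_eq E := by
    rw [(HasClass.comap_away E p h0 ht hp hs hZ (hZc.hasClass E)).constructibleClass_eq E,
      lefschetzPow_zero, mul_one]
  dimBound_iff n := by
    rw [add_zero, DimBound, DimBound, le_antisymm (dimension_le_comap_away hs hZ)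
      (dimension_comap_away_le (Fact.out : p.Prime).ne_zero ht hp Z)]

/-- All constructible subsets of the open set `h ≠ 0` are preimages of constructible sets. -/
theorem exists_away_preimage_eq {p : ℕ} (hp0 : p ≠ 0)
    (ht : ∀ P, t (algebraMap _ _ P) = algebraMap _ _ (MvPolynomial.bind₁ Θ P))
    (hp : ∀ r, r ^ p ∈ t.range)
    (hs : ∀ y, MvPolynomial.eval y h ≠ 0 →
      ∃ x, MvPolynomial.eval x h ≠ 0 ∧ (fun i => MvPolynomial.eval x (Θ i)) = y)
    {W : Set (κ → k)} (hW : ∀ x ∈ W, MvPolynomial.eval x h ≠ 0) (hWc : IsConstructibleSet W) :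
    ∃ Z : Set (κ → k), IsConstructibleSet Z ∧ (∀ x ∈ Z, MvPolynomial.eval x h ≠ 0) ∧
      W = {x | MvPolynomial.eval x h ≠ 0 ∧ (fun i => MvPolynomial.eval x (Θ i)) ∈ Z} := by
  classical
  let ev (x : κ → k) (hx : MvPolynomial.eval x h ≠ 0) : Localization.Away h →+* k :=
    IsLocalization.Away.lift h (g := MvPolynomial.eval x) (isUnit_iff_ne_zero.mpr hx)
  have hev : ∀ x hx P, ev x hx (algebraMap _ _ P) = MvPolynomial.eval x P := fun x hx P =>
    IsLocalization.Away.lift_eq h _ P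
  have hne : ∀ x, MvPolynomial.eval x h ≠ 0 →
      MvPolynomial.eval (fun i => MvPolynomial.eval x (Θ i)) h ≠ 0 := by
    intro x hx
    rw [← eval_bind₁, ← hev x hx, ← ht]
    exact (((IsLocalization.Away.algebraMap_isUnit (S := Localization.Away h) h).map t).map
      (ev x hx)).ne_zero
  have hQ : ∀ P : MvPolynomial κ k, ∃ Q : MvPolynomial κ k, ∀ x, MvPolynomial.eval x h ≠ 0 →
      (MvPolynomial.eval x P = 0 ↔
        MvPolynomial.eval (fun i => MvPolynomial.eval x (Θ i)) Q = 0) := by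
    intro P
    obtain ⟨r, hr⟩ := hp (algebraMap _ _ P)
    obtain ⟨n, Q, hQ⟩ := IsLocalization.Away.surj h r
    refine ⟨Q, fun x hx => ?_⟩
    have h1 := congrArg (fun y => ev x hx (t y)) hQ
    simp only [map_mul, map_pow, hr, ht, hev, eval_bind₁] at h1
    rw [← h1, mul_eq_zero, or_iff_left (pow_ne_zero _ (hne x hx)), pow_eq_zero_iff hp0]
  choose Q hQ using hQ
  obtain ⟨L, hL⟩ := isConstructibleSet_iff.mp hWc
  have key : ∀ x x', MvPolynomial.eval x h ≠ 0 → MvPolynomial.eval x' h ≠ 0 →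
      (∀ P ∈ L, (MvPolynomial.eval (fun i => MvPolynomial.eval x (Θ i)) (Q P) = 0 ↔
        MvPolynomial.eval (fun i => MvPolynomial.eval x' (Θ i)) (Q P) = 0)) →
      x ∈ W → x' ∈ W := fun x x' hx hx' H =>
    hL _ _ fun P hP => by rw [hQ P x hx, hQ P x' hx', H P hP]
  refine ⟨(fun x i => MvPolynomial.eval x (Θ i)) '' W, isConstructibleSet_iff.mpr
    ⟨insert h (L.image Q), ?_⟩, ?_, ?_⟩
  · rintro _ y H ⟨x, hx, rfl⟩
    have hy : MvPolynomial.eval y h ≠ 0 := fun hy =>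
      hne x (hW x hx) ((H h (Finset.mem_insert_self _ _)).mpr hy)
    obtain ⟨x', hx', rfl⟩ := hs y hy
    exact ⟨x', key x x' (hW x hx) hx' (fun P hP => H _ (Finset.mem_insert_of_mem
      (Finset.mem_image_of_mem Q hP))) hx, rfl⟩
  · rintro _ ⟨x, hx, rfl⟩
    exact hne x (hW x hx)
  · ext x
    refine ⟨fun hx => ⟨hW x hx, x, hx, rfl⟩, ?_⟩
    rintro ⟨hx, x', hx', he⟩
    exact key x' x (hW x' hx') hx (fun P hP => by
      rw [show (fun i => MvPolynomial.eval x' (Θ i)) = _ from he]) hx'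

end Away

end ClassShift

/-! ### The completed Grothendieck ring as a topological group -/

section Completed

variable {k : Type u} [Field k] {E : Set (FreeCommRing (Variety k))}

theorem Completed.ext {x y : Completed E} (h : ∀ N, x.1 N = y.1 N) : x = y :=
  Subtype.ext (funext h)

variable (E) in
/-- The projection `ℳ̂' → ℳ' / F N`. -/
def proj (N : ℤ) : Completed E →+ LocalizedRing E ⧸ dimFiltration E N where
  toFun x := x.1 N
  map_zero' := rfl
  map_add' _ _ := rfl

theorem Completed.ext_proj {x y : Completed E} (h : ∀ N, proj E N x = proj E N y) : x = y :=
  Completed.ext h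

theorem Completed.tendsto_iff {ι : Type*} {F : Filter ι} {f : ι → Completed E} {m : Completed E} :
    Filter.Tendsto f F (nhds m) ↔ ∀ N, ∀ᶠ i in F, proj E N (f i) = proj E N m := by
  let _ : ∀ n : ℤ, TopologicalSpace (LocalizedRing E ⧸ dimFiltration E n) := fun _ => ⊥
  have : ∀ n : ℤ, DiscreteTopology (LocalizedRing E ⧸ dimFiltration E n) := fun _ => ⟨rfl⟩
  rw [nhds_induced, Filter.tendsto_comap_iff, tendsto_pi_nhds]
  refine forall_congr' fun N => ?_
  rw [nhds_discrete, Filter.tendsto_pure]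
  rfl

instance : T2Space (Completed E) := by
  let _ : ∀ n : ℤ, TopologicalSpace (LocalizedRing E ⧸ dimFiltration E n) := fun _ => ⊥
  have : ∀ n : ℤ, DiscreteTopology (LocalizedRing E ⧸ dimFiltration E n) := fun _ => ⟨rfl⟩
  exact T2Space.of_injective_continuous
    (f := fun x : Completed E => (x.1 : ∀ n : ℤ, LocalizedRing E ⧸ dimFiltration E n))
    Subtype.val_injective continuous_induced_dom

instance : IsTopologicalAddGroup (Completed E) := by
  let _ : ∀ n : ℤ, TopologicalSpace (LocalizedRing E ⧸ dimFiltration E n) := fun _ => ⊥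
  have : ∀ n : ℤ, DiscreteTopology (LocalizedRing E ⧸ dimFiltration E n) := fun _ => ⟨rfl⟩
  exact topologicalAddGroup_induced (G := ∀ n : ℤ, LocalizedRing E ⧸ dimFiltration E n)
    (AddSubgroup.subtype (completion E) : completion E →+ _)

theorem transition_mk (N : ℤ) (x : LocalizedRing E) :
    transition E N (QuotientAddGroup.mk x) = QuotientAddGroup.mk x := rfl

/-- A family whose terms tend to zero is summable, because the filtration is complete. -/
theorem summable_of_finite {ι : Type*} {f : ι → Completed E}
    (h : ∀ N, {i | proj E N (f i) ≠ 0}.Finite) : Summable f := by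
  have key : ∀ N (s : Finset ι), (h N).toFinset ⊆ s →
      ∑ i ∈ s, proj E N (f i) = ∑ i ∈ (h N).toFinset, proj E N (f i) := fun N s hs =>
    (Finset.sum_subset hs fun i _ hi => by
      by_contra hne
      exact hi ((h N).mem_toFinset.mpr hne)).symm
  classical
  let m : Completed E := (⟨fun N => ∑ i ∈ (h N).toFinset, proj E N (f i), fun N => by
    dsimp only
    rw [← key (N + 1) ((h N).toFinset ∪ (h (N + 1)).toFinset) Finset.subset_union_right,
      ← key N ((h N).toFinset ∪ (h (N + 1)).toFinset) Finset.subset_union_left, map_sum]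
    exact Finset.sum_congr rfl fun i _ => (f i).2 N⟩ : completion E)
  refine ⟨m, Completed.tendsto_iff.mpr fun N => ?_⟩
  filter_upwards [Filter.eventually_ge_atTop (h N).toFinset] with s hs
  rw [map_sum, key N s hs]
  rfl

theorem proj_mulLefschetz {i N : ℤ} {x : Completed E} {r : LocalizedRing E}
    (h : proj E (N + i) x = QuotientAddGroup.mk r) :
    proj E N (mulLefschetz E i x) = QuotientAddGroup.mk (r * lefschetzPow E i) := by
  change mulLefschetzQuotient E i N (N + i) rfl (proj E (N + i) x) = _
  rw [h]
  rfl

theorem proj_mulLefschetz_congr {i N : ℤ} {x y : Completed E}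
    (h : proj E (N + i) x = proj E (N + i) y) :
    proj E N (mulLefschetz E i x) = proj E N (mulLefschetz E i y) :=
  congrArg (mulLefschetzQuotient E i N (N + i) rfl) h

variable (E) in
/-- Multiplication by `𝕃 ^ i` as a homomorphism. -/
def mulLefschetzHom (i : ℤ) : Completed E →+ Completed E :=
  AddMonoidHom.mk' (mulLefschetz E i) fun x y => Completed.ext fun N =>
    map_add (mulLefschetzQuotient E i N (N + i) rfl) (x.1 (N + i)) (y.1 (N + i))

theorem hasSum_mulLefschetz {ι : Type*} {f : ι → Completed E} {m : Completed E} (i : ℤ)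
    (h : HasSum f m) : HasSum (fun j => mulLefschetz E i (f j)) (mulLefschetz E i m) := by
  refine Completed.tendsto_iff.mpr fun N => ?_
  filter_upwards [Completed.tendsto_iff.mp h (N + i)] with s hs
  rw [← proj_mulLefschetz_congr hs]
  exact congrArg _ (map_sum (mulLefschetzHom E i) f s).symm

end Completed

/-! ### Motivic measures -/

section Measure

variable {k : Type u} [Field k] {X : Type v} {S : TruncationSystem k X}

theorem IsCylinder.mem_iff {l : S.Level} {C : Set X} (h : IsCylinder S l C) {x : X} :
    x ∈ C ↔ x ∈ S.domain l ∧ S.trunc l x ∈ S.trunc l '' C := by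
  refine ⟨fun hx => ⟨h.1 hx, x, hx, rfl⟩, ?_⟩
  rintro ⟨hx, y, hy, he⟩
  exact h.2.1 y hy x hx he.symm

theorem image_trunc_eq {l : S.Level} (hl : ∀ u, ∃ x ∈ S.domain l, S.trunc l x = u)
    {C : Set X} {Z : Set (S.Coord l → k)}
    (h : ∀ x, x ∈ C ↔ x ∈ S.domain l ∧ S.trunc l x ∈ Z) : S.trunc l '' C = Z := by
  ext u
  constructor
  · rintro ⟨x, hx, rfl⟩
    exact ((h x).mp hx).2
  · intro hu
    obtain ⟨x, hx, rfl⟩ := hl u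
    exact ⟨x, (h x).mpr ⟨hx, hu⟩, rfl⟩

theorem isCylinder_of_mem_iff {l : S.Level} (hl : ∀ u, ∃ x ∈ S.domain l, S.trunc l x = u)
    {C : Set X} {Z : Set (S.Coord l → k)} (hZ : IsConstructibleSet Z)
    (h : ∀ x, x ∈ C ↔ x ∈ S.domain l ∧ S.trunc l x ∈ Z) : IsCylinder S l C :=
  ⟨fun x hx => ((h x).mp hx).1, fun x hx y hy he => (h y).mpr ⟨hy, he ▸ ((h x).mp hx).2⟩,
    (image_trunc_eq hl h).symm ▸ hZ⟩

/-- Cylinders of level `l` are cylinders of level `l'`, of the same measure and dimension. -/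
def Refines (S : TruncationSystem k X) (l l' : S.Level) : Prop :=
  ∀ C, IsCylinder S l C → IsCylinder S l' C ∧
    ClassShift (S.shift l' - S.shift l) (S.trunc l '' C) (S.trunc l' '' C)

/-- The truncations are onto, and their levels are directed. -/
structure IsRegularSystem (S : TruncationSystem k X) : Prop where
  surjective : ∀ l u, ∃ x ∈ S.domain l, S.trunc l x = u
  directed : ∀ l l', ∃ l'', Refines S l l'' ∧ Refines S l' l''
  nonempty : Nonempty S.Level

/-- Cylinders of an arbitrary level. -/
def IsCyl (S : TruncationSystem k X) (C : Set X) : Prop := ∃ l, IsCylinder S l C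

/-- The measure of a cylinder of level `l`, before completion. -/
def volAt (E : Set (FreeCommRing (Variety k))) (S : TruncationSystem k X) (l : S.Level)
    (C : Set X) : LocalizedRing E :=
  algebraMap _ _ (constructibleClass E (S.trunc l '' C)) * lefschetzPow E (-S.shift l)

open Classical in
/-- The measure of a cylinder, before completion. -/
def vol (E : Set (FreeCommRing (Variety k))) (S : TruncationSystem k X) (C : Set X) :
    LocalizedRing E :=
  if h : IsCyl S C then volAt E S h.choose C else 0

theorem Refines.volAt_eq {l l' : S.Level} (h : Refines S l l') {C : Set X} (hC : IsCylinder S l C)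
    (E : Set (FreeCommRing (Variety k))) : volAt E S l' C = volAt E S l C := by
  rw [volAt, volAt, (h C hC).2.class_eq, mul_assoc, ← lefschetzPow_add]
  congr 2
  ring

theorem cylinderDimLE_iff {l : S.Level} {C : Set X} {n : ℤ} :
    CylinderDimLE S l C n ↔ DimBound (S.trunc l '' C) (n + S.shift l) := by
  refine forall_congr' fun d => imp_congr_right fun _ => ?_
  omega

theorem Refines.dimLE_iff {l l' : S.Level} (h : Refines S l l') {C : Set X}
    (hC : IsCylinder S l C) {n : ℤ} : CylinderDimLE S l' C n ↔ CylinderDimLE S l C n := by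
  rw [cylinderDimLE_iff, cylinderDimLE_iff, (h C hC).2.dimBound_iff]
  rw [show n + S.shift l + (S.shift l' - S.shift l) = n + S.shift l' by ring]

theorem DimLE.mono {A A' : Set X} {n m : ℤ} (h : DimLE S A n) (hA : A' ⊆ A) (hn : n ≤ m) :
    DimLE S A' m := by
  obtain ⟨l, B, hB, hAB, hd⟩ := h
  exact ⟨l, B, hB, hA.trans hAB, fun d hd' => (hd d hd').trans hn⟩

variable (hS : IsRegularSystem S)
include hS

theorem IsRegularSystem.volAt_eq {l l' : S.Level} {C : Set X} (h : IsCylinder S l C)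
    (h' : IsCylinder S l' C) (E : Set (FreeCommRing (Variety k))) :
    volAt E S l C = volAt E S l' C := by
  obtain ⟨l'', h₁, h₂⟩ := hS.directed l l'
  rw [← h₁.volAt_eq h, h₂.volAt_eq h']

theorem IsRegularSystem.vol_eq {l : S.Level} {C : Set X} (h : IsCylinder S l C)
    (E : Set (FreeCommRing (Variety k))) : vol E S C = volAt E S l C := by
  have h' : IsCyl S C := ⟨l, h⟩
  rw [vol, dif_pos h']
  exact hS.volAt_eq h'.choose_spec h E

theorem IsRegularSystem.exists_common {C C' : Set X} (h : IsCyl S C) (h' : IsCyl S C') :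
    ∃ l, IsCylinder S l C ∧ IsCylinder S l C' := by
  obtain ⟨l, h⟩ := h
  obtain ⟨l', h'⟩ := h'
  obtain ⟨l'', h₁, h₂⟩ := hS.directed l l'
  exact ⟨l'', (h₁ C h).1, (h₂ C' h').1⟩

theorem IsRegularSystem.dimLE_iff {l : S.Level} {C : Set X} (h : IsCylinder S l C) {n : ℤ} :
    DimLE S C n ↔ CylinderDimLE S l C n := by
  refine ⟨?_, fun hd => ⟨l, C, h, subset_rfl, hd⟩⟩
  rintro ⟨l', B, hB, hCB, hd⟩
  obtain ⟨l'', h₁, h₂⟩ := hS.directed l l'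
  rw [← h₁.dimLE_iff h, cylinderDimLE_iff]
  rw [← h₂.dimLE_iff hB, cylinderDimLE_iff] at hd
  exact hd.mono (Set.image_mono hCB) le_rfl

variable [IsAlgClosed k]

theorem IsRegularSystem.isCyl_empty : IsCyl S (∅ : Set X) := by
  obtain ⟨l⟩ := hS.nonempty
  have := S.finite_coord l
  exact ⟨l, isCylinder_of_mem_iff (hS.surjective l) isConstructibleSet_univ.compl (by simp)⟩

theorem IsRegularSystem.isCyl_union {C C' : Set X} (h : IsCyl S C) (h' : IsCyl S C') :
    IsCyl S (C ∪ C') := by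
  obtain ⟨l, h, h'⟩ := hS.exists_common h h'
  have := S.finite_coord l
  refine ⟨l, isCylinder_of_mem_iff (hS.surjective l) (h.2.2.union h'.2.2) fun x => ?_⟩
  rw [Set.mem_union, h.mem_iff, h'.mem_iff, ← and_or_left]
  rfl

theorem IsRegularSystem.isCyl_inter {C C' : Set X} (h : IsCyl S C) (h' : IsCyl S C') :
    IsCyl S (C ∩ C') := by
  obtain ⟨l, h, h'⟩ := hS.exists_common h h'
  have := S.finite_coord l
  refine ⟨l, isCylinder_of_mem_iff (hS.surjective l) (h.2.2.inter h'.2.2) fun x => ?_⟩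
  rw [Set.mem_inter_iff, h.mem_iff, h'.mem_iff, ← and_and_left]
  rfl

theorem IsRegularSystem.isCyl_diff {C C' : Set X} (h : IsCyl S C) (h' : IsCyl S C') :
    IsCyl S (C \ C') := by
  obtain ⟨l, h, h'⟩ := hS.exists_common h h'
  have := S.finite_coord l
  refine ⟨l, isCylinder_of_mem_iff (hS.surjective l) (h.2.2.diff h'.2.2) fun x => ?_⟩
  rw [Set.mem_sdiff, h.mem_iff, h'.mem_iff, Set.mem_sdiff]
  tauto

theorem IsRegularSystem.vol_union {C C' : Set X} (h : IsCyl S C) (h' : IsCyl S C')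
    (hd : Disjoint C C') (E : Set (FreeCommRing (Variety k))) :
    vol E S (C ∪ C') = vol E S C + vol E S C' := by
  obtain ⟨l, h, h'⟩ := hS.exists_common h h'
  have := S.finite_coord l
  have hu : IsCylinder S l (C ∪ C') := by
    refine isCylinder_of_mem_iff (hS.surjective l) (h.2.2.union h'.2.2) fun x => ?_
    rw [Set.mem_union, h.mem_iff, h'.mem_iff, ← and_or_left]
    rfl
  have hdis : Disjoint (S.trunc l '' C) (S.trunc l '' C') := by
    rw [Set.disjoint_left]
    rintro _ ⟨x, hx, rfl⟩ hx'
    exact Set.disjoint_left.mp hd hx (h'.mem_iff.mpr ⟨h.1 hx, hx'⟩)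
  rw [hS.vol_eq hu, hS.vol_eq h, hS.vol_eq h', volAt, volAt, volAt, Set.image_union,
    constructibleClass_union E h.2.2 h'.2.2 hdis, map_add, add_mul]

theorem IsRegularSystem.dimLE_union {A A' : Set X} {n : ℤ} (h : DimLE S A n) (h' : DimLE S A' n) :
    DimLE S (A ∪ A') n := by
  obtain ⟨l, B, hB, hA, hd⟩ := h
  obtain ⟨l', B', hB', hA', hd'⟩ := h'
  obtain ⟨l'', h₁, h₂⟩ := hS.directed l l'
  rw [← h₁.dimLE_iff hB, cylinderDimLE_iff] at hd
  rw [← h₂.dimLE_iff hB', cylinderDimLE_iff] at hd'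
  have := S.finite_coord l''
  refine ⟨l'', B ∪ B', ?_, Set.union_subset_union hA hA', ?_⟩
  · have h := (h₁ B hB).1
    have h' := (h₂ B' hB').1
    refine isCylinder_of_mem_iff (hS.surjective l'') (h.2.2.union h'.2.2) fun x => ?_
    rw [Set.mem_union, h.mem_iff, h'.mem_iff, ← and_or_left]
    rfl
  · rw [cylinderDimLE_iff, Set.image_union]
    exact hd.union hd'

theorem IsRegularSystem.dimLE_empty (n : ℤ) : DimLE S (∅ : Set X) n := by
  obtain ⟨l, h⟩ := hS.isCyl_empty
  refine (hS.dimLE_iff h).mpr ?_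
  rw [cylinderDimLE_iff, Set.image_empty]
  exact dimBound_empty _

theorem IsRegularSystem.dimLE_biUnion {ι : Type*} (s : Finset ι) {A : ι → Set X} {n : ℤ}
    (h : ∀ i ∈ s, DimLE S (A i) n) : DimLE S (⋃ i ∈ s, A i) n := by
  classical
  induction s using Finset.induction_on with
  | empty => simpa using hS.dimLE_empty n
  | insert i s hi ih =>
    rw [Finset.set_biUnion_insert]
    exact hS.dimLE_union (h i (Finset.mem_insert_self i s))
      (ih fun j hj => h j (Finset.mem_insert_of_mem hj))

theorem IsRegularSystem.vol_mem {C : Set X} (h : IsCyl S C) {N : ℤ} (hd : DimLE S C (-N))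
    (E : Set (FreeCommRing (Variety k))) : vol E S C ∈ dimFiltration E N := by
  obtain ⟨l, h⟩ := h
  have := S.finite_coord l
  rw [hS.dimLE_iff h, cylinderDimLE_iff] at hd
  rw [hS.vol_eq h]
  exact mem_dimFiltration_of_dimBound E h.2.2 hd (by omega)

theorem IsRegularSystem.mk_vol_eq {C C' : Set X} (h : IsCyl S C) (h' : IsCyl S C') {N : ℤ}
    (hd : DimLE S (symmDiff C C') (-N)) (E : Set (FreeCommRing (Variety k))) :
    (QuotientAddGroup.mk (vol E S C) : LocalizedRing E ⧸ dimFiltration E N) =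
      QuotientAddGroup.mk (vol E S C') := by
  have key : ∀ C C' : Set X, IsCyl S C → IsCyl S C' → DimLE S (C \ C') (-N) →
      (QuotientAddGroup.mk (vol E S C) : LocalizedRing E ⧸ dimFiltration E N) =
        QuotientAddGroup.mk (vol E S (C ∩ C')) := by
    intro C C' h h' hd
    have h1 := hS.vol_union (hS.isCyl_inter h h') (hS.isCyl_diff h h')
      (Set.disjoint_left.mpr fun x hx hx' => hx'.2 hx.2) E
    rw [Set.inter_union_sdiff] at h1
    rw [h1, QuotientAddGroup.mk_add, (QuotientAddGroup.eq_zero_iff _).mpr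
      (hS.vol_mem (hS.isCyl_diff h h') hd E), add_zero]
  rw [key C C' h h' (hd.mono (fun x hx => Or.inl hx) le_rfl),
    key C' C h' h (hd.mono (fun x hx => Or.inr hx) le_rfl), Set.inter_comm]

theorem IsRegularSystem.dimLE_symmDiff_trans {A B C : Set X} {n : ℤ}
    (h : DimLE S (symmDiff A B) n) (h' : DimLE S (symmDiff B C) n) :
    DimLE S (symmDiff A C) n :=
  (hS.dimLE_union h h').mono (symmDiff_triangle A B C) le_rfl

omit hS [IsAlgClosed k] in
theorem isMeasurableSet_iff {A : Set X} :
    IsMeasurableSet S A ↔ ∀ n, ∃ C, IsCyl S C ∧ DimLE S (symmDiff A C) n := by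
  constructor
  · rintro ⟨l, C, hC, l', B, hB, ht, hAB⟩ n
    obtain ⟨i, hi⟩ := (ht n).exists
    exact ⟨C i, ⟨l i, hC i⟩, l' i, B i, hB i, hAB i, hi⟩
  · intro h
    choose C hC hd using fun i : ℕ => h (-(i : ℤ))
    choose l hl using hC
    choose l' B hB hAB hd using hd
    refine ⟨l, C, hl, l', B, hB, fun n => ?_, hAB⟩
    filter_upwards [Filter.eventually_ge_atTop (-n).toNat] with i hi d hd'
    have := hd i d hd'
    omega

theorem IsRegularSystem.hasMeasure_iff {A : Set X} (hA : IsMeasurableSet S A)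
    {E : Set (FreeCommRing (Variety k))} {m : Completed E} : HasMeasure E S A m ↔
      ∀ N C, IsCyl S C → DimLE S (symmDiff A C) (-N) →
        proj E N m = QuotientAddGroup.mk (vol E S C) := by
  constructor
  · rintro ⟨l, C, ⟨hC, l', B, hB, ht, hAB⟩, hm⟩ N C' hC' hd
    obtain ⟨i, hi, hi'⟩ := ((Completed.tendsto_iff.mp hm N).and (ht (-N))).exists
    rw [← hi]
    have h1 : DimLE S (symmDiff A (C i)) (-N) := ⟨l' i, B i, hB i, hAB i, hi'⟩
    rw [← hS.mk_vol_eq ⟨l i, hC i⟩ hC'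
      (hS.dimLE_symmDiff_trans (by rwa [symmDiff_comm]) hd) E, hS.vol_eq (hC i)]
    rfl
  · intro h
    obtain ⟨l, C, hAp⟩ := hA
    refine ⟨l, C, hAp, Completed.tendsto_iff.mpr fun N => ?_⟩
    obtain ⟨hC, l', B, hB, ht, hAB⟩ := hAp
    filter_upwards [ht (-N)] with i hi
    rw [h N (C i) ⟨l i, hC i⟩ ⟨l' i, B i, hB i, hAB i, hi⟩, hS.vol_eq (hC i)]
    rfl

/-- The measure of a measurable set modulo `F N` is that of any approximating cylinder. -/
theorem IsRegularSystem.proj_measure {A : Set X} (hA : IsMeasurableSet S A)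
    (E : Set (FreeCommRing (Variety k))) {N : ℤ} {C : Set X} (hC : IsCyl S C)
    (hd : DimLE S (symmDiff A C) (-N)) :
    proj E N (measure E S A) = QuotientAddGroup.mk (vol E S C) := by
  have h : ∃ m, HasMeasure E S A m := by
    choose D hD hd using isMeasurableSet_iff.mp hA
    have key : ∀ N C, IsCyl S C → DimLE S (symmDiff A C) (-N) →
        (QuotientAddGroup.mk (vol E S (D (-N))) : LocalizedRing E ⧸ dimFiltration E N) =
          QuotientAddGroup.mk (vol E S C) := fun N C hC hd' =>
      hS.mk_vol_eq (hD _) hC (hS.dimLE_symmDiff_trans (by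
        rw [symmDiff_comm]
        exact hd (-N)) hd') E
    refine ⟨(⟨fun N => QuotientAddGroup.mk (vol E S (D (-N))), fun N => ?_⟩ : completion E),
      (hS.hasMeasure_iff hA).mpr key⟩
    rw [transition_mk]
    exact (key N _ (hD _) ((hd (-(N + 1))).mono subset_rfl (by omega))).symm
  rw [measure, dif_pos h]
  exact (hS.hasMeasure_iff hA).mp h.choose_spec N C hC hd

theorem IsRegularSystem.isMeasurableSet_of_isCyl {C : Set X} (h : IsCyl S C) :
    IsMeasurableSet S C :=
  isMeasurableSet_iff.mpr fun n => ⟨C, h, by rw [symmDiff_self]; exact hS.dimLE_empty n⟩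

theorem IsRegularSystem.measure_eq {C : Set X} (h : IsCyl S C)
    (E : Set (FreeCommRing (Variety k))) : measure E S C = toCompleted E (vol E S C) :=
  Completed.ext fun _ => hS.proj_measure (hS.isMeasurableSet_of_isCyl h) E h (by
    rw [symmDiff_self]; exact hS.dimLE_empty _)

theorem IsRegularSystem.isMeasurableSet_of_approx {A : Set X}
    (h : ∀ n, ∃ A', IsMeasurableSet S A' ∧ DimLE S (symmDiff A A') n) : IsMeasurableSet S A :=
  isMeasurableSet_iff.mpr fun n => by
    obtain ⟨A', hA', hd⟩ := h n
    obtain ⟨C, hC, hd'⟩ := isMeasurableSet_iff.mp hA' n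
    exact ⟨C, hC, hS.dimLE_symmDiff_trans hd hd'⟩

theorem IsRegularSystem.proj_measure_congr {A A' : Set X} (hA : IsMeasurableSet S A)
    (hA' : IsMeasurableSet S A') (E : Set (FreeCommRing (Variety k))) {N : ℤ}
    (hd : DimLE S (symmDiff A A') (-N)) :
    proj E N (measure E S A) = proj E N (measure E S A') := by
  obtain ⟨C, hC, hd'⟩ := isMeasurableSet_iff.mp hA' (-N)
  rw [hS.proj_measure hA E hC (hS.dimLE_symmDiff_trans hd hd'), hS.proj_measure hA' E hC hd']

theorem IsRegularSystem.proj_measure_eq_zero {A : Set X} (hA : IsMeasurableSet S A)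
    (E : Set (FreeCommRing (Variety k))) {N : ℤ} (hd : DimLE S A (-N)) :
    proj E N (measure E S A) = 0 := by
  rw [hS.proj_measure hA E hS.isCyl_empty (by rwa [← Set.bot_eq_empty, symmDiff_bot])]
  refine (QuotientAddGroup.eq_zero_iff _).mpr (hS.vol_mem hS.isCyl_empty (hS.dimLE_empty _) E)

theorem IsRegularSystem.isMeasurableSet_inter {A C : Set X} (hA : IsMeasurableSet S A)
    (hC : IsCyl S C) : IsMeasurableSet S (A ∩ C) :=
  isMeasurableSet_iff.mpr fun n => by
    obtain ⟨D, hD, hd⟩ := isMeasurableSet_iff.mp hA n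
    refine ⟨D ∩ C, hS.isCyl_inter hD hC, hd.mono ?_ le_rfl⟩
    rintro x (⟨hx, hx'⟩ | ⟨hx, hx'⟩)
    · exact Or.inl ⟨hx.1, fun h => hx' ⟨h, hx.2⟩⟩
    · exact Or.inr ⟨hx.1, fun h => hx' ⟨h, hx.2⟩⟩

theorem IsRegularSystem.measurable_union {A A' : Set X} (hA : IsMeasurableSet S A)
    (hA' : IsMeasurableSet S A') (hd : Disjoint A A') (E : Set (FreeCommRing (Variety k))) :
    IsMeasurableSet S (A ∪ A') ∧ measure E S (A ∪ A') = measure E S A + measure E S A' := by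
  -- approximate `A` by `C` and `A'` by the complement of `C` in a cylinder
  have key : ∀ n, ∃ C C', IsCyl S C ∧ IsCyl S C' ∧ Disjoint C C' ∧ DimLE S (symmDiff A C) n ∧
      DimLE S (symmDiff A' C') n ∧ DimLE S (symmDiff (A ∪ A') (C ∪ C')) n := by
    intro n
    obtain ⟨C, hC, h⟩ := isMeasurableSet_iff.mp hA n
    obtain ⟨C', hC', h'⟩ := isMeasurableSet_iff.mp hA' n
    have hu := hS.dimLE_union h h'
    have hAA : ∀ x, x ∈ A → x ∉ A' := fun x hx => Set.disjoint_left.mp hd hx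
    refine ⟨C, C' \ C, hC, hS.isCyl_diff hC' hC, Set.disjoint_left.mpr fun x hx hx' => hx'.2 hx, h,
      hu.mono (fun x => ?_) le_rfl, hu.mono (fun x => ?_) le_rfl⟩
    · simp only [Set.mem_symmDiff, Set.mem_union, Set.mem_sdiff]
      have := hAA x
      tauto
    · simp only [Set.mem_symmDiff, Set.mem_union, Set.mem_sdiff]
      tauto
  have hm : IsMeasurableSet S (A ∪ A') := isMeasurableSet_iff.mpr fun n => by
    obtain ⟨C, C', hC, hC', -, -, -, h⟩ := key n
    exact ⟨C ∪ C', hS.isCyl_union hC hC', h⟩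
  refine ⟨hm, Completed.ext fun N => ?_⟩
  obtain ⟨C, C', hC, hC', hCC, h₁, h₂, h₃⟩ := key (-N)
  change proj E N _ = proj E N (_ + _)
  rw [map_add, hS.proj_measure hm E (hS.isCyl_union hC hC') h₃, hS.proj_measure hA E hC h₁,
    hS.proj_measure hA' E hC' h₂, hS.vol_union hC hC' hCC, QuotientAddGroup.mk_add]

theorem IsRegularSystem.measurable_biUnion {ι : Type*} {P : ι → Set X}
    (hP : ∀ i, IsMeasurableSet S (P i)) (hd : Pairwise fun i j => Disjoint (P i) (P j))
    (s : Finset ι) (E : Set (FreeCommRing (Variety k))) :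
    IsMeasurableSet S (⋃ i ∈ s, P i) ∧ measure E S (⋃ i ∈ s, P i) = ∑ i ∈ s, measure E S (P i) := by
  classical
  induction s using Finset.induction_on with
  | empty =>
    rw [Finset.sum_empty]
    simp only [Finset.notMem_empty, Set.iUnion_false, Set.iUnion_empty]
    have hm := hS.isMeasurableSet_of_isCyl hS.isCyl_empty
    exact ⟨hm, Completed.ext fun N => hS.proj_measure_eq_zero hm E (hS.dimLE_empty _)⟩
  | insert i s hi ih =>
    rw [Finset.set_biUnion_insert, Finset.sum_insert hi, ← ih.2]
    refine hS.measurable_union (hP i) ih.1 ?_ E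
    rw [Set.disjoint_iUnion₂_right]
    exact fun j hj => hd fun h => hi (h ▸ hj)

/-- A set which is, up to sets of arbitrarily small dimension, a finite union of members of a
disjoint family of measurable subsets is measurable, and its measure is the sum of theirs. -/
theorem IsRegularSystem.hasSum_measure {ι : Type*} {A : Set X} {P : ι → Set X}
    (hP : ∀ i, IsMeasurableSet S (P i)) (hd : Pairwise fun i j => Disjoint (P i) (P j))
    (hPA : ∀ i, P i ⊆ A) (h : ∀ n, ∃ s : Finset ι, DimLE S (A \ ⋃ i ∈ s, P i) n)
    (E : Set (FreeCommRing (Variety k))) :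
    IsMeasurableSet S A ∧ HasSum (fun i => measure E S (P i)) (measure E S A) := by
  have hsub : ∀ s : Finset ι, ⋃ i ∈ s, P i ⊆ A := fun s => Set.iUnion₂_subset fun i _ => hPA i
  have hsymm : ∀ s : Finset ι, symmDiff A (⋃ i ∈ s, P i) = A \ ⋃ i ∈ s, P i := fun s => by
    rw [Set.symmDiff_def, Set.sdiff_eq_empty.mpr (hsub s), Set.union_empty]
  have hm : IsMeasurableSet S A := hS.isMeasurableSet_of_approx fun n => by
    obtain ⟨s, hs⟩ := h n
    exact ⟨_, (hS.measurable_biUnion hP hd s E).1, by rwa [hsymm]⟩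
  refine ⟨hm, Completed.tendsto_iff.mpr fun N => ?_⟩
  obtain ⟨s, hs⟩ := h (-N)
  filter_upwards [Filter.eventually_ge_atTop s] with s' hs'
  rw [← (hS.measurable_biUnion hP hd s' E).2]
  refine (hS.proj_measure_congr hm (hS.measurable_biUnion hP hd s' E).1 E ?_).symm
  rw [hsymm]
  exact hs.mono (Set.sdiff_subset_sdiff_right (Set.biUnion_subset_biUnion_left hs')) le_rfl

/-- The integral of `𝕃 ^ f` as a sum over a partition of the fibres of `f`: if every fibre is, up to
sets of arbitrarily small dimension, a finite union of parts, then the integral converges if and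
only if the terms belonging to the parts tend to zero. -/
theorem IsRegularSystem.hasIntegral_iff {ι : Type*} {A : Set X} {f : X → ℤ} {d : ι → ℤ}
    {P : ι → Set X} (hP : ∀ i, IsMeasurableSet S (P i))
    (hd : Pairwise fun i j => Disjoint (P i) (P j)) (hPA : ∀ i, P i ⊆ fibre A f (d i))
    (h : ∀ m n, ∃ s : Finset ι, DimLE S (fibre A f m \ ⋃ i ∈ s, P i) n)
    (E : Set (FreeCommRing (Variety k))) (m : Completed E) :
    HasIntegral E S A f m ↔ (∀ N : ℤ, {i | ¬ DimLE S (P i) (N - d i)}.Finite) ∧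
      HasSum (fun i => mulLefschetz E (d i) (measure E S (P i))) m := by
  have hfib : ∀ i n, d i ≠ n → Disjoint (fibre A f n) (P i) := fun i n hi =>
    Set.disjoint_left.mpr fun x hx hx' => hi ((hPA i hx').2.symm.trans hx.2)
  have hs : ∀ m n, ∃ s : Finset {i // d i = m}, DimLE S (fibre A f m \ ⋃ i ∈ s, P i) n := by
    intro m n
    obtain ⟨s, hs⟩ := h m n
    refine ⟨s.subtype fun i => d i = m, hs.mono (fun x hx => ⟨hx.1, fun hx' => hx.2 ?_⟩) le_rfl⟩
    obtain ⟨i, hi, hxi⟩ := Set.mem_iUnion₂.mp hx'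
    have hdi : d i = m := by
      by_contra hne
      exact Set.disjoint_left.mp (hfib i m hne) hx.1 hxi
    exact Set.mem_iUnion₂.mpr ⟨⟨i, hdi⟩, by simpa using hi, hxi⟩
  have hsum := fun n => hS.hasSum_measure (A := fibre A f n) (P := fun i : {i // d i = n} => P i)
    (fun i => hP i) (fun i j hij => hd fun he => hij (Subtype.ext he))
    (fun i => by
      have := hPA i
      rwa [i.2] at this) (hs n) E
  have hf : IsMeasurableFun S A f := fun n => (hsum n).1
  -- convergence
  have hconv : (∀ N : ℤ, {n : ℤ | ¬ DimLE S (fibre A f n) (N - n)}.Finite) ↔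
      ∀ N : ℤ, {i | ¬ DimLE S (P i) (N - d i)}.Finite := by
    constructor
    · intro H N
      choose s hs using fun n => h n (N - n)
      refine ((H N).biUnion fun n _ => (s n).finite_toSet).subset fun i hi => ?_
      refine Set.mem_iUnion₂.mpr ⟨d i, fun hfi => hi (hfi.mono (hPA i) le_rfl), ?_⟩
      by_contra his
      refine hi ((hs (d i)).mono (fun x hx => ⟨hPA i hx, fun hx' => ?_⟩) le_rfl)
      obtain ⟨j, hj, hxj⟩ := Set.mem_iUnion₂.mp hx'
      refine Set.disjoint_left.mp (hd fun he => ?_) hx hxj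
      exact his (he ▸ hj)
    · intro H N
      refine ((H N).image d).subset fun n hn => ?_
      by_contra hne
      obtain ⟨s, hs⟩ := hs n (N - n)
      refine hn ((hS.dimLE_union hs (hS.dimLE_biUnion s (A := fun i => P i) fun i _ => ?_)).mono
        (fun x hx => ?_) le_rfl)
      · by_contra hi
        exact hne ⟨i, fun h' => hi (by rwa [i.2] at h'), i.2⟩
      · by_cases hx' : x ∈ ⋃ i ∈ s, P i
        · exact Or.inr hx'
        · exact Or.inl ⟨hx, hx'⟩
  rw [HasIntegral, hconv]
  refine ⟨fun H => ⟨H.2.1, ?_⟩, fun H => ⟨hf, H.1, ?_⟩⟩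
  all_goals
    obtain ⟨M, hM⟩ : Summable fun i => mulLefschetz E (d i) (measure E S (P i)) := by
      refine summable_of_finite fun N => ((show ∀ N : ℤ, {i | ¬ DimLE S (P i) (N - d i)}.Finite by
        first | exact H.1 | exact H.2.1) (-N)).subset fun i hi hdi => hi ?_
      have h0 := hS.proj_measure_eq_zero (hP i) E (N := N + d i)
        (hdi.mono subset_rfl (by omega))
      rw [proj_mulLefschetz (r := 0) h0, zero_mul]
      rfl
    have hM' := (Equiv.sigmaFiberEquiv d).hasSum_iff.mpr hM
    have h2 := hM'.sigma (g := fun n => mulLefschetz E n (measure E S (fibre A f n))) fun n => by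
      have := hasSum_mulLefschetz n (hsum n).2
      convert this using 2 with i
      change mulLefschetz E (d i.1) _ = _
      rw [i.2]
      rfl
  · rwa [H.2.2.unique h2]
  · rwa [H.2.unique hM]

end Measure

section Transfer

variable {k : Type u} [Field k] [IsAlgClosed k] {X X' : Type v} {S : TruncationSystem k X}
  {S' : TruncationSystem k X'}

/-- The map `ψ` identifies the cylinders contained in `D` with those contained in `ψ '' D`, and
multiplies measures by `𝕃 ^ (-c)`. -/
structure IsMeasureShift (S' : TruncationSystem k X') (S : TruncationSystem k X) (ψ : X' → X)
    (D : Set X') (c : ℤ) : Prop where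
  injOn : Set.InjOn ψ D
  isCyl : IsCyl S' D
  forward : ∀ C ⊆ D, IsCyl S' C → IsCyl S (ψ '' C)
  backward : ∀ C ⊆ D, IsCyl S (ψ '' C) → IsCyl S' C
  vol_eq : ∀ C ⊆ D, IsCyl S' C → ∀ E : Set (FreeCommRing (Variety k)),
    vol E S' C = vol E S (ψ '' C) * lefschetzPow E c
  dimLE_iff : ∀ C ⊆ D, IsCyl S' C → ∀ n, DimLE S (ψ '' C) n ↔ DimLE S' C (n + c)

variable {ψ : X' → X} {D : Set X'} {c : ℤ} (h : IsMeasureShift S' S ψ D c)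
  (hS : IsRegularSystem S) (hS' : IsRegularSystem S')
include h hS hS'

theorem IsMeasureShift.dimLE_iff' {A : Set X'} (hA : A ⊆ D) (n : ℤ) :
    DimLE S (ψ '' A) n ↔ DimLE S' A (n + c) := by
  constructor
  · rintro ⟨l, B, hB, hAB, hd⟩
    have hB' : IsCyl S (B ∩ ψ '' D) := hS.isCyl_inter ⟨l, hB⟩ (h.forward D subset_rfl h.isCyl)
    obtain ⟨C, hC, hCB⟩ := Set.subset_image_iff.mp (Set.inter_subset_right (s := B) (t := ψ '' D))
    rw [← hCB] at hB'
    have hdC : DimLE S (ψ '' C) n :=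
      DimLE.mono ⟨l, B, hB, subset_rfl, hd⟩ (hCB.trans_subset Set.inter_subset_left) le_rfl
    refine ((h.dimLE_iff C hC (h.backward C hC hB') n).mp hdC).mono ?_ le_rfl
    rw [← h.injOn.image_subset_image_iff hA hC, hCB]
    exact Set.subset_inter hAB (Set.image_mono hA)
  · rintro ⟨l, B, hB, hAB, hd⟩
    refine DimLE.mono ((h.dimLE_iff (B ∩ D) Set.inter_subset_right
      (hS'.isCyl_inter ⟨l, hB⟩ h.isCyl) n).mpr ?_) (Set.image_mono (Set.subset_inter hAB hA)) le_rfl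
    exact DimLE.mono ⟨l, B, hB, subset_rfl, hd⟩ Set.inter_subset_left le_rfl

theorem IsMeasureShift.isMeasurableSet {A : Set X'} (hA : A ⊆ D)
    (hm : IsMeasurableSet S (ψ '' A)) : IsMeasurableSet S' A ∧
      ∀ (E : Set (FreeCommRing (Variety k))) (d : ℤ),
        mulLefschetz E (d + -c) (measure E S' A) = mulLefschetz E d (measure E S (ψ '' A)) := by
  have key : ∀ n, ∃ C ⊆ D, IsCyl S' C ∧ DimLE S (symmDiff (ψ '' A) (ψ '' C)) n ∧
      DimLE S' (symmDiff A C) (n + c) := by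
    intro n
    obtain ⟨B, hB, hd⟩ := isMeasurableSet_iff.mp hm n
    have hB' : IsCyl S (B ∩ ψ '' D) := hS.isCyl_inter hB (h.forward D subset_rfl h.isCyl)
    obtain ⟨C, hC, hCB⟩ := Set.subset_image_iff.mp (Set.inter_subset_right (s := B) (t := ψ '' D))
    rw [← hCB] at hB'
    have hd' : DimLE S (symmDiff (ψ '' A) (ψ '' C)) n := by
      refine hd.mono ?_ le_rfl
      rw [hCB]
      rintro x (⟨hx, hx'⟩ | ⟨hx, hx'⟩)
      · exact Or.inl ⟨hx, fun hxB => hx' ⟨hxB, Set.image_mono hA hx⟩⟩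
      · exact Or.inr ⟨hx.1, hx'⟩
    refine ⟨C, hC, h.backward C hC hB', hd', ?_⟩
    have hAC : symmDiff A C ⊆ D := fun x hx => hx.elim (fun hx => hA hx.1) fun hx => hC hx.1
    rw [← h.dimLE_iff' hS hS' hAC]
    refine hd'.mono ?_ le_rfl
    rintro _ ⟨x, ⟨hx, hx'⟩ | ⟨hx, hx'⟩, rfl⟩
    · refine Or.inl ⟨⟨x, hx, rfl⟩, ?_⟩
      rintro ⟨y, hy, he⟩
      exact hx' (h.injOn (hC hy) (hA hx) he ▸ hy)
    · refine Or.inr ⟨⟨x, hx, rfl⟩, ?_⟩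
      rintro ⟨y, hy, he⟩
      exact hx' (h.injOn (hA hy) (hC hx) he ▸ hy)
  have hm' : IsMeasurableSet S' A := isMeasurableSet_iff.mpr fun n => by
    obtain ⟨C, hC, hC', -, hd⟩ := key (n - c)
    exact ⟨C, hC', by rwa [sub_add_cancel] at hd⟩
  refine ⟨hm', fun E d => Completed.ext_proj fun N => ?_⟩
  obtain ⟨C, hC, hC', hd, hd'⟩ := key (-(N + d))
  rw [proj_mulLefschetz (hS.proj_measure hm E (h.forward C hC hC') hd),
    proj_mulLefschetz (hS'.proj_measure hm' E hC' (hd'.mono subset_rfl (by omega))),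
    h.vol_eq C hC hC', mul_assoc, ← lefschetzPow_add, add_comm d, add_neg_cancel_left]

end Transfer

/-! ### Laurent series in characteristic `p` -/

section Laurent

variable {k : Type u} [Field k]

theorem exists_coeff_eq_zero_of_lt (a : LaurentSeries k) : ∃ A, ∀ i < A, a.coeff i = 0 :=
  ⟨a.order, fun _ hi => HahnSeries.coeff_eq_zero_of_lt_order hi⟩

theorem exists_laurent {c : ℤ → k} {A : ℤ} (h : ∀ i < A, c i = 0) :
    ∃ a : LaurentSeries k, ∀ i, a.coeff i = c i :=
  ⟨HahnSeries.ofSuppBddBelow c ⟨A, fun i hi => by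
    by_contra hlt
    exact hi (h i (by omega))⟩, fun i => congrFun HahnSeries.coeff_ofSuppBddBelow i⟩

theorem laurent_coeff_mul {a b : LaurentSeries k} {A B : ℤ} (ha : ∀ i < A, a.coeff i = 0)
    (hb : ∀ i < B, b.coeff i = 0) {n C : ℤ} (hC : n - B < C) :
    (a * b).coeff n = ∑ i ∈ Finset.Ico A C, a.coeff i * b.coeff (n - i) := by
  rw [HahnSeries.coeff_mul]
  refine Finset.sum_bij_ne_zero (fun ij _ _ => ij.1) ?_ ?_ ?_ ?_
  · intro ij h _
    rw [Finset.mem_antidiagonal] at h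
    refine Finset.mem_Ico.mpr ⟨le_of_not_gt fun h' => h.1 (ha _ h'), ?_⟩
    by_contra hc
    exact h.2.1 (hb _ (by have := h.2.2; omega))
  · intro x hx _ y hy _ he
    rw [Finset.mem_antidiagonal] at hx hy
    exact Prod.ext he (by have := hx.2.2; have := hy.2.2; omega)
  · intro i _ hne
    refine ⟨(i, n - i), ?_, hne, rfl⟩
    rw [Finset.mem_antidiagonal]
    exact ⟨left_ne_zero_of_mul hne, right_ne_zero_of_mul hne, by simp⟩
  · intro ij h _
    rw [Finset.mem_antidiagonal] at h
    rw [← h.2.2, add_sub_cancel_left]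

theorem laurent_coeff_mul_eq_zero {a b : LaurentSeries k} {A B : ℤ} (ha : ∀ i < A, a.coeff i = 0)
    (hb : ∀ i < B, b.coeff i = 0) {n : ℤ} (hn : n < A + B) : (a * b).coeff n = 0 := by
  rw [laurent_coeff_mul ha hb (C := A) (by omega), Finset.Ico_self, Finset.sum_empty]

theorem laurent_coeff_pow_eq_zero {a : LaurentSeries k} {A : ℤ} (ha : ∀ i < A, a.coeff i = 0)
    (m : ℕ) : ∀ n < m * A, (a ^ m).coeff n = 0 := by
  induction m with
  | zero =>
    intro n hn
    rw [pow_zero, HahnSeries.coeff_one, if_neg (by push_cast at hn; omega)]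
  | succ m ih =>
    intro n hn
    rw [pow_succ]
    exact laurent_coeff_mul_eq_zero ih ha (by push_cast at hn; linarith)

variable (p : ℕ) [Fact p.Prime] [CharP k p]

instance : CharP (LaurentSeries k) p :=
  charP_of_injective_ringHom (HahnSeries.C (Γ := ℤ) (R := k)).injective p

theorem laurent_coeff_pow_char (a : LaurentSeries k) (n : ℤ) :
    (a ^ p).coeff n = if (p : ℤ) ∣ n then a.coeff (n / p) ^ p else 0 := by
  have hp : (0 : ℤ) < p := by exact_mod_cast (Fact.out : p.Prime).pos
  obtain ⟨A, hA⟩ := exists_coeff_eq_zero_of_lt a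
  let M := max A (n / p + 1)
  let T : LaurentSeries k := ∑ i ∈ Finset.Ico A M, HahnSeries.single i (a.coeff i)
  have hT : ∀ i, T.coeff i = if i ∈ Finset.Ico A M then a.coeff i else 0 := by
    intro i
    simp only [T, HahnSeries.coeff_sum, HahnSeries.coeff_single]
    convert Finset.sum_ite_eq (Finset.Ico A M) i a.coeff
  have hR : ∀ i < M, (a - T).coeff i = 0 := by
    intro i hi
    rw [HahnSeries.coeff_sub, hT]
    split_ifs with h
    · exact sub_self _
    · rw [hA i (by rw [Finset.mem_Ico] at h; omega), sub_zero]
  have hn : n < p * M := by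
    have h1 : n < p * (n / p + 1) := by
      have := Int.emod_lt_of_pos n hp
      have := Int.mul_ediv_add_emod n p
      linarith
    exact h1.trans_le (by gcongr; exact le_max_right _ _)
  have hTp : T ^ p = ∑ i ∈ Finset.Ico A M, HahnSeries.single (p * i) (a.coeff i ^ p) := by
    rw [sum_pow_char]
    refine Finset.sum_congr rfl fun i _ => ?_
    rw [HahnSeries.single_pow, nsmul_eq_mul]
  rw [← add_sub_cancel T a, add_pow_char, HahnSeries.coeff_add,
    laurent_coeff_pow_eq_zero hR p n hn, add_zero, add_sub_cancel, hTp, HahnSeries.coeff_sum]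
  simp only [HahnSeries.coeff_single]
  split_ifs with h
  · obtain ⟨m, rfl⟩ := h
    rw [Int.mul_ediv_cancel_left _ hp.ne']
    simp only [mul_right_inj' hp.ne', Finset.sum_ite_eq]
    split_ifs with hm
    · rfl
    · have : m < A := by
        by_contra hA'
        refine hm (Finset.mem_Ico.mpr ⟨by omega, ?_⟩)
        rw [mul_lt_mul_iff_right₀ hp] at hn
        exact hn
      rw [hA m this, zero_pow (Fact.out : p.Prime).ne_zero]
  · exact Finset.sum_eq_zero fun i _ => if_neg fun hi => h ⟨i, hi⟩

theorem laurent_coeff_pow_mul (a : LaurentSeries k) (i : ℤ) :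
    (a ^ p).coeff (p * i) = a.coeff i ^ p := by
  rw [laurent_coeff_pow_char, if_pos (dvd_mul_right _ _), Int.mul_ediv_cancel_left]
  exact_mod_cast (Fact.out : p.Prime).ne_zero

theorem laurent_coeff_pow_of_not_dvd (a : LaurentSeries k) {i : ℤ} (hi : ¬ (p : ℤ) ∣ i) :
    (a ^ p).coeff i = 0 := by
  rw [laurent_coeff_pow_char, if_neg hi]

variable {p}

/-- `Δ_G` is stable under multiplication by `p`-th powers. -/
theorem mul_pow_mem_deltaG {f : LaurentSeries k} (hf : f ∈ DeltaG p) (a : LaurentSeries k) :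
    f * a ^ p ∈ DeltaG p := by
  intro n hn
  obtain ⟨A, hA⟩ := exists_coeff_eq_zero_of_lt f
  obtain ⟨B, hB⟩ := exists_coeff_eq_zero_of_lt (a ^ p)
  rw [laurent_coeff_mul hA hB (C := n - B + 1) (by omega)]
  refine Finset.sum_eq_zero fun i _ => ?_
  by_cases h : (p : ℤ) ∣ i
  · rw [hf i h, zero_mul]
  · rw [laurent_coeff_pow_of_not_dvd p a (fun h' => h ((dvd_sub_right hn).mp h')), mul_zero]

theorem exists_powerSeries_iff {a : LaurentSeries k} :
    (∃ b : PowerSeries k, algebraMap (PowerSeries k) (LaurentSeries k) b = a) ↔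
      ∀ i < 0, a.coeff i = 0 := by
  constructor
  · rintro ⟨b, rfl⟩ i hi
    rw [LaurentSeries.coe_algebraMap, PowerSeries.coeff_coe, if_pos hi]
  · intro h
    refine ⟨PowerSeries.mk fun n => a.coeff n, ?_⟩
    ext i
    rw [LaurentSeries.coe_algebraMap, PowerSeries.coeff_coe]
    split_ifs with hi
    · exact (h i hi).symm
    · rw [PowerSeries.coeff_mk, Int.natAbs_of_nonneg (by omega)]

variable (p) in
open Classical in
/-- The function `s` of `f ∈ Δ_G`: the least `n ≥ 0` such that `f` has no terms of degree less than
`-p n`. -/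
def poleOrder (f : LaurentSeries k) : ℤ :=
  if f = 0 then 0 else max 0 ⌈(-(f.order : ℚ)) / p⌉

omit [CharP k p] in
theorem poleOrder_le_iff {f : LaurentSeries k} {n : ℤ} :
    poleOrder p f ≤ n ↔ 0 ≤ n ∧ ∀ i < -(p * n), f.coeff i = 0 := by
  have hp : (0 : ℚ) < p := by exact_mod_cast (Fact.out : p.Prime).pos
  rw [poleOrder]
  split_ifs with hf
  · simp [hf]
  · rw [max_le_iff, Int.ceil_le, div_le_iff₀ hp]
    refine and_congr_right fun _ => ?_
    have h1 : (-(f.order : ℚ) ≤ n * p) ↔ -(p * n) ≤ f.order := by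
      rw [neg_le, ← Int.cast_natCast (R := ℚ) p, ← Int.cast_mul, ← Int.cast_neg, Int.cast_le,
        mul_comm]
    rw [h1]
    constructor
    · exact fun h i hi => HahnSeries.coeff_eq_zero_of_lt_order (by omega)
    · intro h
      by_contra hlt
      exact HahnSeries.coeff_order_eq_zero.not.mpr hf (h _ (by omega))

omit [CharP k p] in
theorem poleOrder_nonneg (f : LaurentSeries k) : 0 ≤ poleOrder p f := (poleOrder_le_iff.mp le_rfl).1

omit [CharP k p] in
theorem coeff_eq_zero_of_poleOrder (f : LaurentSeries k) :
    ∀ i < -(p * poleOrder p f), f.coeff i = 0 := (poleOrder_le_iff.mp le_rfl).2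

end Laurent

/-! ### Twisted arcs in coordinates -/

section Arcs

variable {k : Type u} [Field k] {p : ℕ} [Fact p.Prime]

theorem zCoeff_zero_add_mul (f a b : LaurentSeries k) :
    zCoeff p 0 (algebraMap _ (TorsorRing p f) b + algebraMap _ _ a * TorsorRing.z p f) = b := by
  have hp := (Fact.out : p.Prime)
  have h : algebraMap _ (TorsorRing p f) b + algebraMap _ _ a * TorsorRing.z p f =
      AdjoinRoot.mk (torsorPoly p f) (Polynomial.C a * Polynomial.X + Polynomial.C b) := by
    rw [map_add, map_mul, add_comm]
    rfl
  rw [h]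
  change (AdjoinRoot.modByMonicHom (torsorPoly_monic p f) (AdjoinRoot.mk _ _)).coeff 0 = b
  rw [AdjoinRoot.modByMonicHom_mk, (Polynomial.modByMonic_eq_self_iff
    (torsorPoly_monic p f)).mpr]
  · simp
  · rw [Polynomial.degree_X_pow_sub_C hp.pos]
    refine Polynomial.degree_linear_le.trans_lt ?_
    exact_mod_cast hp.one_lt

theorem zCoeff_zero_algebraMap (f b : LaurentSeries k) :
    zCoeff p 0 (algebraMap _ (TorsorRing p f) b) = b := by
  simpa using zCoeff_zero_add_mul (p := p) f 0 b

variable [CharP k p]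

theorem coactionTorsor_algebraMap (f a : LaurentSeries k) :
    coactionTorsor p f (algebraMap _ _ a) = algebraMap _ _ a ⊗ₜ 1 :=
  coactionTorsorRingHom_algebraMap p f a

theorem coactionTorsor_z (f : LaurentSeries k) :
    coactionTorsor p f (TorsorRing.z p f) = TorsorRing.z p f ⊗ₜ 1 + 1 ⊗ₜ eps k p :=
  TorsorRing.lift_z _ _ (by rw [add_pow_tensor, TorsorRing.z_pow]; rfl)

theorem coactionV_X_zero : coactionV k p (MvPolynomial.X 0) = MvPolynomial.X 0 ⊗ₜ 1 := by
  simp [coactionV]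

theorem coactionV_X_one : coactionV k p (MvPolynomial.X 1) =
    MvPolynomial.X 1 ⊗ₜ 1 + MvPolynomial.X 0 ⊗ₜ eps k p := by
  simp [coactionV]

theorem TwistedArc.coaction_X_zero (γ : TwistedArc k p) :
    coactionTorsor p γ.f (γ.hom (MvPolynomial.X 0)) = γ.hom (MvPolynomial.X 0) ⊗ₜ 1 := by
  have h := DFunLike.congr_fun γ.equivariant (MvPolynomial.X 0)
  rw [AlgHom.comp_apply, coactionV_X_zero, Algebra.TensorProduct.map_tmul, map_one] at h
  exact h.symm

theorem TwistedArc.hom_X_zero (γ : TwistedArc k p) :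
    γ.hom (MvPolynomial.X 0) = algebraMap _ _ γ.a := by
  obtain ⟨a, ha⟩ := mem_range_of_coaction_eq p γ.coaction_X_zero
  rw [TwistedArc.a, ← ha, zCoeff_zero_algebraMap]

theorem TwistedArc.hom_X_one (γ : TwistedArc k p) : γ.hom (MvPolynomial.X 1) =
    algebraMap _ _ γ.b + algebraMap _ _ γ.a * TorsorRing.z p γ.f := by
  have h := DFunLike.congr_fun γ.equivariant (MvPolynomial.X 1)
  rw [AlgHom.comp_apply, coactionV_X_one, map_add, Algebra.TensorProduct.map_tmul,
    Algebra.TensorProduct.map_tmul, map_one, AlgHom.comp_apply, γ.hom_X_zero] at h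
  have h' : coactionTorsor p γ.f (γ.hom (MvPolynomial.X 1) -
      algebraMap _ _ γ.a * TorsorRing.z p γ.f) = (γ.hom (MvPolynomial.X 1) -
        algebraMap _ _ γ.a * TorsorRing.z p γ.f) ⊗ₜ 1 := by
    rw [map_sub, map_mul, coactionTorsor_algebraMap, coactionTorsor_z, ← h, mul_add,
      Algebra.TensorProduct.tmul_mul_tmul, Algebra.TensorProduct.tmul_mul_tmul,
      TensorProduct.sub_tmul]
    simp
  obtain ⟨b, hb⟩ := mem_range_of_coaction_eq p h'
  have hb' : γ.hom (MvPolynomial.X 1) =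
    algebraMap _ _ b + algebraMap _ _ γ.a * TorsorRing.z p γ.f := by rw [hb, sub_add_cancel]
  rw [TwistedArc.b, hb', zCoeff_zero_add_mul]

theorem TwistedArc.s_eq (γ : TwistedArc k p) : γ.s = poleOrder p γ.f := rfl

theorem pow_hom_eq (f a b : LaurentSeries k) :
    (algebraMap _ _ b + algebraMap _ _ a * TorsorRing.z p f) ^ p =
      algebraMap _ (TorsorRing p f) (b ^ p + f * a ^ p) := by
  have : CharP (TorsorRing p f) p :=
    charP_of_injective_ringHom (algebraMap_laurent_injective p f) p
  rw [add_pow_char, mul_pow, TorsorRing.z_pow, map_add, map_mul, map_pow, map_pow, mul_comm]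

/-- The two summands have no degree in common, so that both are integral. -/
theorem TwistedArc.pow_add_coeff (γ : TwistedArc k p) :
    (∀ i < 0, (γ.b ^ p).coeff i = 0) ∧ ∀ i < 0, (γ.f * γ.a ^ p).coeff i = 0 := by
  have h : algebraMap _ _ (γ.b ^ p + γ.f * γ.a ^ p) ∈ integers p γ.f := by
    rw [← pow_hom_eq, ← γ.hom_X_one]
    exact pow_mem (γ.mem_integers _) p
  have h1 := exists_powerSeries_iff.mp (mem_range_of_mem_integers p h)
  have h2 := mul_pow_mem_deltaG γ.mem_deltaG γ.a
  refine ⟨fun i hi => ?_, fun i hi => ?_⟩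
  · by_cases hpi : (p : ℤ) ∣ i
    · simpa [h2 i hpi] using h1 i hi
    · exact laurent_coeff_pow_of_not_dvd p γ.b hpi
  · by_cases hpi : (p : ℤ) ∣ i
    · exact h2 i hpi
    · simpa [laurent_coeff_pow_of_not_dvd p γ.b hpi] using h1 i hi

theorem TwistedArc.b_coeff (γ : TwistedArc k p) : ∀ i < 0, γ.b.coeff i = 0 := by
  intro i hi
  have hp : (0 : ℤ) < p := by exact_mod_cast (Fact.out : p.Prime).pos
  have := γ.pow_add_coeff.1 (p * i) (by nlinarith)
  rw [laurent_coeff_pow_mul] at this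
  exact pow_eq_zero_iff (Fact.out : p.Prime).ne_zero |>.mp this

/-- If `f a ^ p` is integral then `s(f) ≤ ord(a)`. -/
theorem poleOrder_le_order {f a : LaurentSeries k} (ha : a ≠ 0) (ha0 : 0 ≤ a.order)
    (h : ∀ i < 0, (f * a ^ p).coeff i = 0) : poleOrder p f ≤ a.order := by
  refine poleOrder_le_iff.mpr ⟨ha0, ?_⟩
  rcases eq_or_ne f 0 with rfl | hf
  · simp
  intro i hi
  refine HahnSeries.coeff_eq_zero_of_lt_order (hi.trans_le ?_)
  have h1 : (f * a ^ p).order = f.order + p * a.order := by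
    rw [HahnSeries.order_mul hf (pow_ne_zero _ ha), HahnSeries.order_pow, nsmul_eq_mul]
  have h2 : 0 ≤ (f * a ^ p).order := by
    by_contra hlt
    exact HahnSeries.coeff_order_eq_zero.not.mpr (mul_ne_zero hf (pow_ne_zero _ ha))
      (h _ (by omega))
  linarith

theorem TwistedArc.a_nonneg (γ : TwistedArc k p) : ∀ i < 0, γ.a.coeff i = 0 := by
  have h := γ.mem_integers (MvPolynomial.X 0)
  rw [γ.hom_X_zero] at h
  exact exists_powerSeries_iff.mp (mem_range_of_mem_integers p h)

theorem order_nonneg_of_coeff {a : LaurentSeries k} (h : ∀ i < 0, a.coeff i = 0) : 0 ≤ a.order := by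
  rcases eq_or_ne a 0 with rfl | ha
  · simp
  by_contra hlt
  exact HahnSeries.coeff_order_eq_zero.not.mpr ha (h _ (by omega))

theorem TwistedArc.s_le_order (γ : TwistedArc k p) (ha : γ.a ≠ 0) : γ.s ≤ γ.a.order :=
  poleOrder_le_order ha (order_nonneg_of_coeff γ.a_nonneg) γ.pow_add_coeff.2

theorem TwistedArc.a_coeff (γ : TwistedArc k p) : ∀ i < γ.s, γ.a.coeff i = 0 := by
  intro i hi
  rcases eq_or_ne γ.a 0 with ha | ha
  · rw [ha]; rfl
  · exact HahnSeries.coeff_eq_zero_of_lt_order (hi.trans_le (γ.s_le_order ha))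

theorem algebraMap_powerSeries_mem_integers (f : LaurentSeries k) {a : LaurentSeries k}
    (ha : ∀ i < 0, a.coeff i = 0) : algebraMap _ (TorsorRing p f) a ∈ integers p f := by
  obtain ⟨b, rfl⟩ := exists_powerSeries_iff.mpr ha
  exact (integers p f).algebraMap_mem b

/-- Every triple `(f, a, b)` as in the description of twisted arcs defines one. -/
theorem exists_twistedArc {f a b : LaurentSeries k} (hf : f ∈ DeltaG p)
    (ha : ∀ i < poleOrder p f, a.coeff i = 0) (hb : ∀ i < 0, b.coeff i = 0) :
    ∃ γ : TwistedArc k p, γ.f = f ∧ γ.a = a ∧ γ.b = b := by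
  let φ : VRing k →ₐ[k] TorsorRing p f :=
    MvPolynomial.aeval ![algebraMap _ _ a, algebraMap _ _ b + algebraMap _ _ a * TorsorRing.z p f]
  have h0 : φ (MvPolynomial.X 0) = algebraMap _ _ a := by simp [φ]
  have h1 : φ (MvPolynomial.X 1) = algebraMap _ _ b + algebraMap _ _ a * TorsorRing.z p f := by
    simp [φ]
  have ha0 : ∀ i < 0, a.coeff i = 0 := fun i hi => ha i (hi.trans_le (poleOrder_nonneg f))
  have hmem0 : φ (MvPolynomial.X 0) ∈ integers p f := by
    rw [h0]
    exact algebraMap_powerSeries_mem_integers f ha0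
  have hmem1 : φ (MvPolynomial.X 1) ∈ integers p f := by
    rw [h1]
    refine add_mem (algebraMap_powerSeries_mem_integers f hb) ?_
    by_cases hf0 : f = 0
    · have hz : TorsorRing.z p f ∈ integers p f := by
        rw [integers, if_pos hf0]
        exact Algebra.subset_adjoin rfl
      exact mul_mem (algebraMap_powerSeries_mem_integers f ha0) hz
    · have hp : (0 : ℤ) < p := by exact_mod_cast (Fact.out : p.Prime).pos
      have hint : ∀ i < 0, (f * a ^ p).coeff i = 0 := fun i hi =>
        laurent_coeff_mul_eq_zero (coeff_eq_zero_of_poleOrder (p := p) f)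
          (laurent_coeff_pow_eq_zero ha p) (by omega)
      obtain ⟨g, hg⟩ := exists_powerSeries_iff.mpr hint
      rw [integers, if_neg hf0]
      refine IsIntegral.of_pow (Fact.out : p.Prime).pos (?_ : IsIntegral (PowerSeries k) _)
      have := pow_hom_eq (p := p) f a 0
      rw [map_zero, zero_add, zero_pow (Fact.out : p.Prime).ne_zero, zero_add, ← hg] at this
      rw [this]
      exact isIntegral_algebraMap (A := TorsorRing p f) (x := g)
  have hmem : ∀ r, φ r ∈ integers p f := by
    intro r
    induction r using MvPolynomial.induction_on with
    | C c =>
      have : φ (MvPolynomial.C c) = algebraMap (PowerSeries k) _ (algebraMap k _ c) := by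
        rw [← MvPolynomial.algebraMap_eq, AlgHom.commutes]
        rfl
      rw [this]
      exact (integers p f).algebraMap_mem _
    | add r r' h h' =>
      rw [map_add]
      exact add_mem h h'
    | mul_X r i h =>
      rw [map_mul]
      refine mul_mem h ?_
      fin_cases i
      · exact hmem0
      · exact hmem1
  refine ⟨⟨f, hf, φ, hmem, ?_⟩, rfl, ?_, ?_⟩
  · refine MvPolynomial.algHom_ext fun i => ?_
    fin_cases i
    · change Algebra.TensorProduct.map φ _ (coactionV k p (MvPolynomial.X 0)) =
        coactionTorsor p f (φ (MvPolynomial.X 0))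
      rw [coactionV_X_zero, Algebra.TensorProduct.map_tmul, h0, coactionTorsor_algebraMap, map_one]
    · change Algebra.TensorProduct.map φ _ (coactionV k p (MvPolynomial.X 1)) =
        coactionTorsor p f (φ (MvPolynomial.X 1))
      rw [coactionV_X_one, map_add, Algebra.TensorProduct.map_tmul,
        Algebra.TensorProduct.map_tmul, h0, h1, map_add, map_mul, coactionTorsor_algebraMap,
        coactionTorsor_algebraMap, coactionTorsor_z, mul_add, Algebra.TensorProduct.tmul_mul_tmul,
        Algebra.TensorProduct.tmul_mul_tmul, TensorProduct.add_tmul]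
      simp [add_assoc]
  · exact (congrArg (zCoeff p 0) h0).trans (zCoeff_zero_algebraMap f a)
  · exact (congrArg (zCoeff p 0) h1).trans (zCoeff_zero_add_mul f a b)

theorem TwistedArc.ext_coord {γ γ' : TwistedArc k p} (hf : γ.f = γ'.f) (ha : γ.a = γ'.a)
    (hb : γ.b = γ'.b) : γ = γ' := by
  have h0 := γ.hom_X_zero
  have h1 := γ.hom_X_one
  have h0' := γ'.hom_X_zero
  have h1' := γ'.hom_X_one
  rw [ha] at h0 h1
  rw [hb] at h1
  clear ha hb
  generalize γ'.a = a at *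
  generalize γ'.b = b at *
  obtain ⟨f, hfm, φ, hφ, hφ'⟩ := γ
  obtain ⟨f', hfm', φ', hφ₁, hφ₂⟩ := γ'
  dsimp only at hf h0 h1 h0' h1'
  subst hf
  have : φ = φ' := by
    refine MvPolynomial.algHom_ext fun i => ?_
    fin_cases i
    · exact h0.trans h0'.symm
    · exact h1.trans h1'.symm
  subst this
  rfl

/-- The coordinate `x` of the image of a twisted arc in `V/G`. -/
theorem psi_gen_zero (γ : TwistedArc k p) :
    algebraMap (PowerSeries k) (LaurentSeries k) (psi γ (invariantGen k p 0)) = γ.a := by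
  refine algebraMap_laurent_injective p γ.f ?_
  rw [← γ.hom_X_zero]
  exact algebraMap_psi γ (invariantGen k p 0)

/-- The coordinate `y ^ p` of the image of a twisted arc in `V/G`. -/
theorem psi_gen_one (γ : TwistedArc k p) :
    algebraMap (PowerSeries k) (LaurentSeries k) (psi γ (invariantGen k p 1)) =
      γ.b ^ p + γ.f * γ.a ^ p := by
  refine algebraMap_laurent_injective p γ.f ?_
  rw [← pow_hom_eq, ← γ.hom_X_one, ← map_pow]
  exact algebraMap_psi γ (invariantGen k p 1)

end Arcs

/-! ### The ring of invariants -/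

section Invariants

variable {k : Type u} [Field k] {p : ℕ}

/-- A homomorphism `k[ε] → k[δ]` with `δ ^ 2 = 0` turns the coaction into the derivation
`x ∂/∂y`. -/
theorem pderiv_eq_zero_of_mem_invariants (hp : 2 ≤ p) {r : VRing k} (hr : r ∈ invariants k p) :
    MvPolynomial.pderiv 1 r = 0 := by
  have he : (DualNumber.eps : DualNumber (VRing k)) ^ p = 0 := by
    obtain ⟨n, hn⟩ := Nat.exists_eq_add_of_le hp
    rw [hn, pow_add, pow_two, DualNumber.eps_mul_eps, zero_mul]
  let h : VRing k ⊗[k] CoordRing k p →ₐ[k] DualNumber (VRing k) :=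
    Algebra.TensorProduct.lift (TrivSqZeroExt.inlAlgHom k _ _)
      (AdjoinRoot.liftAlgHom _ (Algebra.ofId k _) DualNumber.eps (by simp [he]))
      (fun _ _ => Commute.all _ _)
  have hl : ∀ w, h (w ⊗ₜ 1) = TrivSqZeroExt.inl w := fun w => by simp [h]
  have hr' : ∀ w, h (w ⊗ₜ eps k p) = TrivSqZeroExt.inl w * DualNumber.eps := fun w => by simp [h]
  have key : ∀ r : VRing k, h (coactionV k p r) =
      TrivSqZeroExt.inl r + TrivSqZeroExt.inr (MvPolynomial.X 0 * MvPolynomial.pderiv 1 r) := by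
    intro r
    induction r using MvPolynomial.induction_on with
    | C c =>
      rw [← MvPolynomial.algebraMap_eq, AlgHom.commutes, AlgHom.commutes, Derivation.map_algebraMap]
      simp [TrivSqZeroExt.algebraMap_eq_inl']
    | add r r' h₁ h₂ =>
      rw [map_add, map_add, h₁, h₂, map_add]
      refine TrivSqZeroExt.ext ?_ ?_ <;> simp [mul_add]
    | mul_X r i h₁ =>
      rw [map_mul, map_mul, h₁, Derivation.leibniz]
      fin_cases i
      · change _ * h (coactionV k p (MvPolynomial.X 0)) = _
        rw [coactionV, MvPolynomial.aeval_X]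
        change _ * h (MvPolynomial.X 0 ⊗ₜ 1) = _
        rw [hl]
        refine TrivSqZeroExt.ext ?_ ?_
        · simp
        · simp
          ring
      · change _ * h (coactionV k p (MvPolynomial.X 1)) = _
        rw [coactionV, MvPolynomial.aeval_X]
        change _ * h (MvPolynomial.X 1 ⊗ₜ 1 + MvPolynomial.X 0 ⊗ₜ eps k p) = _
        rw [map_add, hl, hr']
        refine TrivSqZeroExt.ext ?_ ?_
        · simp
        · simp
          ring
  have h0 : coactionV k p r = r ⊗ₜ 1 := hr
  have h1 := key r
  rw [h0, hl, left_eq_add] at h1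
  have h2 : MvPolynomial.X 0 * MvPolynomial.pderiv 1 r = 0 := by
    simpa using congrArg TrivSqZeroExt.snd h1
  exact (mul_eq_zero.mp h2).resolve_left (MvPolynomial.X_ne_zero 0)

variable [Fact p.Prime] [CharP k p]

variable (k p) in
/-- The homomorphism `k[x, w] → k[x, y]^G` with `w ↦ y ^ p`. -/
def toInvariants : MvPolynomial (Fin 2) k →ₐ[k] invariants k p :=
  MvPolynomial.aeval (invariantGen k p)

theorem toInvariants_surjective : Function.Surjective (toInvariants k p) := by
  rintro ⟨r, hr⟩
  have hp := (Fact.out : p.Prime)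
  have hd := pderiv_eq_zero_of_mem_invariants hp.two_le hr
  have hdvd : ∀ m ∈ r.support, p ∣ m 1 := by
    intro m hm
    by_contra hpm
    have h0 : m 1 ≠ 0 := fun h => hpm (h ▸ dvd_zero p)
    have h1 := congrArg (MvPolynomial.coeff (m - Finsupp.single 1 1)) hd
    have h2 : m - Finsupp.single 1 1 + Finsupp.single 1 1 = m :=
      tsub_add_cancel_of_le (Finsupp.single_le_iff.mpr (by omega))
    rw [MvPolynomial.coeff_pderiv, h2, MvPolynomial.coeff_zero] at h1
    have h3 : (m 1 : k) ≠ 0 := (CharP.cast_eq_zero_iff k p (m 1)).not.mpr hpm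
    have h4 : (((m - Finsupp.single 1 1 : Fin 2 →₀ ℕ) 1 : k) + 1) = m 1 := by
      rw [Finsupp.tsub_apply, Finsupp.single_eq_same]
      exact_mod_cast congrArg (Nat.cast (R := k)) (Nat.sub_add_cancel (by omega : 1 ≤ m 1))
    rw [h4] at h1
    exact (mul_ne_zero (MvPolynomial.mem_support_iff.mp hm) h3) h1
  refine ⟨∑ m ∈ r.support, MvPolynomial.monomial
    (Finsupp.single 0 (m 0) + Finsupp.single 1 (m 1 / p)) (r.coeff m), Subtype.ext ?_⟩
  change (invariants k p).val (toInvariants k p _) = r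
  rw [map_sum, map_sum]
  conv_rhs => rw [r.as_sum]
  refine Finset.sum_congr rfl fun m hm => ?_
  rw [toInvariants, MvPolynomial.aeval_monomial, map_mul, AlgHom.commutes,
    Finsupp.prod_fintype _ _ (by simp), Fin.prod_univ_two, map_mul, map_pow, map_pow,
    MvPolynomial.monomial_eq, Finsupp.prod_fintype _ _ (by simp), Fin.prod_univ_two]
  simp only [Finsupp.add_apply, Finsupp.single_apply]
  simp [invariantGen, ← pow_mul, Nat.mul_div_cancel' (hdvd m hm), MvPolynomial.algebraMap_eq]

variable [IsAlgClosed k]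

theorem toInvariants_injective : Function.Injective (toInvariants k p) := by
  rw [injective_iff_map_eq_zero]
  intro P hP
  refine MvPolynomial.funext fun u => ?_
  obtain ⟨v, hv⟩ := IsAlgClosed.exists_pow_nat_eq (u 1) (Fact.out : p.Prime).pos
  have h1 : (MvPolynomial.aeval ![u 0, v] : VRing k →ₐ[k] k).comp
      ((invariants k p).val.comp (toInvariants k p)) = MvPolynomial.aeval u := by
    refine MvPolynomial.algHom_ext fun i => ?_
    fin_cases i
    · simp [toInvariants, invariantGen]
    · simp [toInvariants, invariantGen, hv]
  have h2 := DFunLike.congr_fun h1 P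
  rw [AlgHom.comp_apply, AlgHom.comp_apply, hP, map_zero, map_zero] at h2
  rw [map_zero]
  exact (RingHom.congr_fun (MvPolynomial.coe_aeval_eq_eval u) P).symm.trans h2.symm

variable (k p) in
/-- The ring of invariants is the polynomial ring `k[x, y ^ p]`. -/
def invariantsEquiv : MvPolynomial (Fin 2) k ≃ₐ[k] invariants k p :=
  AlgEquiv.ofBijective (toInvariants k p) ⟨toInvariants_injective, toInvariants_surjective⟩

theorem invariantsEquiv_X (i : Fin 2) :
    invariantsEquiv k p (MvPolynomial.X i) = invariantGen k p i :=
  MvPolynomial.aeval_X _ _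

theorem projective_exteriorPower {R M : Type*} [CommRing R] [AddCommGroup M] [Module R M]
    [Module.Projective R M] (n : ℕ) : Module.Projective R (⋀[R]^n M) := by
  obtain ⟨s, hs⟩ := Module.projective_def'.mp (inferInstance : Module.Projective R M)
  refine Module.Projective.of_split (exteriorPower.map n s)
    (exteriorPower.map n (Finsupp.linearCombination R id)) ?_
  rw [← exteriorPower.map_comp, hs, exteriorPower.map_id]

/-- The sheaf of differential `2`-forms of a smooth variety is reflexive. -/
theorem omegaJacobian_eq_top_of_smooth {A : Type u} [CommRing A] [Algebra k A]
    [Algebra.FormallySmooth k A] [Algebra.FiniteType k A] : omegaJacobian k A = ⊤ := by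
  have := projective_exteriorPower (R := A) (M := Ω[A⁄k]) 2
  have h := LinearMap.range_eq_top.mpr (Module.bijective_dual_eval A (⋀[A]^2 (Ω[A⁄k]))).2
  rw [omegaJacobian, h]
  simp

theorem omegaJacobian_eq_top : omegaJacobian k (invariants k p) = ⊤ := by
  have : Algebra.FormallySmooth k (invariants k p) :=
    Algebra.FormallySmooth.of_equiv (invariantsEquiv k p)
  have : Algebra.FiniteType k (invariants k p) :=
    Algebra.FiniteType.equiv inferInstance (invariantsEquiv k p)
  exact omegaJacobian_eq_top_of_smooth

theorem quotientArc_ext {δ δ' : QuotientArc k p}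
    (h : ∀ i, δ (invariantGen k p i) = δ' (invariantGen k p i)) : δ = δ' := by
  have h1 : δ.comp (invariantsEquiv k p : MvPolynomial (Fin 2) k →ₐ[k] invariants k p) =
      δ'.comp (invariantsEquiv k p : MvPolynomial (Fin 2) k →ₐ[k] invariants k p) :=
    MvPolynomial.algHom_ext fun i => by
      change δ (invariantsEquiv k p _) = δ' (invariantsEquiv k p _)
      rw [invariantsEquiv_X, h]
  ext1 r
  obtain ⟨P, rfl⟩ := (invariantsEquiv k p).surjective r
  exact DFunLike.congr_fun h1 P

theorem exists_quotientArc (x : Fin 2 → PowerSeries k) :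
    ∃ δ : QuotientArc k p, ∀ i, δ (invariantGen k p i) = x i :=
  ⟨(MvPolynomial.aeval x).comp
    ((invariantsEquiv k p).symm : invariants k p →ₐ[k] MvPolynomial (Fin 2) k), fun i => by
    rw [← invariantsEquiv_X]
    simp⟩

/-! ### Arcs of the quotient in coordinates -/

/-- The coordinates `x` and `y ^ p` of an arc of `V/G`, as Laurent series. -/
def QuotientArc.coord (δ : QuotientArc k p) (i : Fin 2) : LaurentSeries k :=
  algebraMap (PowerSeries k) (LaurentSeries k) (δ (invariantGen k p i))

theorem coord_coeff_of_neg (δ : QuotientArc k p) (i : Fin 2) :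
    ∀ n < 0, (QuotientArc.coord δ i).coeff n = 0 := exists_powerSeries_iff.mp ⟨_, rfl⟩

theorem coord_coeff (δ : QuotientArc k p) (i : Fin 2) (n : ℕ) :
    (QuotientArc.coord δ i).coeff n = PowerSeries.coeff n (δ (invariantGen k p i)) := by
  rw [QuotientArc.coord, LaurentSeries.coe_algebraMap, LaurentSeries.coeff_coe_powerSeries]

theorem coord_ext {δ δ' : QuotientArc k p}
    (h : ∀ i, QuotientArc.coord δ i = QuotientArc.coord δ' i) : δ = δ' :=
  quotientArc_ext fun i => HahnSeries.ofPowerSeries_injective (Γ := ℤ) (h i)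

theorem exists_coord {x w : LaurentSeries k} (hx : ∀ n < 0, x.coeff n = 0)
    (hw : ∀ n < 0, w.coeff n = 0) :
    ∃ δ : QuotientArc k p, QuotientArc.coord δ 0 = x ∧ QuotientArc.coord δ 1 = w := by
  obtain ⟨x, rfl⟩ := exists_powerSeries_iff.mpr hx
  obtain ⟨w, rfl⟩ := exists_powerSeries_iff.mpr hw
  obtain ⟨δ, hδ⟩ := exists_quotientArc (p := p) ![x, w]
  exact ⟨δ, congrArg _ (hδ 0), congrArg _ (hδ 1)⟩

theorem coord_psi_zero (γ : TwistedArc k p) : QuotientArc.coord (psi γ) 0 = γ.a := psi_gen_zero γ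

theorem coord_psi_one (γ : TwistedArc k p) :
    QuotientArc.coord (psi γ) 1 = γ.b ^ p + γ.f * γ.a ^ p := psi_gen_one γ

theorem coord_psi_coeff_mul (γ : TwistedArc k p) (i : ℤ) :
    (QuotientArc.coord (psi γ) 1).coeff (p * i) = γ.b.coeff i ^ p := by
  rw [coord_psi_one, HahnSeries.coeff_add, laurent_coeff_pow_mul,
    mul_pow_mem_deltaG γ.mem_deltaG γ.a _ (dvd_mul_right _ _), add_zero]

theorem coord_psi_coeff_of_not_dvd (γ : TwistedArc k p) {i : ℤ} (hi : ¬ (p : ℤ) ∣ i) :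
    (QuotientArc.coord (psi γ) 1).coeff i = (γ.f * γ.a ^ p).coeff i := by
  rw [coord_psi_one, HahnSeries.coeff_add, laurent_coeff_pow_of_not_dvd p γ.b hi, zero_add]

/-- The map `ψ` is injective where `x ≠ 0`: the series `b ^ p` and `f a ^ p` are the parts of the
image of `y ^ p` consisting of the terms of degree divisible by `p` and prime to `p`. -/
theorem psi_injOn : Set.InjOn (psi : TwistedArc k p → QuotientArc k p) {γ | γ.a ≠ 0} := by
  intro γ hγ γ' hγ' h
  have ha : γ.a = γ'.a := by rw [← coord_psi_zero, h, coord_psi_zero]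
  have hb : γ.b = γ'.b := by
    ext i
    refine frobenius_inj k p ?_
    change γ.b.coeff i ^ p = γ'.b.coeff i ^ p
    rw [← coord_psi_coeff_mul, h, coord_psi_coeff_mul]
  have hf : γ.f * γ.a ^ p = γ'.f * γ'.a ^ p := by
    ext i
    by_cases hi : (p : ℤ) ∣ i
    · rw [mul_pow_mem_deltaG γ.mem_deltaG γ.a i hi, mul_pow_mem_deltaG γ'.mem_deltaG γ'.a i hi]
    · rw [← coord_psi_coeff_of_not_dvd γ hi, h, coord_psi_coeff_of_not_dvd γ' hi]
  rw [ha] at hf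
  exact TwistedArc.ext_coord (mul_right_cancel₀ (pow_ne_zero p hγ') hf) ha hb

/-- All arcs of `V/G` with `x ≠ 0` are images of twisted arcs. -/
theorem exists_psi_eq {δ : QuotientArc k p} (h : QuotientArc.coord δ 0 ≠ 0) :
    ∃ γ : TwistedArc k p, psi γ = δ ∧ γ.a = QuotientArc.coord δ 0 := by
  classical
  have hp : (0 : ℤ) < p := by exact_mod_cast (Fact.out : p.Prime).pos
  set x := QuotientArc.coord δ 0
  set w := QuotientArc.coord δ 1 with hw
  have hx0 := coord_coeff_of_neg δ 0
  have hw0 := coord_coeff_of_neg δ 1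
  choose root hroot using fun c : k => IsAlgClosed.exists_pow_nat_eq c (Fact.out : p.Prime).pos
  have hroot0 : root 0 = 0 := by
    have := hroot 0
    rwa [pow_eq_zero_iff (Fact.out : p.Prime).ne_zero] at this
  obtain ⟨b, hb⟩ := exists_laurent (c := fun i => root (w.coeff (p * i))) (A := 0) fun i hi => by
    rw [hw0 _ (by nlinarith), hroot0]
  obtain ⟨g, hg⟩ := exists_laurent (c := fun i => if (p : ℤ) ∣ i then 0 else w.coeff i) (A := 0)
    fun i hi => by rw [hw0 i hi, ite_self]
  have hg0 : ∀ i < 0, g.coeff i = 0 := fun i hi => by rw [hg, hw0 i hi, ite_self]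
  have hgΔ : g ∈ DeltaG p := fun i hi => by rw [hg, if_pos hi]
  have hfx : g * x⁻¹ ^ p * x ^ p = g := by
    rw [mul_assoc, ← mul_pow, inv_mul_cancel₀ h, one_pow, mul_one]
  have hs : poleOrder p (g * x⁻¹ ^ p) ≤ x.order :=
    poleOrder_le_order h (order_nonneg_of_coeff hx0) (by rwa [hfx])
  obtain ⟨γ, hγf, hγa, hγb⟩ := exists_twistedArc (mul_pow_mem_deltaG hgΔ x⁻¹)
    (fun i hi => HahnSeries.coeff_eq_zero_of_lt_order (hi.trans_le hs))
    (fun i hi => by rw [hb, hw0 _ (by nlinarith), hroot0] : ∀ i < 0, b.coeff i = 0)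
  refine ⟨γ, coord_ext fun j => ?_, hγa⟩
  fin_cases j
  · exact (coord_psi_zero γ).trans hγa
  · change QuotientArc.coord (psi γ) 1 = w
    ext i
    by_cases hi : (p : ℤ) ∣ i
    · obtain ⟨i, rfl⟩ := hi
      rw [coord_psi_coeff_mul, hγb, hb, hroot]
    · rw [coord_psi_coeff_of_not_dvd γ hi, hγf, hγa, hfx, hg, if_neg hi]

end Invariants

/-! ### Truncations of arcs -/

section Systems

/-- The integers in `[u, v)` prime to `p`. -/
abbrev PrimeTo (p : ℕ) (u v : ℤ) : Type := {i : ℤ // u ≤ i ∧ i < v ∧ ¬ (p : ℤ) ∣ i}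

instance (p : ℕ) (u v : ℤ) : Finite (PrimeTo p u v) :=
  Set.Finite.to_subtype ((Set.finite_Ico u v).subset fun _ (hi : _ ∧ _ ∧ _) => ⟨hi.1, hi.2.1⟩)

/-- The integers in `[u, v)`. -/
abbrev IntIco (u v : ℤ) : Type := {i : ℤ // u ≤ i ∧ i < v}

instance (u v : ℤ) : Finite (IntIco u v) := Set.Finite.to_subtype (Set.finite_Ico u v)

theorem card_intIco {u v : ℤ} (h : u ≤ v) : (Nat.card (IntIco u v) : ℤ) = v - u := by
  have : Nat.card (IntIco u v) = (Finset.Ico u v).card := by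
    rw [Nat.subtype_card]
    simp
  rw [this, Int.card_Ico, Int.toNat_of_nonneg (by omega)]

open Classical in
theorem card_primeTo (p : ℕ) (u v : ℤ) :
    Nat.card (PrimeTo p u v) = ((Finset.Ico u v).filter fun i => ¬ (p : ℤ) ∣ i).card := by
  rw [Nat.subtype_card]
  simp [and_assoc]

theorem card_primeTo_add (p : ℕ) {u v w : ℤ} (h : u ≤ v) (h' : v ≤ w) :
    Nat.card (PrimeTo p u w) = Nat.card (PrimeTo p u v) + Nat.card (PrimeTo p v w) := by
  classical
  rw [card_primeTo, card_primeTo, card_primeTo, ← Finset.Ico_union_Ico_eq_Ico h h',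
    Finset.filter_union, Finset.card_union_of_disjoint]
  exact (Finset.Ico_disjoint_Ico_consecutive u v w).mono (Finset.filter_subset _ _)
    (Finset.filter_subset _ _)

theorem card_primeTo_mul (p : ℕ) [Fact p.Prime] {u v : ℤ} (h : u ≤ v) :
    (Nat.card (PrimeTo p (u * p) (v * p)) : ℤ) = (p - 1) * (v - u) := by
  have hp : (0 : ℤ) < p := by exact_mod_cast (Fact.out : p.Prime).pos
  have h1 := Finset.card_filter_add_card_filter_not (s := Finset.Ico (u * p) (v * p))
    fun i => (p : ℤ) ∣ i
  have h2 := Int.Ico_filter_dvd_card (u * p) (v * p) hp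
  have hq : ((p : ℤ) : ℚ) ≠ 0 := by exact_mod_cast hp.ne'
  rw [Int.cast_mul, Int.cast_mul, mul_div_cancel_right₀ _ hq, mul_div_cancel_right₀ _ hq,
    Int.ceil_intCast, Int.ceil_intCast, max_eq_left (by omega)] at h2
  rw [Int.card_Ico] at h1
  rw [card_primeTo]
  have h3 : ((v * p - u * p).toNat : ℤ) = v * p - u * p :=
    Int.toNat_of_nonneg (by nlinarith)
  zify at h1
  rw [h2, h3] at h1
  have h4 := eq_sub_of_add_eq' h1
  calc _ = _ := by congr!
    _ = _ := h4
    _ = _ := by ring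

variable {k : Type u} [Field k] {p : ℕ} [Fact p.Prime] [CharP k p]

open Classical in
/-- The coefficients of a twisted arc can be prescribed. -/
theorem exists_twistedArc_coeff {S : ℤ} {cf ca cb : ℤ → k} (hf : ∀ i < -(p * S), cf i = 0)
    (hf' : ∀ i, (p : ℤ) ∣ i → cf i = 0) :
    ∃ γ : TwistedArc k p, (∀ i, γ.f.coeff i = cf i) ∧
      (∀ i, γ.a.coeff i = if γ.s ≤ i then ca i else 0) ∧
      ∀ i, γ.b.coeff i = if 0 ≤ i then cb i else 0 := by
  obtain ⟨f, hf⟩ := exists_laurent hf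
  obtain ⟨a, ha⟩ := exists_laurent (c := fun i => if poleOrder p f ≤ i then ca i else 0)
    (A := poleOrder p f) fun i hi => if_neg (by omega)
  obtain ⟨b, hb⟩ := exists_laurent (c := fun i => if 0 ≤ i then cb i else 0) (A := 0)
    fun i hi => if_neg (by omega)
  obtain ⟨γ, rfl, rfl, rfl⟩ := exists_twistedArc (p := p) (f := f) (a := a) (b := b)
    (fun i hi => by rw [hf, hf' i hi]) (fun i hi => by rw [ha, if_neg (by omega)])
    (fun i hi => by rw [hb, if_neg (by omega)])
  exact ⟨γ, hf, ha, hb⟩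

variable (k p) in
/-- The level `(m, n, j)` of the system `twistedSystem`. -/
def twistedLevel (m n j : ℕ) : (twistedSystem k p).Level := (m, n, j)

variable (k p) in
/-- The level `m` of the system `quotientSystem`. -/
def quotientLevel (m : ℕ) : (quotientSystem k p).Level := m

/-- The truncation of twisted arcs at the level `(m, n, j)`. -/
def TwistedArc.trunc (γ : TwistedArc k p) (m n j : ℕ) :
    PrimeTo p (-j) (n * p) ⊕ Fin (m + 1) ⊕ Fin (m + 1) → k :=
  Sum.elim (fun i => γ.f.coeff i)
    (Sum.elim (fun i => γ.a.coeff (γ.s + (i : ℕ))) (fun i => γ.b.coeff ((i : ℕ) : ℤ)))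

/-- The truncation of arcs of `V/G` at the level `m`. -/
def QuotientArc.trunc (δ : QuotientArc k p) (m : ℕ) (i : Fin 2 × Fin (m + 1)) : k :=
  (QuotientArc.coord δ i.1).coeff ((i.2 : ℕ) : ℤ)

open Classical in
theorem twistedSystem_surjective (l : (twistedSystem k p).Level)
    (u : (twistedSystem k p).Coord l → k) :
    ∃ γ ∈ (twistedSystem k p).domain l, (twistedSystem k p).trunc l γ = u := by
  obtain ⟨m, n, j⟩ := l
  have hp : (0 : ℤ) < p := by exact_mod_cast (Fact.out : p.Prime).pos
  let cf : ℤ → k := fun i => if h : -(j : ℤ) ≤ i ∧ i < n * p ∧ ¬ (p : ℤ) ∣ i then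
    u (Sum.inl ⟨i, h⟩) else 0
  let ext : (Fin (m + 1) → k) → ℤ → k := fun v i =>
    if h : i.toNat < m + 1 then v ⟨i.toNat, h⟩ else 0
  have hcf : ∀ i < -(j : ℤ), cf i = 0 := fun i hi => dif_neg (by omega)
  obtain ⟨γ, hf, ha, hb⟩ := exists_twistedArc_coeff (p := p) (S := j) (cf := cf)
    (ca := fun i => ext (fun i => u (Sum.inr (Sum.inl i))) i)
    (cb := ext fun i => u (Sum.inr (Sum.inr i))) (fun i hi => hcf i (by nlinarith))
    (fun i hi => dif_neg fun h => h.2.2 hi)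
  -- the coefficients of `a` start in degree `s`, which only now is known
  obtain ⟨γ', hf', ha', hb'⟩ := exists_twistedArc_coeff (p := p) (S := j) (cf := cf)
    (ca := fun i => ext (fun i => u (Sum.inr (Sum.inl i))) (i - γ.s))
    (cb := ext fun i => u (Sum.inr (Sum.inr i))) (fun i hi => hcf i (by nlinarith))
    (fun i hi => dif_neg fun h => h.2.2 hi)
  have hs : γ'.s = γ.s := by
    rw [TwistedArc.s_eq, TwistedArc.s_eq]
    congr 1
    ext i
    rw [hf, hf']
  refine ⟨γ', fun i hi => (hf' i).trans (hcf i hi), ?_⟩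
  ext (⟨i, hi⟩ | i | i)
  · exact (hf' i).trans (dif_pos hi)
  · change γ'.a.coeff (γ'.s + (i : ℕ)) = _
    rw [ha', if_pos (by omega), hs, add_sub_cancel_left]
    exact dif_pos (by rw [Int.toNat_natCast]; exact i.2)
  · change γ'.b.coeff ((i : ℕ) : ℤ) = _
    rw [hb', if_pos (by omega)]
    exact dif_pos (by rw [Int.toNat_natCast]; exact i.2)

variable [IsAlgClosed k]

theorem quotientSystem_surjective (l : (quotientSystem k p).Level)
    (u : (quotientSystem k p).Coord l → k) :
    ∃ δ ∈ (quotientSystem k p).domain l, (quotientSystem k p).trunc l δ = u := by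
  have ⟨m, hm⟩ : ∃ m : ℕ, quotientLevel k p m = l := ⟨l, rfl⟩
  subst hm
  obtain ⟨δ, hδ⟩ := exists_quotientArc (p := p) fun i => PowerSeries.mk fun n =>
    if h : n < m + 1 then u (i, ⟨n, h⟩) else (0 : k)
  refine ⟨δ, trivial, ?_⟩
  ext ⟨i, n⟩
  change PowerSeries.coeff _ (δ (invariantGen k p i)) = _
  rw [hδ, PowerSeries.coeff_mk]
  exact dif_pos n.2

variable {τ ν : Type} [Finite τ] [Finite ν]

/-- A set of twisted arcs defined by the vanishing of some coefficients of the truncation and a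
constructible condition on some others is a cylinder, the class of which is known. -/
theorem isCylinder_twisted {m n j : ℕ} {c : ℤ} {W : Set (τ → k)} (hW : IsConstructibleSet W)
    {β : τ ⊕ ν → PrimeTo p (-j) (n * p) ⊕ Fin (m + 1) ⊕ Fin (m + 1)} (hβ : Function.Injective β)
    (hc : (Nat.card (PrimeTo p (-j) (n * p) ⊕ Fin (m + 1) ⊕ Fin (m + 1)) : ℤ) =
      Nat.card τ + Nat.card ν + c) {C : Set (TwistedArc k p)}
    (hC : ∀ γ, γ ∈ C ↔ (∀ i : ℤ, i < -(j : ℤ) → γ.f.coeff i = 0) ∧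
      (∀ i, γ.trunc m n j (β (Sum.inr i)) = 0) ∧
        (fun i => γ.trunc m n j (β (Sum.inl i))) ∈ W) :
    IsCylinder (twistedSystem k p) (twistedLevel k p m n j) C ∧
      ClassShift c W ((twistedSystem k p).trunc (twistedLevel k p m n j) '' C) := by
  have := (twistedSystem k p).finite_coord (twistedLevel k p m n j)
  have hsh := ClassShift.of_coordinates (κ := (twistedSystem k p).Coord (twistedLevel k p m n j))
    hW hβ hc
  have hC' : ∀ γ, γ ∈ C ↔ γ ∈ (twistedSystem k p).domain (twistedLevel k p m n j) ∧
      (twistedSystem k p).trunc (twistedLevel k p m n j) γ ∈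
        {u | (∀ i, u (β (Sum.inr i)) = 0) ∧ (fun i => u (β (Sum.inl i))) ∈ W} := hC
  refine ⟨isCylinder_of_mem_iff (twistedSystem_surjective _) hsh.right hC', ?_⟩
  rwa [image_trunc_eq (twistedSystem_surjective _) hC']

/-- A set of arcs of `V/G` defined by the vanishing of some coefficients of the truncation and a
constructible condition on some others is a cylinder, the class of which is known. -/
theorem isCylinder_quotient {m : ℕ} {c : ℤ} {W : Set (τ → k)} (hW : IsConstructibleSet W)
    {β : τ ⊕ ν → Fin 2 × Fin (m + 1)} (hβ : Function.Injective β)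
    (hc : (Nat.card (Fin 2 × Fin (m + 1)) : ℤ) = Nat.card τ + Nat.card ν + c)
    {C : Set (QuotientArc k p)}
    (hC : ∀ δ : QuotientArc k p, δ ∈ C ↔ (∀ i, δ.trunc m (β (Sum.inr i)) = 0) ∧
      (fun i => δ.trunc m (β (Sum.inl i))) ∈ W) :
    IsCylinder (quotientSystem k p) (quotientLevel k p m) C ∧
      ClassShift c W ((quotientSystem k p).trunc (quotientLevel k p m) '' C) := by
  have := (quotientSystem k p).finite_coord (quotientLevel k p m)
  have hsh := ClassShift.of_coordinates (κ := (quotientSystem k p).Coord (quotientLevel k p m))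
    hW hβ hc
  have hC' : ∀ δ, δ ∈ C ↔ δ ∈ (quotientSystem k p).domain (quotientLevel k p m) ∧
      (quotientSystem k p).trunc (quotientLevel k p m) δ ∈
        {u | (∀ i, u (β (Sum.inr i)) = 0) ∧ (fun i => u (β (Sum.inl i))) ∈ W} := by
    intro δ
    have h : (quotientSystem k p).trunc (quotientLevel k p m) δ = δ.trunc m := by
      ext i
      exact (coord_coeff _ _ _).symm
    rw [hC, h]
    exact ⟨fun h => ⟨trivial, h⟩, fun h => h.2⟩
  refine ⟨isCylinder_of_mem_iff (quotientSystem_surjective _) hsh.right hC', ?_⟩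
  rwa [image_trunc_eq (quotientSystem_surjective _) hC']

theorem twistedSystem_refines {m n j m' n' j' : ℕ} (hm : m ≤ m') (hn : n ≤ n') (hj : j ≤ j') :
    Refines (twistedSystem k p) (twistedLevel k p m n j) (twistedLevel k p m' n' j') := by
  intro C hC
  have hp : (0 : ℤ) < p := by exact_mod_cast (Fact.out : p.Prime).pos
  have := (twistedSystem k p).finite_coord (twistedLevel k p m n j)
  have hnp : (n : ℤ) * p ≤ n' * p := by gcongr
  have hnp' : (0 : ℤ) ≤ n * p := by positivity
  have hm1 : m + 1 ≤ m' + 1 := by omega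
  let β : (PrimeTo p (-j) (n * p) ⊕ Fin (m + 1) ⊕ Fin (m + 1)) ⊕ PrimeTo p (-j') (-j) →
      PrimeTo p (-j') (n' * p) ⊕ Fin (m' + 1) ⊕ Fin (m' + 1) := Sum.elim
    (Sum.elim (fun i => Sum.inl ⟨i.1, by have := i.2.1; omega, i.2.2.1.trans_le hnp, i.2.2.2⟩)
      (Sum.elim (fun i => Sum.inr (Sum.inl (Fin.castLE hm1 i)))
        fun i => Sum.inr (Sum.inr (Fin.castLE hm1 i))))
    fun i => Sum.inl ⟨i.1, i.2.1, by have := i.2.2.1; omega, i.2.2.2⟩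
  have hβ : Function.Injective β := by
    rintro ((⟨i, hi⟩ | i | i) | ⟨i, hi⟩) ((⟨i', hi'⟩ | i' | i') | ⟨i', hi'⟩) h
    all_goals simp only [β, Sum.elim_inl, Sum.elim_inr, Sum.inl.injEq, Sum.inr.injEq,
      Subtype.mk.injEq, reduceCtorEq, Fin.castLE_inj] at h
    · simp [h]
    · omega
    · simp [h]
    · simp [h]
    · omega
    · simp [h]
  refine isCylinder_twisted (τ := (twistedSystem k p).Coord (twistedLevel k p m n j)) hC.2.2 hβ
    ?_ fun γ => ?_
  · change (Nat.card (PrimeTo p (-j') (n' * p) ⊕ Fin (m' + 1) ⊕ Fin (m' + 1)) : ℤ) =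
      Nat.card (PrimeTo p (-j) (n * p) ⊕ Fin (m + 1) ⊕ Fin (m + 1)) + _ +
        (2 * m' + (p - 1) * n' - (2 * m + (p - 1) * n))
    have h1 := card_primeTo_add p (u := -j') (v := -j) (w := n' * p) (by omega) (by omega)
    have h2 := card_primeTo_add p (u := -j) (v := n * p) (w := n' * p) (by omega) (by omega)
    have h3 := card_primeTo_mul p (u := n) (v := n') (by omega)
    simp only [Nat.card_sum, Nat.card_fin]
    push_cast
    rw [h1, h2]
    push_cast
    rw [h3]
    ring
  · have h1 : (fun i => γ.trunc m' n' j' (β (Sum.inl i))) =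
        (twistedSystem k p).trunc (twistedLevel k p m n j) γ := by
      ext (i | i | i) <;> rfl
    refine hC.mem_iff.trans ?_
    change _ ↔ _ ∧ _ ∧ (fun i => γ.trunc m' n' j' (β (Sum.inl i))) ∈ _
    rw [h1, ← and_assoc]
    refine and_congr_left fun _ => ⟨fun h => ⟨fun i hi => h i ?_, fun i => h i.1 i.2.2.1⟩, ?_⟩
    · change i < -(j : ℤ)
      omega
    · rintro ⟨h, h'⟩ i hi
      replace hi : i < -(j : ℤ) := hi
      by_cases hpi : (p : ℤ) ∣ i
      · exact γ.mem_deltaG i hpi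
      · by_cases hij : i < -(j' : ℤ)
        · exact h i hij
        · exact h' ⟨i, by omega, hi, hpi⟩

theorem isRegularSystem_twistedSystem : IsRegularSystem (twistedSystem k p) where
  surjective := twistedSystem_surjective
  directed := fun (m, n, j) (m', n', j') => ⟨twistedLevel k p (max m m') (max n n') (max j j'),
    twistedSystem_refines (le_max_left _ _) (le_max_left _ _) (le_max_left _ _),
    twistedSystem_refines (le_max_right _ _) (le_max_right _ _) (le_max_right _ _)⟩
  nonempty := ⟨twistedLevel k p 0 0 0⟩

theorem quotientSystem_refines {m m' : ℕ} (hm : m ≤ m') :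
    Refines (quotientSystem k p) (quotientLevel k p m) (quotientLevel k p m') := by
  intro C hC
  have := (quotientSystem k p).finite_coord (quotientLevel k p m)
  have hm1 : m + 1 ≤ m' + 1 := by omega
  let β : (Fin 2 × Fin (m + 1)) ⊕ Empty → Fin 2 × Fin (m' + 1) :=
    Sum.elim (fun i => (i.1, Fin.castLE hm1 i.2)) Empty.elim
  have hβ : Function.Injective β := by
    rintro (⟨i, j⟩ | i) (⟨i', j'⟩ | i') h
    · simp only [β, Sum.elim_inl, Prod.mk.injEq, Fin.castLE_inj] at h
      rw [h.1, h.2]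
    all_goals exact Empty.elim ‹_›
  refine isCylinder_quotient (τ := (quotientSystem k p).Coord (quotientLevel k p m)) hC.2.2 hβ
    ?_ fun δ => ?_
  · change (Nat.card (Fin 2 × Fin (m' + 1)) : ℤ) = Nat.card (Fin 2 × Fin (m + 1)) + _ +
      (2 * m' - 2 * m)
    simp only [Nat.card_prod, Nat.card_fin, Nat.card_of_isEmpty]
    push_cast
    ring
  · have h1 : (fun i => δ.trunc m' (β (Sum.inl i))) =
        (quotientSystem k p).trunc (quotientLevel k p m) δ := by
      ext i
      exact coord_coeff _ _ _
    refine hC.mem_iff.trans ?_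
    change _ ↔ _ ∧ (fun i => δ.trunc m' (β (Sum.inl i))) ∈ _
    rw [h1]
    exact ⟨fun h => ⟨fun i => i.elim, h.2⟩, fun h => ⟨trivial, h.2⟩⟩

theorem isRegularSystem_quotientSystem : IsRegularSystem (quotientSystem k p) where
  surjective := quotientSystem_surjective
  directed := fun (m : ℕ) (m' : ℕ) => ⟨quotientLevel k p (max m m'),
    quotientSystem_refines (le_max_left _ _), quotientSystem_refines (le_max_right _ _)⟩
  nonempty := ⟨quotientLevel k p 0⟩

/-- The arcs of `V/G` with `ord(x)` large form a set of small dimension. -/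
theorem dimLE_ordX_quotient (n : ℕ) :
    DimLE (quotientSystem k p) {δ | ∀ i < (n + 1 : ℤ), (QuotientArc.coord δ 0).coeff i = 0}
      (1 - n) := by
  let β : Fin (n + 1) ⊕ Fin (n + 1) → Fin 2 × Fin (n + 1) :=
    Sum.elim (fun i => (1, i)) fun i => (0, i)
  have hβ : Function.Injective β := by
    rintro (i | i) (i' | i') h <;> simp_all [β]
  obtain ⟨hC, hsh⟩ := isCylinder_quotient (c := 0) (isConstructibleSet_univ (k := k)) hβ (by
      simp only [Nat.card_prod, Nat.card_fin]
      push_cast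
      ring)
    (C := {δ : QuotientArc k p | ∀ i < (n + 1 : ℤ), (QuotientArc.coord δ 0).coeff i = 0})
    fun δ => by
      refine ⟨fun h => ⟨fun i => h (i : ℕ) (by omega), trivial⟩, fun h i hi => ?_⟩
      rcases lt_or_ge i 0 with h0 | h0
      · exact coord_coeff_of_neg δ 0 i h0
      · lift i to ℕ using h0
        exact h.1 ⟨i, by omega⟩
  refine ⟨_, _, hC, subset_rfl, ?_⟩
  rw [cylinderDimLE_iff]
  refine DimBound.mono ((hsh.dimBound_iff _).mp (dimBound_card _)) subset_rfl ?_
  change (Nat.card (Fin (n + 1)) : ℤ) + 0 ≤ 1 - n + 2 * n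
  rw [Nat.card_fin]
  push_cast
  omega

/-- The twisted arcs with `s` bounded and `ord(x)` large form a set of small dimension. -/
theorem dimLE_ordX_twisted (S n : ℕ) :
    DimLE (twistedSystem k p) {γ | γ.s ≤ S ∧ ∀ i < (S + n + 1 : ℤ), γ.a.coeff i = 0}
      ((p - 1) * S + 1 - n) := by
  let β : (PrimeTo p (-(S * p : ℕ)) ((0 : ℕ) * p) ⊕ Fin (n + 1)) ⊕ Fin (n + 1) →
      PrimeTo p (-(S * p : ℕ)) ((0 : ℕ) * p) ⊕ Fin (n + 1) ⊕ Fin (n + 1) :=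
    Sum.elim (Sum.elim (fun i => Sum.inl i) fun i => Sum.inr (Sum.inr i))
      fun i => Sum.inr (Sum.inl i)
  have hβ : Function.Injective β := by
    rintro ((i | i) | i) ((i' | i') | i') h <;> simp_all [β]
  obtain ⟨hC, hsh⟩ := isCylinder_twisted (c := 0) (isConstructibleSet_univ (k := k)) hβ (by
      simp only [Nat.card_sum, Nat.card_fin]
      push_cast
      ring) (C := {γ : TwistedArc k p | (∀ i : ℤ, i < -((S * p : ℕ) : ℤ) → γ.f.coeff i = 0) ∧
        (∀ i, γ.trunc n 0 (S * p) (β (Sum.inr i)) = 0) ∧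
          (fun i => γ.trunc n 0 (S * p) (β (Sum.inl i))) ∈ Set.univ}) fun γ => Iff.rfl
  refine ⟨_, _, hC, ?_, ?_⟩
  · rintro γ ⟨hs, ha⟩
    refine ⟨fun i hi => (poleOrder_le_iff.mp hs).2 i ?_, fun i => ha _ (by omega), trivial⟩
    push_cast at hi
    linarith
  · rw [cylinderDimLE_iff]
    refine DimBound.mono ((hsh.dimBound_iff _).mp (dimBound_card _)) subset_rfl ?_
    change (Nat.card (PrimeTo p (-(S * p : ℕ)) ((0 : ℕ) * p) ⊕ Fin (n + 1)) : ℤ) + 0 ≤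
      (p - 1) * S + 1 - n + (2 * n + (p - 1) * (0 : ℕ))
    have := card_primeTo_mul p (u := -S) (v := 0) (by omega)
    rw [Nat.card_sum, Nat.card_fin, Nat.cast_mul, ← neg_mul, Nat.cast_zero]
    push_cast
    rw [this]
    linarith

end Systems

/-! ### The map on coefficients -/

section Strata

variable {k : Type u} [Field k] {p : ℕ} [Fact p.Prime] [CharP k p] {e s n : ℕ}

variable (p) in
/-- The index set of the coefficients of `f`, `a` and `b` that matter for the twisted arcs
`γ = (f, a, b)` with `s(γ) = s` and `ord(a) = e`, up to the precision `n`. The bounds are such that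
the coefficients of `a` and of `b ^ p + f a ^ p` in degrees less than `p (e + n)` depend only on
the coefficients with these indices. -/
abbrev CoeffIndex (e s n : ℕ) : Type :=
  PrimeTo p (-((p * s : ℕ) : ℤ)) (n * p) ⊕ IntIco e (p * (e + n)) ⊕ IntIco 0 (e + n)

open Classical in
variable (k p) in
/-- The coefficient of `f` in degree `i` as a coordinate function, zero outside the range of
`CoeffIndex`. -/
def coeffF (e s n : ℕ) (i : ℤ) : MvPolynomial (CoeffIndex p e s n) k :=
  if h : -((p * s : ℕ) : ℤ) ≤ i ∧ i < n * p ∧ ¬ (p : ℤ) ∣ i then MvPolynomial.X (Sum.inl ⟨i, h⟩)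
  else 0

open Classical in
variable (k p) in
/-- The coefficient of `a` in degree `i` as a coordinate function, zero outside the range of
`CoeffIndex`. -/
def coeffA (e s n : ℕ) (i : ℤ) : MvPolynomial (CoeffIndex p e s n) k :=
  if h : (e : ℤ) ≤ i ∧ i < p * (e + n) then MvPolynomial.X (Sum.inr (Sum.inl ⟨i, h⟩)) else 0

open Classical in
variable (k p) in
/-- The coefficient of `b` in degree `i` as a coordinate function, zero outside the range of
`CoeffIndex`. -/
def coeffB (e s n : ℕ) (i : ℤ) : MvPolynomial (CoeffIndex p e s n) k :=
  if h : (0 : ℤ) ≤ i ∧ i < e + n then MvPolynomial.X (Sum.inr (Sum.inr ⟨i, h⟩)) else 0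

variable (k p) in
/-- The map `(f, a, b) ↦ (a, b ^ p + f a ^ p)` on coefficients. The coefficient of `y ^ p` in degree
`j + p e`, for `j` prime to `p`, is put in the place of the coefficient of `f` in degree `j`, and
its coefficient in degree `p i` is put in the place of the coefficient of `b` in degree `i`. -/
def coeffMap (e s n : ℕ) : CoeffIndex p e s n → MvPolynomial (CoeffIndex p e s n) k :=
  Sum.elim
    (fun j => ∑ r ∈ Finset.Ico (e : ℤ) (p * (e + n)),
      coeffA k p e s n r ^ p * coeffF k p e s n (j - p * (r - e)))
    (Sum.elim (fun i => MvPolynomial.X (Sum.inr (Sum.inl i)))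
      fun i => MvPolynomial.X (Sum.inr (Sum.inr i)) ^ p)

/-- The coefficients of a twisted arc. -/
def TwistedArc.coeffs (γ : TwistedArc k p) (e s n : ℕ) : CoeffIndex p e s n → k :=
  Sum.elim (fun j => γ.f.coeff j) (Sum.elim (fun i => γ.a.coeff i) fun i => γ.b.coeff i)

/-- The coefficients of an arc of the quotient, indexed as in `coeffMap`. -/
def QuotientArc.coeffs (δ : QuotientArc k p) (e s n : ℕ) : CoeffIndex p e s n → k :=
  Sum.elim (fun j => (QuotientArc.coord δ 1).coeff (j + p * e))
    (Sum.elim (fun i => (QuotientArc.coord δ 0).coeff i)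
      fun i => (QuotientArc.coord δ 1).coeff (p * i))

variable (k p) in
/-- The twisted arcs `γ` with `s(γ) ≤ s` and `ord(a) ≥ e`. -/
def arcDomain (e s : ℕ) : Set (TwistedArc k p) :=
  {γ | (∀ i < -((p * s : ℕ) : ℤ), γ.f.coeff i = 0) ∧ ∀ i < (e : ℤ), γ.a.coeff i = 0}

variable (k p) in
/-- A set of arcs of the quotient that contains the image of `arcDomain`. Where the coefficient of
`x` in degree `e` is not zero it is equal to this image, by `exists_arcDomain_psi_eq`. -/
def quotientDomain (e s : ℕ) : Set (QuotientArc k p) :=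
  {δ | (∀ i < (e : ℤ), (QuotientArc.coord δ 0).coeff i = 0) ∧
    ∀ i : ℤ, i < p * (e - s) → ¬ (p : ℤ) ∣ i → (QuotientArc.coord δ 1).coeff i = 0}

omit [CharP k p] in
theorem eval_coeffF_of_mem (v : CoeffIndex p e s n → k) {i : ℤ}
    (h : -((p * s : ℕ) : ℤ) ≤ i ∧ i < n * p ∧ ¬ (p : ℤ) ∣ i) :
    MvPolynomial.eval v (coeffF k p e s n i) = v (Sum.inl ⟨i, h⟩) := by
  rw [coeffF, dif_pos h, MvPolynomial.eval_X]

omit [CharP k p] in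
theorem eval_coeffA_of_mem (v : CoeffIndex p e s n → k) {i : ℤ}
    (h : (e : ℤ) ≤ i ∧ i < p * (e + n)) :
    MvPolynomial.eval v (coeffA k p e s n i) = v (Sum.inr (Sum.inl ⟨i, h⟩)) := by
  rw [coeffA, dif_pos h, MvPolynomial.eval_X]

omit [CharP k p] in
theorem eval_coeffB_of_mem (v : CoeffIndex p e s n → k) {i : ℤ} (h : (0 : ℤ) ≤ i ∧ i < e + n) :
    MvPolynomial.eval v (coeffB k p e s n i) = v (Sum.inr (Sum.inr ⟨i, h⟩)) := by
  rw [coeffB, dif_pos h, MvPolynomial.eval_X]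

theorem eval_coeffF {γ : TwistedArc k p} (hγ : γ ∈ arcDomain k p e s) {i : ℤ} (hi : i < n * p) :
    MvPolynomial.eval (γ.coeffs e s n) (coeffF k p e s n i) = γ.f.coeff i := by
  by_cases h : -((p * s : ℕ) : ℤ) ≤ i ∧ i < n * p ∧ ¬ (p : ℤ) ∣ i
  · exact eval_coeffF_of_mem _ h
  · rw [coeffF, dif_neg h, map_zero]
    by_cases hpi : (p : ℤ) ∣ i
    · exact (γ.mem_deltaG i hpi).symm
    · exact (hγ.1 i (by by_contra h'; exact h ⟨by omega, hi, hpi⟩)).symm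

theorem eval_coeffA {γ : TwistedArc k p} (hγ : γ ∈ arcDomain k p e s) {i : ℤ}
    (hi : i < p * (e + n)) :
    MvPolynomial.eval (γ.coeffs e s n) (coeffA k p e s n i) = γ.a.coeff i := by
  by_cases h : (e : ℤ) ≤ i ∧ i < p * (e + n)
  · exact eval_coeffA_of_mem _ h
  · rw [coeffA, dif_neg h, map_zero]
    exact (hγ.2 i (by by_contra h'; exact h ⟨by omega, hi⟩)).symm

theorem eval_coeffB (γ : TwistedArc k p) {i : ℤ} (hi : i < e + n) :
    MvPolynomial.eval (γ.coeffs e s n) (coeffB k p e s n i) = γ.b.coeff i := by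
  by_cases h : (0 : ℤ) ≤ i ∧ i < e + n
  · exact eval_coeffB_of_mem _ h
  · rw [coeffB, dif_neg h, map_zero]
    exact (γ.b_coeff i (by by_contra h'; exact h ⟨by omega, hi⟩)).symm

/-- Only the coefficients of `a ^ p` in degrees divisible by `p` contribute to `f a ^ p`. -/
theorem laurent_coeff_mul_pow {f a : LaurentSeries k} {A B C N : ℤ} (hf : ∀ i < B, f.coeff i = 0)
    (ha : ∀ i < A, a.coeff i = 0) (hC : N - B < p * C) :
    (f * a ^ p).coeff N = ∑ r ∈ Finset.Ico A C, a.coeff r ^ p * f.coeff (N - p * r) := by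
  have hp : (0 : ℤ) < p := by exact_mod_cast (Fact.out : p.Prime).pos
  rw [mul_comm f, laurent_coeff_mul (laurent_coeff_pow_eq_zero ha p) hf hC]
  symm
  refine Finset.sum_bij_ne_zero (fun r _ _ => p * r) ?_ ?_ ?_ ?_
  · intro r hr _
    rw [Finset.mem_Ico] at hr ⊢
    exact ⟨by nlinarith, by nlinarith⟩
  · intro r _ _ r' _ _ h
    exact mul_left_cancel₀ hp.ne' h
  · intro i hi hne
    by_cases hpi : (p : ℤ) ∣ i
    · obtain ⟨r, rfl⟩ := hpi
      rw [Finset.mem_Ico, mul_le_mul_iff_right₀ hp, mul_lt_mul_iff_right₀ hp] at hi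
      refine ⟨r, Finset.mem_Ico.mpr hi, ?_, rfl⟩
      rwa [laurent_coeff_pow_mul] at hne
    · rw [laurent_coeff_pow_of_not_dvd p a hpi, zero_mul] at hne
      exact absurd rfl hne
  · intro r _ _
    rw [laurent_coeff_pow_mul]

variable (p) in
/-- The sum defining `coeffMap` is long enough, and it contains the leading coefficient of `a`. -/
theorem add_lt_mul_add (hse : s ≤ e) (hn : 1 ≤ n) :
    (e + n + s : ℤ) ≤ p * (e + n) ∧ (e : ℤ) < p * (e + n) := by
  have hp : (2 : ℤ) ≤ p := by exact_mod_cast (Fact.out : p.Prime).two_le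
  constructor <;> nlinarith

variable [IsAlgClosed k]

theorem psi_mem_quotientDomain {γ : TwistedArc k p} (hγ : γ ∈ arcDomain k p e s) :
    psi γ ∈ quotientDomain k p e s := by
  refine ⟨fun i hi => by rw [coord_psi_zero]; exact hγ.2 i hi, fun i hi hpi => ?_⟩
  rw [coord_psi_coeff_of_not_dvd γ hpi]
  refine laurent_coeff_mul_eq_zero hγ.1 (laurent_coeff_pow_eq_zero hγ.2 p) ?_
  push_cast
  linarith

/-- On coefficients, the map `ψ` is given by the polynomials `coeffMap`. -/
theorem coeffs_psi (hse : s ≤ e) (hn : 1 ≤ n) {γ : TwistedArc k p} (hγ : γ ∈ arcDomain k p e s) :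
    (psi γ).coeffs e s n =
      fun i => MvPolynomial.eval (γ.coeffs e s n) (coeffMap k p e s n i) := by
  have hp : (0 : ℤ) < p := by exact_mod_cast (Fact.out : p.Prime).pos
  obtain ⟨h1, h2⟩ := add_lt_mul_add p hse hn
  ext (j | i | i)
  · have hj : ¬ (p : ℤ) ∣ j + p * e :=
      fun h => j.2.2.2 ((Int.dvd_add_left (dvd_mul_right _ _)).mp h)
    change (QuotientArc.coord (psi γ) 1).coeff (j + p * e) = MvPolynomial.eval (γ.coeffs e s n)
      (∑ r ∈ Finset.Ico (e : ℤ) (p * (e + n)),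
        coeffA k p e s n r ^ p * coeffF k p e s n (j - p * (r - e)))
    rw [coord_psi_coeff_of_not_dvd γ hj, laurent_coeff_mul_pow hγ.1 hγ.2 (C := p * (e + n)),
      map_sum]
    · refine Finset.sum_congr rfl fun r hr => ?_
      rw [Finset.mem_Ico] at hr
      rw [map_mul, map_pow, eval_coeffA hγ hr.2, eval_coeffF hγ]
      · congr 2
        ring
      · have := j.2.2.1
        nlinarith
    · have := j.2.2.1
      push_cast
      nlinarith
  · change (QuotientArc.coord (psi γ) 0).coeff i =
      MvPolynomial.eval _ (MvPolynomial.X (Sum.inr (Sum.inl i)))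
    rw [coord_psi_zero, MvPolynomial.eval_X]
    rfl
  · change (QuotientArc.coord (psi γ) 1).coeff (p * i) =
      MvPolynomial.eval _ (MvPolynomial.X (Sum.inr (Sum.inr i)) ^ p)
    rw [coord_psi_coeff_mul, map_pow, MvPolynomial.eval_X]
    rfl

/-- Arcs of the quotient can be prescribed by their coefficients. -/
theorem exists_quotient_coeffs (hse : s ≤ e) (v : CoeffIndex p e s n → k) :
    ∃ δ ∈ quotientDomain k p e s, δ.coeffs e s n = v := by
  classical
  have hp : (0 : ℤ) < p := by exact_mod_cast (Fact.out : p.Prime).pos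
  obtain ⟨x, hx⟩ := exists_laurent (c := fun i => MvPolynomial.eval v (coeffA k p e s n i)) (A := e)
    fun i hi => by rw [coeffA, dif_neg (by omega), map_zero]
  have hw : ∀ i : ℤ, i < p * (e - s) → ¬ (p : ℤ) ∣ i →
      MvPolynomial.eval v (coeffF k p e s n (i - p * e)) = 0 := by
    intro i hi _
    rw [coeffF, dif_neg, map_zero]
    push_cast
    intro h
    linarith [h.1]
  obtain ⟨w, hw'⟩ := exists_laurent (c := fun i => if (p : ℤ) ∣ i then
    MvPolynomial.eval v (coeffB k p e s n (i / p))
    else MvPolynomial.eval v (coeffF k p e s n (i - p * e))) (A := 0) fun i hi => by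
      split_ifs with h
      · rw [coeffB, dif_neg, map_zero]
        have := Int.ediv_neg_of_neg_of_pos hi hp
        omega
      · exact hw i (by nlinarith [Int.ofNat_le.mpr hse]) h
  obtain ⟨δ, hδ0, hδ1⟩ := exists_coord (p := p) (x := x) (w := w)
    (fun i hi => by rw [hx, coeffA, dif_neg (by omega), map_zero])
    (fun i hi => by
      rw [hw']
      split_ifs with h
      · rw [coeffB, dif_neg, map_zero]
        have := Int.ediv_neg_of_neg_of_pos hi hp
        omega
      · exact hw i (by nlinarith [Int.ofNat_le.mpr hse]) h)
  refine ⟨δ, ⟨fun i hi => ?_, fun i hi hpi => ?_⟩, ?_⟩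
  · rw [hδ0, hx, coeffA, dif_neg (by omega), map_zero]
  · rw [hδ1, hw', if_neg hpi, hw i hi hpi]
  · ext (j | i | i)
    · change (QuotientArc.coord δ 1).coeff (j + p * e) = _
      rw [hδ1, hw', if_neg fun h => j.2.2.2 ((Int.dvd_add_left (dvd_mul_right _ _)).mp h),
        add_sub_cancel_right, eval_coeffF_of_mem v j.2]
    · change (QuotientArc.coord δ 0).coeff i = _
      rw [hδ0, hx, eval_coeffA_of_mem v i.2]
    · change (QuotientArc.coord δ 1).coeff (p * i) = _
      rw [hδ1, hw', if_pos (dvd_mul_right _ _), Int.mul_ediv_cancel_left _ hp.ne',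
        eval_coeffB_of_mem v i.2]

/-- Twisted arcs can be prescribed by their coefficients. -/
theorem exists_twisted_coeffs (hse : s ≤ e) (v : CoeffIndex p e s n → k) :
    ∃ γ ∈ arcDomain k p e s, γ.coeffs e s n = v := by
  classical
  obtain ⟨γ, hf, ha, hb⟩ := exists_twistedArc_coeff (p := p) (S := s)
    (cf := fun i => MvPolynomial.eval v (coeffF k p e s n i))
    (ca := fun i => MvPolynomial.eval v (coeffA k p e s n i))
    (cb := fun i => MvPolynomial.eval v (coeffB k p e s n i))
    (fun i hi => by rw [coeffF, dif_neg (by push_cast; omega), map_zero])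
    (fun i hi => by rw [coeffF, dif_neg (by tauto), map_zero])
  have hf0 : ∀ i < -((p * s : ℕ) : ℤ), γ.f.coeff i = 0 := fun i hi => by
    rw [hf, coeffF, dif_neg (by omega), map_zero]
  have hs : γ.s ≤ s := poleOrder_le_iff.mpr ⟨by omega, by exact_mod_cast hf0⟩
  refine ⟨γ, ⟨hf0, fun i hi => ?_⟩, ?_⟩
  · rw [ha, coeffA, dif_neg (by omega), map_zero, ite_self]
  · ext (j | i | i)
    · exact (hf j).trans (eval_coeffF_of_mem v j.2)
    · refine (ha i).trans ?_
      rw [if_pos (by have := i.2.1; omega), eval_coeffA_of_mem v i.2]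
    · refine (hb i).trans ?_
      rw [if_pos i.2.1, eval_coeffB_of_mem v i.2]

/-- If `ord(x) = e` and `f x ^ p` has no terms of degree less than `p (e - s)`, then `f` has none of
degree less than `-p s`. -/
theorem exists_arcDomain_psi_eq {δ : QuotientArc k p}
    (hδ : δ ∈ quotientDomain k p e s) (h0 : (QuotientArc.coord δ 0).coeff e ≠ 0) :
    ∃ γ ∈ arcDomain k p e s, psi γ = δ := by
  have hp : (0 : ℤ) < p := by exact_mod_cast (Fact.out : p.Prime).pos
  have hx : QuotientArc.coord δ 0 ≠ 0 := fun h => h0 (by rw [h]; rfl)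
  obtain ⟨γ, rfl, ha⟩ := exists_psi_eq hx
  have ha' := ha ▸ h0
  have ha0 : γ.a ≠ 0 := by rwa [ha]
  have hord : γ.a.order ≤ e := HahnSeries.order_le_of_coeff_ne_zero ha'
  refine ⟨γ, ⟨fun i hi => ?_, fun i hi => by rw [ha]; exact hδ.1 i hi⟩, rfl⟩
  rcases eq_or_ne γ.f 0 with hf | hf
  · rw [hf]; rfl
  refine HahnSeries.coeff_eq_zero_of_lt_order (hi.trans_le ?_)
  have h1 : (γ.f * γ.a ^ p).order = γ.f.order + p * γ.a.order := by
    rw [HahnSeries.order_mul hf (pow_ne_zero _ ha0), HahnSeries.order_pow, nsmul_eq_mul]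
  have h2 : (p : ℤ) * (e - s) ≤ (γ.f * γ.a ^ p).order := by
    by_contra hlt
    have h3 := HahnSeries.coeff_order_eq_zero.not.mpr (mul_ne_zero hf (pow_ne_zero p ha0))
    by_cases hd : (p : ℤ) ∣ (γ.f * γ.a ^ p).order
    · exact h3 (mul_pow_mem_deltaG γ.mem_deltaG γ.a _ hd)
    · rw [← coord_psi_coeff_of_not_dvd γ hd] at h3
      exact h3 (hδ.2 _ (by omega) hd)
  push_cast
  nlinarith

end Strata

/-! ### The map on coefficients where the leading coefficient is invertible -/

section Strata

variable {k : Type u} [Field k] {p : ℕ} [Fact p.Prime] {e s n : ℕ}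

variable (k p) in
/-- The leading coefficient of `a`, for twisted arcs with `ord(a) ≥ e`. -/
abbrev leadingCoeff (e s n : ℕ) : MvPolynomial (CoeffIndex p e s n) k := coeffA k p e s n e

theorem leadingCoeff_eq (hse : s ≤ e) (hn : 1 ≤ n) :
    leadingCoeff k p e s n =
      MvPolynomial.X (Sum.inr (Sum.inl ⟨e, le_rfl, (add_lt_mul_add p hse hn).2⟩)) := by
  rw [leadingCoeff, coeffA, dif_pos ⟨le_rfl, (add_lt_mul_add p hse hn).2⟩]

theorem bind₁_coeffMap_coeffA (i : ℤ) :
    MvPolynomial.bind₁ (coeffMap k p e s n) (coeffA k p e s n i) = coeffA k p e s n i := by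
  rw [coeffA]
  split_ifs with h
  · rw [MvPolynomial.bind₁_X_right]
    rfl
  · rw [map_zero]

variable (k p) in
/-- The endomorphism given by `coeffMap` of the ring of functions on the open set on which the
leading coefficient of `a` does not vanish. -/
def coeffEndo (e s n : ℕ) : Localization.Away (leadingCoeff k p e s n) →+*
    Localization.Away (leadingCoeff k p e s n) :=
  IsLocalization.Away.lift (leadingCoeff k p e s n)
    (g := (algebraMap _ _).comp (MvPolynomial.bind₁ (coeffMap k p e s n)).toRingHom) (by
      change IsUnit (algebraMap _ (Localization.Away (leadingCoeff k p e s n))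
        (MvPolynomial.bind₁ (coeffMap k p e s n) (coeffA k p e s n e)))
      rw [bind₁_coeffMap_coeffA]
      exact IsLocalization.Away.algebraMap_isUnit _)

theorem coeffEndo_algebraMap (P : MvPolynomial (CoeffIndex p e s n) k) :
    coeffEndo k p e s n (algebraMap _ _ P) =
      algebraMap _ _ (MvPolynomial.bind₁ (coeffMap k p e s n) P) :=
  IsLocalization.Away.lift_eq _ _ P

/-- The inverse of the leading coefficient is fixed by `coeffEndo`, as the leading coefficient
is. -/
theorem invSelf_mem_range : IsLocalization.Away.invSelf (leadingCoeff k p e s n) ∈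
    (coeffEndo k p e s n).range := by
  let a := algebraMap _ (Localization.Away (leadingCoeff k p e s n)) (leadingCoeff k p e s n)
  have h1 : a * IsLocalization.Away.invSelf (leadingCoeff k p e s n) = 1 :=
    IsLocalization.Away.mul_invSelf _
  have h2 : coeffEndo k p e s n a = a := by
    rw [coeffEndo_algebraMap]
    exact congrArg _ (bind₁_coeffMap_coeffA _)
  refine ⟨IsLocalization.Away.invSelf (leadingCoeff k p e s n), ?_⟩
  have h3 := congrArg (coeffEndo k p e s n) h1
  rw [map_mul, h2, map_one] at h3
  exact left_inv_eq_right_inv ((mul_comm _ _).trans h3) h1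

theorem coeffA_mem_range (i : ℤ) :
    algebraMap _ _ (coeffA k p e s n i) ∈ (coeffEndo k p e s n).range :=
  ⟨algebraMap _ _ (coeffA k p e s n i), by rw [coeffEndo_algebraMap, bind₁_coeffMap_coeffA]⟩

/-- The coefficients of `f` can be recovered one after the other, as in a triangular system. -/
theorem coeffF_mem_range (hse : s ≤ e) (hn : 1 ≤ n) (i : ℤ) :
    algebraMap _ _ (coeffF k p e s n i) ∈ (coeffEndo k p e s n).range := by
  have hp : (0 : ℤ) < p := by exact_mod_cast (Fact.out : p.Prime).pos
  have he := (add_lt_mul_add p hse hn).2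
  -- induction on `i`, starting where all coefficients of `f` are zero
  have key : ∀ (N : ℕ) (i : ℤ), i + (p * s : ℕ) < N →
      algebraMap _ _ (coeffF k p e s n i) ∈ (coeffEndo k p e s n).range := by
    intro N
    induction N with
    | zero =>
      intro i hi
      rw [coeffF, dif_neg (by omega), map_zero]
      exact zero_mem _
    | succ N ih =>
      intro i hi
      by_cases h : -((p * s : ℕ) : ℤ) ≤ i ∧ i < n * p ∧ ¬ (p : ℤ) ∣ i
      · have h1 : algebraMap _ (Localization.Away (leadingCoeff k p e s n))
            (coeffMap k p e s n (Sum.inl ⟨i, h⟩)) ∈ (coeffEndo k p e s n).range :=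
          ⟨algebraMap _ _ (MvPolynomial.X (Sum.inl ⟨i, h⟩ : CoeffIndex p e s n)), by
            rw [coeffEndo_algebraMap, MvPolynomial.bind₁_X_right]⟩
        have h2 : coeffMap k p e s n (Sum.inl ⟨i, h⟩) =
            leadingCoeff k p e s n ^ p * coeffF k p e s n i +
              ∑ r ∈ Finset.Ioo (e : ℤ) (p * (e + n)),
                coeffA k p e s n r ^ p * coeffF k p e s n (i - p * (r - e)) := by
          change ∑ r ∈ Finset.Ico (e : ℤ) (p * (e + n)),
            coeffA k p e s n r ^ p * coeffF k p e s n (i - p * (r - e)) = _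
          rw [← Finset.Ioo_insert_left he, Finset.sum_insert Finset.left_notMem_Ioo,
            sub_self, mul_zero, sub_zero]
        have h3 : algebraMap _ (Localization.Away (leadingCoeff k p e s n))
            (∑ r ∈ Finset.Ioo (e : ℤ) (p * (e + n)),
              coeffA k p e s n r ^ p * coeffF k p e s n (i - p * (r - e))) ∈
              (coeffEndo k p e s n).range := by
          rw [map_sum]
          refine sum_mem fun r hr => ?_
          rw [Finset.mem_Ioo] at hr
          rw [map_mul, map_pow]
          refine mul_mem (pow_mem (coeffA_mem_range r) p) (ih _ ?_)
          have h4 : (p : ℤ) * 1 ≤ p * (r - e) := mul_le_mul_of_nonneg_left (by omega) hp.le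
          push_cast at hi ⊢
          linarith
        have h4 := mul_mem (pow_mem (invSelf_mem_range (k := k) (p := p) (e := e) (s := s)
          (n := n)) p) (sub_mem h1 h3)
        rw [← map_sub, h2, add_sub_cancel_right, map_mul, map_pow, ← mul_assoc, ← mul_pow,
          mul_comm (IsLocalization.Away.invSelf _), IsLocalization.Away.mul_invSelf, one_pow,
          one_mul] at h4
        exact h4
      · rw [coeffF, dif_neg h, map_zero]
        exact zero_mem _
  exact key (i + (p * s : ℕ) + 1).toNat i (by omega)

variable [CharP k p]

/-- The image of `coeffEndo` contains all `p`-th powers. -/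
theorem pow_mem_range (hse : s ≤ e) (hn : 1 ≤ n)
    (r : Localization.Away (leadingCoeff k p e s n)) : r ^ p ∈ (coeffEndo k p e s n).range := by
  have hX : ∀ P : MvPolynomial (CoeffIndex p e s n) k,
      algebraMap _ (Localization.Away (leadingCoeff k p e s n)) (P ^ p) ∈
        (coeffEndo k p e s n).range := by
    intro P
    induction P using MvPolynomial.induction_on with
    | C c =>
      rw [← map_pow]
      exact ⟨algebraMap _ _ (MvPolynomial.C (c ^ p)), by
        rw [coeffEndo_algebraMap, MvPolynomial.bind₁_C_right]⟩
    | add P Q hP hQ =>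
      rw [add_pow_char (p := p), map_add]
      exact add_mem hP hQ
    | mul_X P i hP =>
      rw [mul_pow, map_mul]
      refine mul_mem hP ?_
      rcases i with i | i | i
      · have := coeffF_mem_range (k := k) (p := p) hse hn i
        rw [coeffF, dif_pos i.2] at this
        rw [map_pow]
        exact pow_mem this p
      · have := coeffA_mem_range (k := k) (p := p) (e := e) (s := s) (n := n) i
        rw [coeffA, dif_pos i.2] at this
        rw [map_pow]
        exact pow_mem this p
      · exact ⟨algebraMap _ _ (MvPolynomial.X (Sum.inr (Sum.inr i))), by
          rw [coeffEndo_algebraMap, MvPolynomial.bind₁_X_right]; rfl⟩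
  obtain ⟨m, P, hP⟩ := IsLocalization.Away.surj (leadingCoeff k p e s n) r
  have h1 : r = algebraMap _ _ P * IsLocalization.Away.invSelf (leadingCoeff k p e s n) ^ m := by
    rw [← hP, mul_assoc, ← mul_pow, IsLocalization.Away.mul_invSelf, one_pow, mul_one]
  rw [h1, mul_pow, ← map_pow, ← pow_mul]
  exact mul_mem (hX P) (pow_mem (invSelf_mem_range (k := k) (p := p)) _)

variable [IsAlgClosed k]

theorem eval_leadingCoeff (hse : s ≤ e) (hn : 1 ≤ n) {γ : TwistedArc k p}
    (hγ : γ ∈ arcDomain k p e s) :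
    MvPolynomial.eval (γ.coeffs e s n) (leadingCoeff k p e s n) = γ.a.coeff e :=
  eval_coeffA hγ (add_lt_mul_add p hse hn).2

theorem eval_leadingCoeff_quotient (hse : s ≤ e) (hn : 1 ≤ n) (δ : QuotientArc k p) :
    MvPolynomial.eval (δ.coeffs e s n) (leadingCoeff k p e s n) =
      (QuotientArc.coord δ 0).coeff e :=
  eval_coeffA_of_mem _ ⟨le_rfl, (add_lt_mul_add p hse hn).2⟩

/-- The surjectivity of `ψ` onto the arcs with `x ≠ 0`, on coefficients. -/
theorem coeffMap_surjective (hse : s ≤ e) (hn : 1 ≤ n) (y : CoeffIndex p e s n → k)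
    (hy : MvPolynomial.eval y (leadingCoeff k p e s n) ≠ 0) :
    ∃ x, MvPolynomial.eval x (leadingCoeff k p e s n) ≠ 0 ∧
      (fun i => MvPolynomial.eval x (coeffMap k p e s n i)) = y := by
  obtain ⟨δ, hδ, rfl⟩ := exists_quotient_coeffs hse y
  rw [eval_leadingCoeff_quotient hse hn] at hy
  obtain ⟨γ, hγ, rfl⟩ := exists_arcDomain_psi_eq hδ hy
  refine ⟨γ.coeffs e s n, ?_, (coeffs_psi hse hn hγ).symm⟩
  rwa [eval_leadingCoeff hse hn hγ, ← coord_psi_zero]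

/-! ### The strata -/

variable (k p) in
/-- The twisted arcs `γ` with `s(γ) = s` and `ord(x) = e`. -/
def stratum (e s : ℕ) : Set (TwistedArc k p) := {γ | γ.s = s ∧ γ.a ≠ 0 ∧ γ.ordX = e}

variable (k p) in
/-- The set of the coefficients of the elements of `stratum`. -/
def coeffStratum (e s n : ℕ) : Set (CoeffIndex p e s n → k) :=
  {v | MvPolynomial.eval v (leadingCoeff k p e s n) ≠ 0 ∧
    (s = 0 ∨ ∃ j : PrimeTo p (-((p * s : ℕ) : ℤ)) (n * p), (j : ℤ) < -(p * (s - 1)) ∧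
      v (Sum.inl j) ≠ 0)}

theorem isConstructibleSet_coeffStratum : IsConstructibleSet (coeffStratum k p e s n) := by
  refine (isConstructibleSet_eq_zero _).compl.inter ?_
  by_cases hs : s = 0
  · simp only [hs, true_or]
    exact isConstructibleSet_univ
  · have : ∀ j : PrimeTo p (-((p * s : ℕ) : ℤ)) (n * p),
        IsConstructibleSet {v : CoeffIndex p e s n → k | (j : ℤ) < -(p * (s - 1)) ∧
          v (Sum.inl j) ≠ 0} := by
      intro j
      by_cases hj : (j : ℤ) < -(p * (s - 1))
      · have := (isConstructibleSet_eq_zero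
          (MvPolynomial.X (Sum.inl j) : MvPolynomial (CoeffIndex p e s n) k)).compl
        simp only [MvPolynomial.eval_X] at this
        simp only [hj, true_and]
        exact this
      · simpa [hj] using (isConstructibleSet_univ (k := k) (ι := CoeffIndex p e s n)).compl
    simp only [hs, false_or]
    exact isConstructibleSet_exists this

/-- For `s(γ) ≤ s`, the condition on the coefficients of `f` in `coeffStratum` means that
`s(γ) = s`. -/
theorem s_eq_iff {γ : TwistedArc k p} (hγ : ∀ i < -((p * s : ℕ) : ℤ), γ.f.coeff i = 0)
    (n : ℕ) : γ.s = s ↔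
      (s = 0 ∨ ∃ j : PrimeTo p (-((p * s : ℕ) : ℤ)) (n * p), (j : ℤ) < -(p * (s - 1)) ∧
        γ.f.coeff j ≠ 0) := by
  have hp : (0 : ℤ) < p := by exact_mod_cast (Fact.out : p.Prime).pos
  have hle : γ.s ≤ s := poleOrder_le_iff.mpr ⟨by omega, by exact_mod_cast hγ⟩
  have h0 : 0 ≤ γ.s := poleOrder_nonneg γ.f
  have hlt : γ.s ≤ s - 1 ↔ (0 : ℤ) ≤ s - 1 ∧ ∀ i < -(p * (s - 1 : ℤ)), γ.f.coeff i = 0 :=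
    poleOrder_le_iff
  rcases Nat.eq_zero_or_pos s with rfl | hs
  · simp only [true_or, iff_true]
    push_cast at hle ⊢
    omega
  · have h1 : γ.s = s ↔ ¬ γ.s ≤ s - 1 := by omega
    rw [h1, hlt, or_iff_right (by omega)]
    push Not
    constructor
    · intro h
      obtain ⟨i, hi, hne⟩ := h (by omega)
      refine ⟨⟨i, ?_, ?_, fun hd => hne (γ.mem_deltaG i hd)⟩, hi, hne⟩
      · by_contra hlt
        exact hne (hγ i (by omega))
      · have : (1 : ℤ) ≤ s := by omega
        nlinarith [Int.natCast_nonneg n]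
    · rintro ⟨j, hj, hne⟩ -
      exact ⟨j, hj, hne⟩

theorem mem_stratum_iff (hse : s ≤ e) (hn : 1 ≤ n) {γ : TwistedArc k p} :
    γ ∈ stratum k p e s ↔ γ ∈ arcDomain k p e s ∧ γ.coeffs e s n ∈ coeffStratum k p e s n := by
  constructor
  · rintro ⟨hs, ha, he⟩
    have hf : ∀ i < -((p * s : ℕ) : ℤ), γ.f.coeff i = 0 := by
      have := coeff_eq_zero_of_poleOrder (p := p) γ.f
      rw [← TwistedArc.s_eq, hs] at this
      exact_mod_cast this
    have hγ : γ ∈ arcDomain k p e s := ⟨hf, fun i hi =>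
      HahnSeries.coeff_eq_zero_of_lt_order (hi.trans_eq he.symm)⟩
    refine ⟨hγ, ?_, (s_eq_iff hf n).mp hs⟩
    rw [eval_leadingCoeff hse hn hγ, ← he]
    exact HahnSeries.coeff_order_eq_zero.not.mpr ha
  · rintro ⟨hγ, h1, h2⟩
    rw [eval_leadingCoeff hse hn hγ] at h1
    have ha : γ.a ≠ 0 := fun h => h1 (by rw [h]; rfl)
    refine ⟨(s_eq_iff hγ.1 n).mpr h2, ha, le_antisymm (HahnSeries.order_le_of_coeff_ne_zero h1) ?_⟩
    by_contra hlt
    exact HahnSeries.coeff_order_eq_zero.not.mpr ha (hγ.2 _ (not_le.mp hlt))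

end Strata

/-! ### The change of variables on the strata -/

section ChangeOfVariables

variable {k : Type u} [Field k] [IsAlgClosed k] {p : ℕ} [Fact p.Prime] [CharP k p] {e s n : ℕ}

/-- The set `C` of twisted arcs is given by the condition `W` on the coefficients of twisted arcs,
and its image in the set of arcs of the quotient by the condition `V`. -/
structure IsPresented (e s n : ℕ) (V W : Set (CoeffIndex p e s n → k)) (C : Set (TwistedArc k p)) :
    Prop where
  isConstructible : IsConstructibleSet V
  ne_zero : ∀ v ∈ V, MvPolynomial.eval v (leadingCoeff k p e s n) ≠ 0
  preimage_eq : W = {v | MvPolynomial.eval v (leadingCoeff k p e s n) ≠ 0 ∧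
    (fun i => MvPolynomial.eval v (coeffMap k p e s n i)) ∈ V}
  subset : W ⊆ coeffStratum k p e s n
  mem_iff : ∀ γ, γ ∈ C ↔ γ ∈ arcDomain k p e s ∧ γ.coeffs e s n ∈ W

theorem IsPresented.mem_image_iff (hse : s ≤ e) (hn : 1 ≤ n)
    {V W : Set (CoeffIndex p e s n → k)} {C : Set (TwistedArc k p)} (h : IsPresented e s n V W C)
    (δ : QuotientArc k p) : δ ∈ psi '' C ↔ δ ∈ quotientDomain k p e s ∧ δ.coeffs e s n ∈ V := by
  constructor
  · rintro ⟨γ, hγ, rfl⟩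
    rw [h.mem_iff, h.preimage_eq] at hγ
    exact ⟨psi_mem_quotientDomain hγ.1, by rw [coeffs_psi hse hn hγ.1]; exact hγ.2.2⟩
  · rintro ⟨hδ, hV⟩
    have h0 := h.ne_zero _ hV
    rw [eval_leadingCoeff_quotient hse hn] at h0
    obtain ⟨γ, hγ, rfl⟩ := exists_arcDomain_psi_eq hδ h0
    refine ⟨γ, ?_, rfl⟩
    rw [h.mem_iff, h.preimage_eq]
    refine ⟨hγ, ?_, ?_⟩
    · rwa [eval_leadingCoeff hse hn hγ, ← coord_psi_zero]
    · rwa [coeffs_psi hse hn hγ] at hV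

/-- As `coeffMap` is a universal homeomorphism where the leading coefficient of `a` is invertible,
the conditions on twisted arcs and on their images have the same class. -/
theorem IsPresented.classShift (hse : s ≤ e) (hn : 1 ≤ n)
    {V W : Set (CoeffIndex p e s n → k)} {C : Set (TwistedArc k p)} (h : IsPresented e s n V W C) :
    ClassShift 0 V W := by
  have h0 : leadingCoeff k p e s n ≠ 0 := by
    rw [leadingCoeff_eq hse hn]
    exact MvPolynomial.X_ne_zero _
  have := ClassShift.away p h0 coeffEndo_algebraMap (pow_mem_range hse hn)
    (coeffMap_surjective hse hn) h.ne_zero h.isConstructible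
  rwa [← h.preimage_eq] at this

/-- The coefficients of `a` in degrees from `s` to `e - 1` are zero, and those of `a` in the last
`s` degrees and of `b` in degrees from `e + n` to `m` are free. -/
theorem IsPresented.twisted (hse : s ≤ e) (hn : 1 ≤ n) {m : ℕ} (hm : (m + 1 : ℤ) = p * (e + n))
    {V W : Set (CoeffIndex p e s n → k)} {C : Set (TwistedArc k p)} (h : IsPresented e s n V W C) :
    IsCylinder (twistedSystem k p) (twistedLevel k p m n (p * s)) C ∧
      ClassShift ((p - 1) * (e + n) + s) W
        ((twistedSystem k p).trunc (twistedLevel k p m n (p * s)) '' C) := by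
  obtain ⟨h1, h2⟩ := add_lt_mul_add p hse hn
  let β : CoeffIndex p e s n ⊕ IntIco s e →
      PrimeTo p (-((p * s : ℕ) : ℤ)) (n * p) ⊕ Fin (m + 1) ⊕ Fin (m + 1) := Sum.elim
    (Sum.elim Sum.inl (Sum.elim
      (fun i => Sum.inr (Sum.inl ⟨(i - s : ℤ).toNat, by have := i.2; omega⟩))
      fun i => Sum.inr (Sum.inr ⟨(i : ℤ).toNat, by have := i.2; omega⟩)))
    fun i => Sum.inr (Sum.inl ⟨(i - s : ℤ).toNat, by have := i.2; omega⟩)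
  have hβ : Function.Injective β := by
    rintro ((i | ⟨i, hi⟩ | ⟨i, hi⟩) | ⟨i, hi⟩) ((i' | ⟨i', hi'⟩ | ⟨i', hi'⟩) | ⟨i', hi'⟩) hii
    all_goals simp only [β, Sum.elim_inl, Sum.elim_inr, Sum.inl.injEq, Sum.inr.injEq,
      Fin.mk.injEq, reduceCtorEq] at hii
    · rw [hii]
    · obtain rfl : i = i' := by omega
      rfl
    · omega
    · obtain rfl : i = i' := by omega
      rfl
    · omega
    · obtain rfl : i = i' := by omega
      rfl
  refine isCylinder_twisted (h.classShift hse hn).right hβ ?_ fun γ => ?_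
  · have hc1 := card_intIco (u := e) (v := p * (e + n)) (by omega)
    have hc2 := card_intIco (u := 0) (v := e + n) (by omega)
    have hc3 := card_intIco (u := s) (v := e) (by omega)
    simp only [Nat.card_sum, Nat.card_fin]
    push_cast at hc1 hc2 hc3 ⊢
    rw [hc1, hc2, hc3, hm]
    ring
  · rw [h.mem_iff]
    -- the truncation of `a` starts in degree `s`, so `s(γ) = s` is needed to compare coordinates
    have key : γ.s = s → (fun i => γ.trunc m n (p * s) (β (Sum.inl i))) = γ.coeffs e s n := by
      intro hs
      ext (i | i | i)
      · rfl
      · change γ.a.coeff (γ.s + ((i - s : ℤ).toNat : ℤ)) = γ.a.coeff i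
        have := i.2
        congr 1
        omega
      · change γ.b.coeff ((i : ℤ).toNat : ℤ) = γ.b.coeff i
        have := i.2
        congr 1
        omega
    have key' : γ.s = s → ((∀ i < (e : ℤ), γ.a.coeff i = 0) ↔
        ∀ i, γ.trunc m n (p * s) (β (Sum.inr i)) = 0) := by
      intro hs
      have hi : ∀ i : IntIco s e, γ.trunc m n (p * s) (β (Sum.inr i)) = γ.a.coeff i := by
        intro i
        change γ.a.coeff (γ.s + ((i - s : ℤ).toNat : ℤ)) = γ.a.coeff i
        have := i.2
        congr 1
        omega
      simp only [hi]
      refine ⟨fun h i => h i i.2.2, fun h i hi => ?_⟩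
      rcases lt_or_ge i s with hlt | hge
      · exact γ.a_coeff i (by omega)
      · exact h ⟨i, hge, hi⟩
    constructor
    · rintro ⟨hγ, hW⟩
      have hs := (s_eq_iff hγ.1 n).mpr (h.subset hW).2
      rw [key hs]
      exact ⟨hγ.1, (key' hs).mp hγ.2, hW⟩
    · rintro ⟨hf, h0, hW⟩
      have hs := (s_eq_iff hf n).mpr (h.subset hW).2
      rw [key hs] at hW
      exact ⟨⟨hf, (key' hs).mpr h0⟩, hW⟩

/-- The coefficients of `x` in degrees less than `e` are zero, as are those of `y ^ p` in the
degrees less than `p (e - s)` that are prime to `p`, and there are no free coefficients. -/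
theorem IsPresented.quotient (hse : s ≤ e) (hn : 1 ≤ n) {m : ℕ} (hm : (m + 1 : ℤ) = p * (e + n))
    {V W : Set (CoeffIndex p e s n → k)} {C : Set (TwistedArc k p)} (h : IsPresented e s n V W C) :
    IsCylinder (quotientSystem k p) (quotientLevel k p m) (psi '' C) ∧
      ClassShift 0 V ((quotientSystem k p).trunc (quotientLevel k p m) '' (psi '' C)) := by
  have hp : (0 : ℤ) < p := by exact_mod_cast (Fact.out : p.Prime).pos
  obtain ⟨h1, h2⟩ := add_lt_mul_add p hse hn
  have hse' : (s : ℤ) ≤ e := by exact_mod_cast hse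
  have hF : ∀ j : PrimeTo p (-((p * s : ℕ) : ℤ)) (n * p),
      0 ≤ (j + p * e : ℤ) ∧ (j + p * e : ℤ) < m + 1 := by
    intro j
    have := j.2.1
    have := j.2.2.1
    push_cast at *
    constructor <;> nlinarith
  have hB : ∀ i : IntIco 0 (e + n), 0 ≤ (p * i : ℤ) ∧ (p * i : ℤ) < m + 1 := by
    intro i
    have := i.2
    constructor <;> nlinarith
  have hP : ∀ i : PrimeTo p (0 * p) ((e - s : ℤ) * p), 0 ≤ (i : ℤ) ∧ (i : ℤ) < m + 1 := by
    intro i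
    have := i.2.1
    have := i.2.2.1
    constructor <;> nlinarith
  let β : CoeffIndex p e s n ⊕ (IntIco 0 e ⊕ PrimeTo p (0 * p) ((e - s : ℤ) * p)) →
      Fin 2 × Fin (m + 1) := Sum.elim
    (Sum.elim (fun j => (1, ⟨(j + p * e : ℤ).toNat, by have := hF j; omega⟩)) (Sum.elim
      (fun i => (0, ⟨(i : ℤ).toNat, by have := i.2; omega⟩))
      fun i => (1, ⟨(p * i : ℤ).toNat, by have := hB i; omega⟩)))
    (Sum.elim (fun i => (0, ⟨(i : ℤ).toNat, by have := i.2; omega⟩))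
      fun i => (1, ⟨(i : ℤ).toNat, by have := hP i; omega⟩))
  -- the integers `j + p e` are prime to `p` and at least `p (e - s)`
  have hFd : ∀ j : PrimeTo p (-((p * s : ℕ) : ℤ)) (n * p), ¬ (p : ℤ) ∣ (j + p * e : ℤ) :=
    fun j h => j.2.2.2 ((Int.dvd_add_left (dvd_mul_right _ _)).mp h)
  have hFe : ∀ j : PrimeTo p (-((p * s : ℕ) : ℤ)) (n * p), (e - s : ℤ) * p ≤ (j + p * e : ℤ) := by
    intro j
    have := j.2.1
    push_cast at this
    linarith
  have hβ : Function.Injective β := by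
    rintro ((i | i | i) | (i | i)) ((i' | i' | i') | (i' | i')) hii
    all_goals
      simp only [β, Sum.elim_inl, Sum.elim_inr, Prod.mk.injEq, Fin.mk.injEq, zero_ne_one,
        one_ne_zero, true_and, false_and] at hii
    · have := hF i
      have := hF i'
      rw [Subtype.ext (show (i : ℤ) = i' by omega)]
    · have := hF i
      have := hB i'
      exact (hFd i ⟨i', by omega⟩).elim
    · have := hF i
      have := hP i'
      have := hFe i
      have := i'.2.2.1
      omega
    · have := i.2
      have := i'.2
      rw [Subtype.ext (show (i : ℤ) = i' by omega)]
    · have := i.2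
      have := i'.2
      omega
    · have := hB i
      have := hF i'
      exact (hFd i' ⟨i, by omega⟩).elim
    · have := hB i
      have := hB i'
      rw [Subtype.ext (mul_left_cancel₀ hp.ne' (show (p * i : ℤ) = p * i' by omega))]
    · have := hB i
      have := hP i'
      exact (i'.2.2.2 ⟨i, by omega⟩).elim
    · have := i.2
      have := i'.2
      omega
    · have := i.2
      have := i'.2
      rw [Subtype.ext (show (i : ℤ) = i' by omega)]
    · have := hF i'
      have := hP i
      have := hFe i'
      have := i.2.2.1
      omega
    · have := hB i'
      have := hP i
      exact (i.2.2.2 ⟨i', by omega⟩).elim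
    · have := hP i
      have := hP i'
      rw [Subtype.ext (show (i : ℤ) = i' by omega)]
  refine isCylinder_quotient h.isConstructible hβ ?_ fun δ => ?_
  · have hc1 := card_intIco (u := e) (v := p * (e + n)) (by omega)
    have hc2 := card_intIco (u := 0) (v := e + n) (by omega)
    have hc3 := card_intIco (u := 0) (v := e) (by omega)
    have hc4 := card_primeTo_mul p (u := 0) (v := e - s) (by omega)
    have hc5 := card_primeTo_mul p (u := -s) (v := n) (by omega)
    have hc6 : ((p * s : ℕ) : ℤ) = s * p := by push_cast; ring
    rw [neg_mul] at hc5
    simp only [Nat.card_sum, Nat.card_fin, Nat.card_prod, hc6]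
    push_cast at hc1 hc2 hc3 hc4 hc5 ⊢
    rw [hc1, hc2, hc3, hc4, hc5, hm]
    ring
  · rw [h.mem_image_iff hse hn]
    have h3 : (fun i => δ.trunc m (β (Sum.inl i))) = δ.coeffs e s n := by
      ext (i | i | i)
      · change (QuotientArc.coord δ 1).coeff ((i + p * e : ℤ).toNat : ℤ) =
          (QuotientArc.coord δ 1).coeff (i + p * e)
        rw [Int.toNat_of_nonneg (hF i).1]
      · change (QuotientArc.coord δ 0).coeff ((i : ℤ).toNat : ℤ) = (QuotientArc.coord δ 0).coeff i
        rw [Int.toNat_of_nonneg (by have := i.2; omega)]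
      · change (QuotientArc.coord δ 1).coeff ((p * i : ℤ).toNat : ℤ) =
          (QuotientArc.coord δ 1).coeff (p * i)
        rw [Int.toNat_of_nonneg (hB i).1]
    have h4 : ∀ i : IntIco 0 e, δ.trunc m (β (Sum.inr (Sum.inl i))) =
        (QuotientArc.coord δ 0).coeff i := by
      intro i
      change (QuotientArc.coord δ 0).coeff ((i : ℤ).toNat : ℤ) = _
      rw [Int.toNat_of_nonneg i.2.1]
    have h5 : ∀ i : PrimeTo p (0 * p) ((e - s : ℤ) * p), δ.trunc m (β (Sum.inr (Sum.inr i))) =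
        (QuotientArc.coord δ 1).coeff i := by
      intro i
      change (QuotientArc.coord δ 1).coeff ((i : ℤ).toNat : ℤ) = _
      rw [Int.toNat_of_nonneg (hP i).1]
    rw [h3]
    refine and_congr_left fun _ => ⟨fun h => ?_, fun h => ⟨fun i hi => ?_, fun i hi hpi => ?_⟩⟩
    · rintro (i | i)
      · rw [h4]
        exact h.1 i i.2.2
      · rw [h5]
        exact h.2 i (by have := i.2.2.1; linarith) i.2.2.2
    · rcases lt_or_ge i 0 with hlt | hge
      · exact coord_coeff_of_neg δ 0 i hlt
      · rw [← h4 ⟨i, hge, hi⟩]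
        exact h _
    · rcases lt_or_ge i 0 with hlt | hge
      · exact coord_coeff_of_neg δ 1 i hlt
      · rw [← h5 ⟨i, by omega, by linarith, hpi⟩]
        exact h _

/-- The cylinders contained in a stratum are presented, as soon as the precision is large. -/
theorem exists_isPresented_of_isCyl (hse : s ≤ e) {C : Set (TwistedArc k p)}
    (hCs : C ⊆ stratum k p e s) (hC : IsCyl (twistedSystem k p) C) :
    ∃ n, 1 ≤ n ∧ ∃ V W, IsPresented e s n V W C := by
  have hp : (0 : ℤ) < p := by exact_mod_cast (Fact.out : p.Prime).pos
  obtain ⟨m, n₀, j, hj, hC⟩ : ∃ m n₀ j : ℕ, p * s ≤ j ∧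
      IsCylinder (twistedSystem k p) (twistedLevel k p m n₀ j) C := by
    obtain ⟨⟨m, n₀, j⟩, hC⟩ := hC
    exact ⟨m, n₀, max j (p * s), le_max_right _ _,
      (twistedSystem_refines le_rfl le_rfl (le_max_left _ _) C hC).1⟩
  obtain ⟨n, hn0, hnm⟩ : ∃ n, n₀ ≤ n ∧ m + 1 ≤ n :=
    ⟨max n₀ (m + 1), le_max_left _ _, le_max_right _ _⟩
  have hn : 1 ≤ n := by omega
  obtain ⟨h1, h2⟩ := add_lt_mul_add p hse hn
  have := (twistedSystem k p).finite_coord (twistedLevel k p m n₀ j)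
  -- the truncation at the level `(m, n₀, j)` as a function of the coefficients
  let g : PrimeTo p (-j) (n₀ * p) ⊕ Fin (m + 1) ⊕ Fin (m + 1) →
      MvPolynomial (CoeffIndex p e s n) k :=
    Sum.elim (fun i => coeffF k p e s n i) (Sum.elim (fun i => coeffA k p e s n (s + (i : ℕ)))
      fun i => coeffB k p e s n (i : ℕ))
  let W : Set (CoeffIndex p e s n → k) := {v | v ∈ coeffStratum k p e s n ∧
    (fun i => MvPolynomial.eval v (g i)) ∈
      (twistedSystem k p).trunc (twistedLevel k p m n₀ j) '' C}
  have hW : IsConstructibleSet W := isConstructibleSet_coeffStratum.inter (hC.2.2.preimage g)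
  obtain ⟨V, hVc, hV0, hVW⟩ := exists_away_preimage_eq (Fact.out : p.Prime).ne_zero
    coeffEndo_algebraMap (pow_mem_range hse hn) (coeffMap_surjective hse hn)
    (fun v hv => hv.1.1) hW
  refine ⟨n, hn, V, W, hVc, hV0, hVW, fun v hv => hv.1, fun γ => ?_⟩
  have key : γ ∈ stratum k p e s → (fun i => MvPolynomial.eval (γ.coeffs e s n) (g i)) =
      (twistedSystem k p).trunc (twistedLevel k p m n₀ j) γ := by
    intro hγ
    have hγ' := ((mem_stratum_iff hse hn).mp hγ).1
    have hs := hγ.1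
    ext (i | i | i)
    · have := i.2.2.1
      have : (n₀ : ℤ) * p ≤ n * p := by gcongr
      exact eval_coeffF hγ' (by linarith)
    · refine (eval_coeffA hγ' (by have := i.2; omega)).trans ?_
      rw [← hs]
      rfl
    · exact eval_coeffB γ (by have := i.2; omega)
  constructor
  · intro hγ
    have hγs := hCs hγ
    have := (mem_stratum_iff hse hn).mp hγs
    refine ⟨this.1, this.2, ?_⟩
    rw [key hγs]
    exact ⟨γ, hγ, rfl⟩
  · rintro ⟨hγ, hst, hW⟩
    have hγs := (mem_stratum_iff hse hn).mpr ⟨hγ, hst⟩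
    rw [key hγs] at hW
    refine hC.mem_iff.mpr ⟨fun i hi => hγ.1 i ?_, hW⟩
    replace hi : i < -(j : ℤ) := hi
    omega

/-- A subset of a stratum with image a cylinder is presented, as soon as the precision is large. -/
theorem exists_isPresented_of_isCyl_image (hse : s ≤ e) {C : Set (TwistedArc k p)}
    (hCs : C ⊆ stratum k p e s) (hC : IsCyl (quotientSystem k p) (psi '' C)) :
    ∃ n, 1 ≤ n ∧ ∃ V W, IsPresented e s n V W C := by
  have hp : (0 : ℤ) < p := by exact_mod_cast (Fact.out : p.Prime).pos
  obtain ⟨m, hC⟩ : ∃ m : ℕ, IsCylinder (quotientSystem k p) (quotientLevel k p m) (psi '' C) := hC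
  obtain ⟨n, hnm⟩ : ∃ n, m + 1 ≤ n := ⟨_, le_rfl⟩
  have hn : 1 ≤ n := by omega
  obtain ⟨h1, h2⟩ := add_lt_mul_add p hse hn
  have hse' : (s : ℤ) ≤ e := by exact_mod_cast hse
  have := (quotientSystem k p).finite_coord (quotientLevel k p m)
  classical
  -- the truncation at the level `m` as a function of the coefficients
  let g : Fin 2 × Fin (m + 1) → MvPolynomial (CoeffIndex p e s n) k := fun i =>
    if i.1 = 0 then coeffA k p e s n (i.2 : ℕ) else
      if (p : ℤ) ∣ (i.2 : ℕ) then coeffB k p e s n ((i.2 : ℕ) / p) else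
        coeffF k p e s n ((i.2 : ℕ) - p * e)
  let V : Set (CoeffIndex p e s n → k) :=
    {v | MvPolynomial.eval v (leadingCoeff k p e s n) ≠ 0 ∧ (fun i => MvPolynomial.eval v (g i)) ∈
      (quotientSystem k p).trunc (quotientLevel k p m) '' (psi '' C)}
  have hV : IsConstructibleSet V := (isConstructibleSet_eq_zero _).compl.inter (hC.2.2.preimage g)
  have key : ∀ δ ∈ quotientDomain k p e s, (fun i => MvPolynomial.eval (δ.coeffs e s n) (g i)) =
      (quotientSystem k p).trunc (quotientLevel k p m) δ := by
    intro δ hδ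
    ext ⟨j, i⟩
    refine Eq.trans ?_ (coord_coeff δ j i)
    have hi : (i : ℕ) < m + 1 := i.2
    have hnp : (n : ℤ) ≤ n * p := by nlinarith [Int.natCast_nonneg n]
    fin_cases j
    · change MvPolynomial.eval _ (coeffA k p e s n (i : ℕ)) = _
      by_cases h : (e : ℤ) ≤ (i : ℕ) ∧ ((i : ℕ) : ℤ) < p * (e + n)
      · exact eval_coeffA_of_mem _ h
      · rw [coeffA, dif_neg h, map_zero]
        exact (hδ.1 _ (by omega)).symm
    · change MvPolynomial.eval _ (if (p : ℤ) ∣ (i : ℕ) then coeffB k p e s n ((i : ℕ) / p) else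
        coeffF k p e s n ((i : ℕ) - p * e)) = (QuotientArc.coord δ 1).coeff ((i : ℕ) : ℤ)
      split_ifs with hd
      · obtain ⟨q, hq⟩ := hd
        have hq0 : 0 ≤ q := by nlinarith
        have hq1 : q < e + n := by nlinarith
        rw [hq, Int.mul_ediv_cancel_left _ hp.ne', eval_coeffB_of_mem _ ⟨hq0, hq1⟩]
        rfl
      · by_cases h : -((p * s : ℕ) : ℤ) ≤ (i : ℕ) - p * e ∧ ((i : ℕ) - p * e : ℤ) < n * p ∧
            ¬ (p : ℤ) ∣ (i : ℕ) - p * e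
        · rw [eval_coeffF_of_mem _ h]
          change (QuotientArc.coord δ 1).coeff ((i : ℕ) - p * e + p * e) = _
          rw [sub_add_cancel]
        · rw [coeffF, dif_neg h, map_zero]
          refine (hδ.2 _ ?_ hd).symm
          have h3 : ¬ (p : ℤ) ∣ (i : ℕ) - p * e :=
            fun h => hd ((dvd_sub_left (dvd_mul_right _ _)).mp h)
          have h4 : ((i : ℕ) - p * e : ℤ) < n * p := by nlinarith
          have h5 : ¬ -((p * s : ℕ) : ℤ) ≤ (i : ℕ) - p * e := fun h6 => h ⟨h6, h4, h3⟩
          push_cast at h5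
          linarith
  have hmem : ∀ δ, δ ∈ psi '' C ↔ δ ∈ quotientDomain k p e s ∧ δ.coeffs e s n ∈ V := by
    intro δ
    constructor
    · rintro ⟨γ, hγ, rfl⟩
      obtain ⟨h3, h4⟩ := (mem_stratum_iff hse hn).mp (hCs hγ)
      have h5 := psi_mem_quotientDomain h3
      refine ⟨h5, ?_, ?_⟩
      · rw [eval_leadingCoeff_quotient hse hn, coord_psi_zero, ← eval_leadingCoeff hse hn h3]
        exact h4.1
      · rw [key _ h5]
        exact ⟨_, ⟨γ, hγ, rfl⟩, rfl⟩
    · rintro ⟨hδ, -, hV⟩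
      rw [key _ hδ] at hV
      exact hC.mem_iff.mpr ⟨trivial, hV⟩
  have hCW : ∀ γ, γ ∈ C ↔ γ ∈ arcDomain k p e s ∧ γ.coeffs e s n ∈
      {v | MvPolynomial.eval v (leadingCoeff k p e s n) ≠ 0 ∧
        (fun i => MvPolynomial.eval v (coeffMap k p e s n i)) ∈ V} := by
    intro γ
    constructor
    · intro hγ
      obtain ⟨h3, h4⟩ := (mem_stratum_iff hse hn).mp (hCs hγ)
      have h5 := ((hmem _).mp ⟨γ, hγ, rfl⟩).2
      rw [coeffs_psi hse hn h3] at h5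
      exact ⟨h3, h4.1, h5⟩
    · rintro ⟨h3, h4, h5⟩
      rw [← coeffs_psi hse hn h3] at h5
      obtain ⟨γ', hγ', he⟩ := (hmem _).mpr ⟨psi_mem_quotientDomain h3, h5⟩
      rw [eval_leadingCoeff hse hn h3] at h4
      have h6 : γ.a ≠ 0 := fun h => h4 (by rw [h]; rfl)
      rwa [← psi_injOn (hCs hγ').2.1 h6 he]
  refine ⟨n, hn, V, _, hV, fun v hv => hv.1, rfl, fun v hv => ?_, hCW⟩
  obtain ⟨γ, hγ, rfl⟩ := exists_twisted_coeffs hse v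
  exact ((mem_stratum_iff hse hn).mp (hCs ((hCW γ).mpr ⟨hγ, hv⟩))).2

/-- On the stratum of the `γ` with `s(γ) = s` and `ord(x) = e`, the map `ψ` changes measures by
`𝕃 ^ (s + (p - 1) e)`. -/
theorem isMeasureShift_stratum (hse : s ≤ e) :
    IsMeasureShift (twistedSystem k p) (quotientSystem k p) psi (stratum k p e s)
      (s + (p - 1) * e) := by
  have hp : 2 ≤ p := (Fact.out : p.Prime).two_le
  have level : ∀ {n : ℕ}, 1 ≤ n → ∃ m : ℕ, (m + 1 : ℤ) = p * (e + n) := by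
    intro n hn
    refine ⟨p * (e + n) - 1, ?_⟩
    have : 1 ≤ p * (e + n) := Nat.one_le_iff_ne_zero.mpr (by positivity)
    push_cast [Nat.cast_sub this]
    ring
  have chain : ∀ C ⊆ stratum k p e s, IsCyl (twistedSystem k p) C → ∃ l l',
      IsCylinder (twistedSystem k p) l C ∧ IsCylinder (quotientSystem k p) l' (psi '' C) ∧
      ∃ c, ClassShift c ((quotientSystem k p).trunc l' '' (psi '' C))
        ((twistedSystem k p).trunc l '' C) ∧
        c = s + (p - 1) * e + (twistedSystem k p).shift l - (quotientSystem k p).shift l' := by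
    intro C hCs hC
    obtain ⟨n, hn, V, W, h⟩ := exists_isPresented_of_isCyl hse hCs hC
    obtain ⟨m, hm⟩ := level hn
    obtain ⟨h1, h2⟩ := h.twisted hse hn hm
    obtain ⟨h3, h4⟩ := h.quotient hse hn hm
    refine ⟨_, _, h1, h3, _, (h4.symm.trans (h.classShift hse hn)).trans h2, ?_⟩
    change -0 + 0 + ((p - 1) * (e + n) + s : ℤ) =
      s + (p - 1) * e + (2 * m + (p - 1) * n) - 2 * m
    ring
  refine ⟨psi_injOn.mono fun γ hγ => hγ.2.1, ?_, fun C hCs hC => ?_, fun C hCs hC => ?_,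
    fun C hCs hC E => ?_, fun C hCs hC N => ?_⟩
  · obtain ⟨V, hVc, hV0, hVW⟩ := exists_away_preimage_eq (W := coeffStratum k p e s 1)
      (Fact.out : p.Prime).ne_zero coeffEndo_algebraMap (pow_mem_range hse le_rfl)
      (coeffMap_surjective hse le_rfl) (fun v hv => hv.1) isConstructibleSet_coeffStratum
    obtain ⟨m, hm⟩ := level le_rfl
    exact ⟨_, (IsPresented.twisted hse le_rfl hm
      ⟨hVc, hV0, hVW, subset_rfl, fun γ => mem_stratum_iff hse le_rfl⟩).1⟩
  · obtain ⟨l, l', -, h, -⟩ := chain C hCs hC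
    exact ⟨l', h⟩
  · obtain ⟨n, hn, V, W, h⟩ := exists_isPresented_of_isCyl_image hse hCs hC
    obtain ⟨m, hm⟩ := level hn
    exact ⟨_, (h.twisted hse hn hm).1⟩
  · obtain ⟨l, l', h, h', c, hc, rfl⟩ := chain C hCs hC
    rw [isRegularSystem_twistedSystem.vol_eq h, isRegularSystem_quotientSystem.vol_eq h', volAt,
      volAt, hc.class_eq, mul_assoc, mul_assoc, ← lefschetzPow_add, ← lefschetzPow_add]
    congr 2
    ring
  · obtain ⟨l, l', h, h', c, hc, rfl⟩ := chain C hCs hC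
    rw [isRegularSystem_twistedSystem.dimLE_iff h, isRegularSystem_quotientSystem.dimLE_iff h',
      cylinderDimLE_iff, cylinderDimLE_iff, hc.dimBound_iff]
    congr! 1
    ring

end ChangeOfVariables

/-! ### The decomposition of the domains of integration -/

section Integrals

variable {k : Type u} [Field k] [IsAlgClosed k] {p : ℕ} [Fact p.Prime] [CharP k p]

/-- The part of `ψ⁻¹(C)` where `F ∘ ψ = ν`, `s = σ` and `ord(x) = σ + τ`, for `i = (ν, τ, σ)`.
As `s ≤ ord(x)`, these parts cover the locus where `ord(x)` is finite. -/
def arcPart (C : Set (QuotientArc k p)) (F : QuotientArc k p → ℤ) (i : ℤ × ℕ × ℕ) :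
    Set (TwistedArc k p) :=
  {γ | γ ∈ stratum k p (i.2.2 + i.2.1) i.2.2 ∧ psi γ ∈ fibre C F i.1}

/-- The difference of the exponents of the two integrals on `arcPart C F i`. -/
def partShift (p : ℕ) (i : ℤ × ℕ × ℕ) : ℤ := i.2.2 + (p - 1) * (i.2.2 + i.2.1 : ℕ)

variable {C : Set (QuotientArc k p)} {F : QuotientArc k p → ℤ}

theorem isMeasureShift_arcPart (i : ℤ × ℕ × ℕ) :
    IsMeasureShift (twistedSystem k p) (quotientSystem k p) psi
      (stratum k p (i.2.2 + i.2.1) i.2.2) (partShift p i) :=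
  isMeasureShift_stratum (Nat.le_add_right _ _)

theorem arcPart_subset (i : ℤ × ℕ × ℕ) :
    arcPart C F i ⊆ fibre (liftedSet C) (exponent F) (i.1 - partShift p i) := by
  rintro γ ⟨⟨hs, ha, he⟩, hC, hF⟩
  refine ⟨⟨hC, ha⟩, ?_⟩
  rw [exponent, hF, hs, he, partShift, sub_sub]

theorem mem_arcPart {γ : TwistedArc k p} (hC : psi γ ∈ C) (ha : γ.a ≠ 0) :
    ∃ t σ : ℕ, γ.s = σ ∧ γ.ordX = σ + t ∧ γ ∈ arcPart C F (F (psi γ), t, σ) := by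
  have h0 : 0 ≤ γ.s := poleOrder_nonneg γ.f
  obtain ⟨σ, hσ⟩ := Int.eq_ofNat_of_zero_le h0
  obtain ⟨t, ht⟩ := Int.eq_ofNat_of_zero_le (sub_nonneg.mpr (γ.s_le_order ha))
  have he : γ.ordX = σ + t := by
    rw [TwistedArc.ordX]
    omega
  exact ⟨t, σ, hσ, he, ⟨hσ, ha, by rw [he]; push_cast; rfl⟩, hC, rfl⟩

theorem pairwise_disjoint_arcPart :
    Pairwise fun i j => Disjoint (arcPart C F i) (arcPart C F j) := by
  intro i j hij
  refine Set.disjoint_left.mpr fun γ hi hj => hij ?_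
  have h1 := hi.1.1.symm.trans hj.1.1
  have h2 := hi.1.2.2.symm.trans hj.1.2.2
  have h3 := hi.2.2.symm.trans hj.2.2
  ext
  · exact h3
  · push_cast at h2
    omega
  · omega

theorem pairwise_disjoint_image_arcPart :
    Pairwise fun i j => Disjoint (psi '' arcPart C F i) (psi '' arcPart C F j) := by
  intro i j hij
  refine Set.disjoint_left.mpr ?_
  rintro _ ⟨γ, hγ, rfl⟩ ⟨γ', hγ', he⟩
  rw [psi_injOn hγ'.1.2.1 hγ.1.2.1 he] at hγ'
  exact Set.disjoint_left.mp (pairwise_disjoint_arcPart hij) hγ hγ'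

theorem image_arcPart_subset (i : ℤ × ℕ × ℕ) : psi '' arcPart C F i ⊆ fibre C F i.1 := by
  rintro _ ⟨γ, hγ, rfl⟩
  exact hγ.2

theorem isMeasurableSet_image_arcPart (hF : IsMeasurableFun (quotientSystem k p) C F)
    (i : ℤ × ℕ × ℕ) : IsMeasurableSet (quotientSystem k p) (psi '' arcPart C F i) := by
  have h := isMeasureShift_arcPart (k := k) (p := p) i
  have he : psi '' arcPart C F i =
      fibre C F i.1 ∩ psi '' stratum k p (i.2.2 + i.2.1) i.2.2 := by
    ext δ
    constructor
    · rintro ⟨γ, ⟨hγ, hγ'⟩, rfl⟩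
      exact ⟨hγ', γ, hγ, rfl⟩
    · rintro ⟨hδ, γ, hγ, rfl⟩
      exact ⟨γ, ⟨hγ, hδ⟩, rfl⟩
  rw [he]
  exact isRegularSystem_quotientSystem.isMeasurableSet_inter (hF i.1)
    (h.forward _ subset_rfl h.isCyl)

theorem isMeasurableSet_arcPart (hF : IsMeasurableFun (quotientSystem k p) C F) (i : ℤ × ℕ × ℕ) :
    IsMeasurableSet (twistedSystem k p) (arcPart C F i) ∧
      ∀ (E : Set (FreeCommRing (Variety k))),
        mulLefschetz E (i.1 - partShift p i) (measure E (twistedSystem k p) (arcPart C F i)) =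
          mulLefschetz E i.1 (measure E (quotientSystem k p) (psi '' arcPart C F i)) := by
  have h := (isMeasureShift_arcPart i).isMeasurableSet isRegularSystem_quotientSystem
    isRegularSystem_twistedSystem (fun _ hγ => hγ.1) (isMeasurableSet_image_arcPart hF i)
  exact ⟨h.1, fun E => h.2 E i.1⟩

theorem dimLE_image_arcPart (i : ℤ × ℕ × ℕ) (n : ℤ) :
    DimLE (quotientSystem k p) (psi '' arcPart C F i) n ↔
      DimLE (twistedSystem k p) (arcPart C F i) (n + partShift p i) :=
  (isMeasureShift_arcPart i).dimLE_iff' isRegularSystem_quotientSystem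
    isRegularSystem_twistedSystem (fun _ hγ => hγ.1) n

/-- Every fibre of `F` is a finite union of parts, up to arcs with large `ord(x)`. -/
theorem exists_dimLE_fibre (m n : ℤ) : ∃ s : Finset (ℤ × ℕ × ℕ),
    DimLE (quotientSystem k p) (fibre C F m \ ⋃ i ∈ s, psi '' arcPart C F i) n := by
  have ⟨N, hN⟩ : ∃ N : ℕ, 1 - n ≤ N := ⟨_, Int.self_le_toNat _⟩
  refine ⟨{m} ×ˢ Finset.range (N + 1) ×ˢ Finset.range (N + 1),
    (dimLE_ordX_quotient N).mono ?_ (by omega)⟩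
  rintro δ ⟨⟨hδC, hδF⟩, hδ⟩
  by_contra hx
  simp only [Set.mem_ofPred_eq, not_forall] at hx
  obtain ⟨j, hj, hne⟩ := hx
  have h0 : QuotientArc.coord δ 0 ≠ 0 := fun h => hne (by rw [h]; rfl)
  obtain ⟨γ, rfl, ha⟩ := exists_psi_eq h0
  have ha0 : γ.a ≠ 0 := by rwa [ha]
  obtain ⟨t, σ, hσ, he, hγ⟩ := mem_arcPart (F := F) hδC ha0
  have hle : γ.ordX ≤ j := HahnSeries.order_le_of_coeff_ne_zero (by rwa [ha])
  refine hδ (Set.mem_iUnion₂.mpr ⟨(m, t, σ), ?_, γ, hδF ▸ hγ, rfl⟩)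
  exact Finset.mem_product.mpr ⟨Finset.mem_singleton_self m, Finset.mem_product.mpr
    ⟨Finset.mem_range.mpr (show t < N + 1 by omega),
      Finset.mem_range.mpr (show σ < N + 1 by omega)⟩⟩

/-- Every fibre of the exponent on which `s` is bounded is a finite union of parts, up to arcs with
large `ord(x)`. -/
theorem exists_dimLE_fibre_exponent
    (hs : ∀ n, BddAbove (TwistedArc.s '' fibre (liftedSet C) (exponent F) n)) (m n : ℤ) :
    ∃ s : Finset {i : ℤ × ℕ × ℕ // i.1 - partShift p i = m},
      DimLE (twistedSystem k p)
        (fibre (liftedSet C) (exponent F) m \ ⋃ i ∈ s, arcPart C F i) n := by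
  classical
  obtain ⟨B, hB⟩ := hs m
  have ⟨S, hS⟩ : ∃ S : ℕ, B ≤ S := ⟨_, Int.self_le_toNat _⟩
  have ⟨N, hN⟩ : ∃ N : ℕ, (p - 1) * S + 1 - n ≤ N := ⟨_, Int.self_le_toNat _⟩
  refine ⟨(Finset.range (S + N + 1) ×ˢ Finset.range (S + 1)).image fun u =>
    ⟨(m + partShift p (m, u), u), by rw [partShift, partShift]; ring⟩,
    (dimLE_ordX_twisted S N).mono ?_ (by omega)⟩
  rintro γ ⟨⟨⟨hγC, ha⟩, hγm⟩, hγ⟩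
  have hsS : γ.s ≤ S := (hB ⟨γ, ⟨⟨hγC, ha⟩, hγm⟩, rfl⟩).trans hS
  by_contra hx
  simp only [Set.mem_ofPred_eq, hsS, true_and, not_forall] at hx
  obtain ⟨j, hj, hne⟩ := hx
  obtain ⟨t, σ, hσ, he, hγ'⟩ := mem_arcPart (F := F) hγC ha
  have hle : γ.ordX ≤ j := HahnSeries.order_le_of_coeff_ne_zero hne
  have hF : F (psi γ) = m + partShift p (m, t, σ) := by
    have h2 := (arcPart_subset _ hγ').2
    rw [hγm] at h2
    have h3 : partShift p (F (psi γ), t, σ) = partShift p (m, t, σ) := rfl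
    omega
  refine hγ (Set.mem_iUnion₂.mpr ⟨⟨(F (psi γ), t, σ), ?_⟩, ?_, hγ'⟩)
  · rw [hF, partShift, partShift]
    ring
  · refine Finset.mem_image.mpr ⟨(t, σ), ?_, Subtype.ext ?_⟩
    · simp only [Finset.mem_product, Finset.mem_range]
      omega
    · exact congrArg (fun ν => (ν, t, σ)) hF.symm

/-! ### Measurability of the exponent -/

/-- On measurable sets of twisted arcs `s` is bounded, since it is bounded on cylinders. -/
theorem bddAbove_s_of_isMeasurableSet {A : Set (TwistedArc k p)}
    (hA : IsMeasurableSet (twistedSystem k p) A) : BddAbove (TwistedArc.s '' A) := by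
  have hp : (0 : ℤ) < p := by exact_mod_cast (Fact.out : p.Prime).pos
  obtain ⟨C, hC, l, B, hB, hAB, -⟩ := isMeasurableSet_iff.mp hA 0
  obtain ⟨l, h⟩ := isRegularSystem_twistedSystem.isCyl_union hC ⟨l, hB⟩
  obtain ⟨m, n, j⟩ := l
  refine ⟨j, ?_⟩
  rintro _ ⟨γ, hγ, rfl⟩
  have hγ' : γ ∈ C ∪ B := by
    by_cases h' : γ ∈ C
    · exact Or.inl h'
    · exact Or.inr (hAB (Or.inl ⟨hγ, h'⟩))
  refine poleOrder_le_iff.mpr ⟨by omega, fun i hi => h.1 hγ' i ?_⟩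
  change i < -(j : ℤ)
  nlinarith

/-- Where `s` is bounded, the fibres of the exponent are made up of measurable parts. -/
theorem isMeasurableFun_exponent_iff (hF : IsMeasurableFun (quotientSystem k p) C F) :
    IsMeasurableFun (twistedSystem k p) (liftedSet C) (exponent F) ↔
      ∀ n, BddAbove (TwistedArc.s '' fibre (liftedSet C) (exponent F) n) := by
  refine ⟨fun h n => bddAbove_s_of_isMeasurableSet (h n), fun hs n => ?_⟩
  exact (isRegularSystem_twistedSystem.hasSum_measure
    (P := fun i : {i : ℤ × ℕ × ℕ // i.1 - partShift p i = n} => arcPart C F i)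
    (fun i => (isMeasurableSet_arcPart hF i).1)
    (fun i j hij => pairwise_disjoint_arcPart fun he => hij (Subtype.ext he))
    (fun i => (arcPart_subset i.1).trans_eq (by rw [i.2])) (exists_dimLE_fibre_exponent hs n) ∅).1

/-! ### Comparison of the integrals -/

/-- Both integrals are the sum of the same terms over the parts. -/
theorem hasIntegral_iff_hasIntegral_exponent (hF : IsMeasurableFun (quotientSystem k p) C F)
    (h : IsMeasurableFun (twistedSystem k p) (liftedSet C) (exponent F))
    (E : Set (FreeCommRing (Variety k))) (m : Completed E) :
    HasIntegral E (quotientSystem k p) C F m ↔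
      HasIntegral E (twistedSystem k p) (liftedSet C) (exponent F) m := by
  have hs := (isMeasurableFun_exponent_iff hF).mp h
  rw [isRegularSystem_quotientSystem.hasIntegral_iff (isMeasurableSet_image_arcPart hF)
      pairwise_disjoint_image_arcPart image_arcPart_subset exists_dimLE_fibre,
    isRegularSystem_twistedSystem.hasIntegral_iff (fun i => (isMeasurableSet_arcPart hF i).1)
      pairwise_disjoint_arcPart arcPart_subset]
  · have hm := fun i => (isMeasurableSet_arcPart hF i).2 E
    simp only [hm]
    refine and_congr_left fun _ => forall_congr' fun N => ?_
    have : ∀ i : ℤ × ℕ × ℕ, N - i.1 + partShift p i = N - (i.1 - partShift p i) :=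
      fun i => by ring
    simp only [dimLE_image_arcPart, this]
  · intro m n
    classical
    obtain ⟨s, hs⟩ := exists_dimLE_fibre_exponent hs m n
    refine ⟨s.map (Function.Embedding.subtype _),
      hs.mono (fun γ hγ => ⟨hγ.1, fun hγ' => ?_⟩) le_rfl⟩
    obtain ⟨i, hi, hγi⟩ := Set.mem_iUnion₂.mp hγ'
    exact hγ.2 (Set.mem_iUnion₂.mpr ⟨i, Finset.mem_map_of_mem _ hi, hγi⟩)

theorem integral_congr {X X' : Type v} {S : TruncationSystem k X} {S' : TruncationSystem k X'}
    {E : Set (FreeCommRing (Variety k))} {A : Set X} {A' : Set X'} {f : X → ℤ} {f' : X' → ℤ}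
    (h : ∀ m, HasIntegral E S A f m ↔ HasIntegral E S' A' f' m) :
    integral E S A f = integral E S' A' f' := by
  have h' : HasIntegral E S A f = HasIntegral E S' A' f' := funext fun m => propext (h m)
  unfold integral
  rw [h']

theorem HasIntegral.integral_eq {X : Type v} {S : TruncationSystem k X}
    {E : Set (FreeCommRing (Variety k))} {A : Set X} {f : X → ℤ} {m : Completed E}
    (h : HasIntegral E S A f m) : integral E S A f = (m : WithTop (Completed E)) := by
  have h' : ∃ m, HasIntegral E S A f m := ⟨m, h⟩
  rw [integral, dif_pos h', h'.choose_spec.2.2.unique h.2.2]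

/-! ### The stringy invariant -/

/-- The space of arcs of `V/G` is a cylinder, which is mapped onto the affine plane. -/
theorem isCyl_univ_quotient :
    IsCylinder (quotientSystem k p) (quotientLevel k p 0) Set.univ ∧
      (quotientSystem k p).trunc (quotientLevel k p 0) '' Set.univ = Set.univ := by
  have := (quotientSystem k p).finite_coord (quotientLevel k p 0)
  have h : ∀ δ : QuotientArc k p, δ ∈ Set.univ ↔
      δ ∈ (quotientSystem k p).domain (quotientLevel k p 0) ∧
        (quotientSystem k p).trunc (quotientLevel k p 0) δ ∈ Set.univ :=
    fun δ => ⟨fun _ => ⟨trivial, trivial⟩, fun _ => trivial⟩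
  exact ⟨isCylinder_of_mem_iff (quotientSystem_surjective _) isConstructibleSet_univ h,
    image_trunc_eq (quotientSystem_surjective _) h⟩

theorem measure_univ_quotient (E : Set (FreeCommRing (Variety k))) :
    measure E (quotientSystem k p) Set.univ = toCompleted E (lefschetzPow E 2) := by
  obtain ⟨h, h'⟩ := isCyl_univ_quotient (k := k) (p := p)
  have := (quotientSystem k p).finite_coord (quotientLevel k p 0)
  have hc : Nat.card ((quotientSystem k p).Coord (quotientLevel k p 0)) = 2 := by
    change Nat.card (Fin 2 × Fin (0 + 1)) = 2
    simp
  rw [isRegularSystem_quotientSystem.measure_eq ⟨_, h⟩, isRegularSystem_quotientSystem.vol_eq h,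
    volAt, h', (hasClass_univ (k := k) E).constructibleClass_eq E, classOf_affineVariety, hc,
    ← lefschetzPow_natCast]
  change toCompleted E (lefschetzPow E 2 * lefschetzPow E (-(2 * (0 : ℕ)))) = _
  rw [← lefschetzPow_add]
  rfl

theorem hasIntegral_univ_quotient (E : Set (FreeCommRing (Variety k))) :
    HasIntegral E (quotientSystem k p) Set.univ (fun _ => 0)
      (toCompleted E (lefschetzPow E 2)) := by
  have hm := isRegularSystem_quotientSystem.isMeasurableSet_of_isCyl
    ⟨_, (isCyl_univ_quotient (k := k) (p := p)).1⟩
  refine (isRegularSystem_quotientSystem.hasIntegral_iff (ι := Unit) (d := fun _ => 0)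
    (P := fun _ => Set.univ) (fun _ => hm) (fun i j hij => (hij rfl).elim)
    (fun _ δ _ => ⟨trivial, rfl⟩) (fun m n => ⟨{()}, ?_⟩) E _).mpr ⟨fun N => Set.toFinite _, ?_⟩
  · exact (isRegularSystem_quotientSystem.dimLE_empty n).mono (fun δ hδ => (hδ.2
      (Set.mem_iUnion₂.mpr ⟨(), Finset.mem_singleton_self _, trivial⟩)).elim) le_rfl
  · have h : mulLefschetz E 0 (measure E (quotientSystem k p) Set.univ) =
        toCompleted E (lefschetzPow E 2) := by
      rw [measure_univ_quotient]
      refine Completed.ext_proj fun N => (proj_mulLefschetz rfl).trans ?_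
      rw [lefschetzPow_zero, mul_one]
      rfl
    rw [← h]
    exact hasSum_unique _

omit [IsAlgClosed k] [Fact p.Prime] [CharP k p] in
theorem ordIdeal_top (δ : QuotientArc k p) : ordIdeal ⊤ δ = 0 := by
  refine le_antisymm (iInf₂_le_of_le 1 trivial ?_) bot_le
  rw [map_one, PowerSeries.order_one]

/-- As the Jacobian ideal is the unit ideal, its order along all arcs is zero. -/
theorem stringyInvariant_eq (E : Set (FreeCommRing (Variety k))) :
    stringyInvariant k p E = integral E (quotientSystem k p) Set.univ (fun _ => 0) := by
  unfold stringyInvariant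
  simp only [omegaJacobian_eq_top, ordIdeal_top]
  congr 1
  ext δ
  simp

end Integrals

end AlphaP

open AlphaP in
theorem theorem6p2 {k : Type u} [Field k] [IsAlgClosed k] (p : ℕ) [Fact p.Prime] [CharP k p]
    (E : Set (FreeCommRing (Variety k))) :
    (∀ (C : Set (QuotientArc k p)) (F : QuotientArc k p → ℤ),
      IsMeasurableFun (quotientSystem k p) C F →
      (IsMeasurableFun (twistedSystem k p) (liftedSet C) (exponent F) ↔
        ∀ n, BddAbove (TwistedArc.s '' fibre (liftedSet C) (exponent F) n)) ∧
      (IsMeasurableFun (twistedSystem k p) (liftedSet C) (exponent F) →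
        integral E (quotientSystem k p) C F =
          integral E (twistedSystem k p) (liftedSet C) (exponent F))) ∧
    ((toCompleted E (lefschetzPow E 2) : Completed E) : WithTop (Completed E)) =
      stringyInvariant k p E ∧
    stringyInvariant k p E = integral E (quotientSystem k p) Set.univ (fun _ => 0) ∧
    integral E (quotientSystem k p) Set.univ (fun _ => 0) =
      integral E (twistedSystem k p) (liftedSet Set.univ)
        (fun γ => -γ.s - (p - 1) * γ.ordX) := by
  have h2 : ∀ (C : Set (QuotientArc k p)) (F : QuotientArc k p → ℤ),
      IsMeasurableFun (quotientSystem k p) C F →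
      IsMeasurableFun (twistedSystem k p) (liftedSet C) (exponent F) →
      integral E (quotientSystem k p) C F =
        integral E (twistedSystem k p) (liftedSet C) (exponent F) := fun C F hF h =>
    integral_congr fun m => hasIntegral_iff_hasIntegral_exponent hF h E m
  have huniv := hasIntegral_univ_quotient (k := k) (p := p) E
  refine ⟨fun C F hF => ⟨isMeasurableFun_exponent_iff hF, h2 C F hF⟩, ?_, stringyInvariant_eq E, ?_⟩
  · rw [stringyInvariant_eq, huniv.integral_eq]
  · have he : exponent (fun _ : QuotientArc k p => (0 : ℤ)) =
        fun γ : TwistedArc k p => -γ.s - (p - 1) * γ.ordX := by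
      funext γ
      rw [exponent, zero_sub]
    rw [← he]
    refine h2 _ _ huniv.1 ((isMeasurableFun_exponent_iff huniv.1).mpr fun n => ⟨-n, ?_⟩)
    -- both `s` and `ord(x)` are nonnegative, so the fibre over `n` lies in `s ≤ -n`
    rintro _ ⟨γ, ⟨-, hγ⟩, rfl⟩
    have hp : (0 : ℤ) ≤ p - 1 := by
      have : (1 : ℤ) ≤ p := by exact_mod_cast (Fact.out : p.Prime).pos
      omega
    have hx : 0 ≤ (p - 1 : ℤ) * γ.ordX := mul_nonneg hp (order_nonneg_of_coeff γ.a_nonneg)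
    rw [exponent] at hγ
    linarith
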